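/- **Setting.** Let $N\ge 0$ and let $V$ be a complex superspace with an ordered homogeneous basis $v_1,\dots,v_N$ of parities $\bar 1,\dots,\bar N\in\mathbb Z_2$ (we write $\bar i$ for the parity of $v_i$). Put $i'=N+1-i$; assume $\overline{i'}=\bar i$ for all $i$ and that the odd part of $V$ is even-dimensional. Let $\vartheta_i\in\{\pm1\}$ with $\vartheta_i=1$ if $\bar i=\bar 0$ and $\vartheta_i=-\vartheta_{i'}$ if $\bar i=\bar 1$. Let $\varepsilon_1,\dots,\varepsilon_N$ be the weights of $\mathfrak{osp}(V)$ on $v_1,\dots,v_N$, so $\varepsilon_{i'}=-\varepsilon_i$, with the bilinear form $(\varepsilon_i,\varepsilon_j)=\delta_{ij}(-1)^{\bar i}$ for $1\le i,j\le\lfloor N/2\rfloor$. The positive roots are $\varepsilon_a-\varepsilon_b$ ($a<b<a'$), of parity $\bar a+\bar b$, and $2\varepsilon_a$ ($a<a'$, $\bar a=\bar 1$), which are even. Let $\rho$ be half the sum of the even positive roots minus half the sum of the odd positive roots. Over $\mathbb C(q)$ put $$R=q^{-1}\sum_{i,j}q^{-(\varepsilon_i,\varepsilon_j)}E_{ii}\otimes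 E_{jj}-(q-q^{-1})q^{-1}\sum_{i<j}(-1)^{\bar j}E_{ij}\otimes\Big(E_{ji}-(-1)^{\bar j(\bar i+\bar j)}\vartheta_i\vartheta_j\,q^{(\rho,\varepsilon_i-\varepsilon_j)-\frac12(\varepsilon_i,\varepsilon_i)+\frac12(\varepsilon_j,\varepsilon_j)}E_{i'j'}\Big).$$ (The exponents are integers.) Let $U(R)$ be the $\mathbb C(q)$-superalgebra generated by $l^+_{ij},\,l^-_{ji}$ ($1\le i\le j\le N$), where $l^\pm_{ij}$ has parity $\bar i+\bar j$, with the following relations, in which $L^\pm=\sum_{i,j} l^\pm_{ij}\otimes E_{ij}$ and $l^+_{ij}=0=l^-_{ji}$ for $i>j$: $$l^\pm_{ii}l^\mp_{ii}=1,\qquad R_{12}L^\pm_1L^\pm_2=L^\pm_2L^\pm_1R_{12},\qquad R_{12}L^+_1L^-_2=L^-_2L^+_1R_{12}.$$ The matrix equations are understood coefficientwise in the super tensor product with $\mathrm{End}(V)^{\otimes2}$, where $E_{ij}$ has parity $\bar i+\bar j$. Let $U^+(R)$, respectively $U^-(R)$, be the superalgebra generated by the $l^+_{ij}$, respectively the $l^-_{ji}$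 ($i\le j$), with only the relations $R_{12}L^\pm_1L^\pm_2=L^\pm_2L^\pm_1R_{12}$ of that sign. It is a superbialgebra with $$\Delta(l^\pm_{ij})=\sum_k(-1)^{(\bar i+\bar k)(\bar k+\bar j)}l^\pm_{ik}\otimes l^\pm_{kj},\qquad \epsilon(l^\pm_{ij})=\delta_{ij}.$$ A *skew-pairing* of superbialgebras $A,B$ over a field $\mathbb K$ is an even bilinear map $(\cdot,\cdot)\colon A\otimes B\to\mathbb K$ such that $$(1,b)=\epsilon(b),\quad (a,1)=\epsilon(a),\quad (aa',b)=(a\otimes a',\Delta(b)),\quad (a,bb')=(\Delta^{\mathrm{op}}(a),b\otimes b'),$$ where $(a\otimes a',b\otimes b')=(-1)^{|a'||b|}(a,b)(a',b')$. The convolution of even bilinear maps is $(\phi\star\psi)(a\otimes b)=\sum(-1)^{|a_2||b_1|}\phi(a_1\otimes b_1)\psi(a_2\otimes b_2)$, with unit $\epsilon\otimes\epsilon$. If a skew-pairing has a convolution inverse $(\cdot,\cdot)'$, the *generalized double* $\mathcal D(A,B)$ is the superspace $A\otimes B$ with unit $1\otimes1$ and with the associative multiplication $(a\otimes b)(a'\otimes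 b')=(a\otimes1)\cdot\big((1\otimes b)(a'\otimes1)\big)\cdot(1\otimes b')$, where $(a\otimes1)(x\otimes y)(1\otimes b')=ax\otimes yb'$ and $$(1\otimes b)(a\otimes1)=\sum(-1)^{(|a|-|a_3|)(|b|-|b_1|)+|b_1|+|a_3|}(a_1,b_1)(a_3,b_3)'\,a_2\otimes b_2 .$$ **Proposition.** (a) There is a unique skew-pairing $(\cdot,\cdot)_R\colon U^+(R)\times U^-(R)\to\mathbb C(q)$ such that $$\sum_{1\le i,j,k,l\le N}(-1)^{(\bar i+\bar j)(\bar k+\bar l)}(l^+_{ij},l^-_{kl})_R\,E_{ij}\otimes E_{kl}=R.$$ (b) This skew-pairing is convolution invertible, so that the generalized double $\mathcal D_R=\mathcal D(U^+(R),U^-(R))$ is defined (the above multiplication is associative with unit $1\otimes 1$). The superalgebra $U(R)$ is isomorphic to the quotient of $\mathcal D_R$ by the relations $l^\pm_{ii}l^\mp_{ii}=1$, $1\le i\le N$, by an isomorphism of superalgebras that sends the classes of $l^+_{ij}\otimes1$ and $1\otimes l^-_{ij}$ to $l^+_{ij}$ and $l^-_{ij}$. -/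

import Mathlib

open scoped TensorProduct DirectSum

namespace OspRTT

noncomputable section

/-! ### Signs and superspaces -/

/-- The sign `(-1)^x` of `x ∈ ℤ/2`, as an element of a ring. -/
def sgn (K : Type*) [Ring K] (x : ZMod 2) : K := if x = 0 then 1 else -1

theorem sgn_zero {K : Type*} [Ring K] : sgn K 0 = 1 := by simp [sgn]

theorem sgn_one {K : Type*} [Ring K] : sgn K 1 = -1 := by simp [sgn]

theorem zmod2_cases (x : ZMod 2) : x = 0 ∨ x = 1 := by revert x; decide

theorem sgn_add {K : Type*} [Ring K] (x y : ZMod 2) : sgn K (x + y) = sgn K x * sgn K y := by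
  rcases zmod2_cases x with rfl | rfl <;> rcases zmod2_cases y with rfl | rfl <;>
    simp [sgn_zero, sgn_one, show (1 + 1 : ZMod 2) = 0 from rfl]

theorem sgn_mul_self {K : Type*} [Ring K] (x : ZMod 2) : sgn K x * sgn K x = 1 := by
  rcases zmod2_cases x with rfl | rfl <;> simp [sgn_zero, sgn_one]

theorem uzpow_smul_eq {K : Type*} [Ring K] {M : Type*} [AddCommGroup M] [Module K M]
    (x : ZMod 2) (v : M) : ((-1 : ℤˣ) ^ x) • v = sgn K x • v := by
  rcases zmod2_cases x with rfl | rfl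
  · simp [sgn_zero]
  · simp [sgn_one, Units.smul_def]

section Parity

variable {K : Type*} [Field K] {A : Type*} [Ring A] [Algebra K A]

/-- The `ℤ/2`-grading of an algebra attached to a parity involution `θ`: the component of degree
`i` is `{a | θ a = (-1)^i a}`. -/
def parityGrading (θ : A →ₐ[K] A) (i : ZMod 2) : Submodule K A :=
  LinearMap.ker (θ.toLinearMap - sgn K i • LinearMap.id)

theorem mem_parityGrading {θ : A →ₐ[K] A} {i : ZMod 2} {a : A} :
    a ∈ parityGrading θ i ↔ θ a = sgn K i • a := by
  simp [parityGrading, sub_eq_zero]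

/-- The projection onto the component of degree `i`. -/
def parityProj (θ : A →ₐ[K] A) (hθ : ∀ a, θ (θ a) = a) (i : ZMod 2) :
    A →ₗ[K] parityGrading θ i :=
  LinearMap.codRestrict (parityGrading θ i)
    ((2⁻¹ : K) • (LinearMap.id + sgn K i • θ.toLinearMap)) (fun a => by
      simp only [mem_parityGrading, LinearMap.smul_apply, LinearMap.add_apply, LinearMap.id_apply,
        AlgHom.toLinearMap_apply, map_smul, map_add, hθ, smul_add]
      rw [smul_comm (sgn K i) (2⁻¹ : K) (sgn K i • θ a), smul_smul (sgn K i) (sgn K i),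
        sgn_mul_self, one_smul, smul_comm (sgn K i) (2⁻¹ : K) a, add_comm])

theorem parityProj_coe (θ : A →ₐ[K] A) (hθ : ∀ a, θ (θ a) = a) (i : ZMod 2) (a : A) :
    (parityProj θ hθ i a : A) = (2⁻¹ : K) • (a + sgn K i • θ a) := rfl

/-- If `θ` is an involution, `parityGrading θ` is an algebra grading. -/
@[reducible]
def parityGradedAlgebra [CharZero K] (θ : A →ₐ[K] A) (hθ : ∀ a, θ (θ a) = a) :
    GradedAlgebra (parityGrading θ) where
  one_mem := by simp [mem_parityGrading, sgn_zero]
  mul_mem i j a b ha hb := by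
    rw [mem_parityGrading] at *
    rw [map_mul, ha, hb, sgn_add, smul_mul_smul_comm]
  toDecomposition := DirectSum.Decomposition.ofLinearMap _
    (DirectSum.lof K (ZMod 2) (fun i => parityGrading θ i) 0 ∘ₗ parityProj θ hθ 0 +
      DirectSum.lof K (ZMod 2) (fun i => parityGrading θ i) 1 ∘ₗ parityProj θ hθ 1)
    (by
      ext a
      simp only [LinearMap.comp_apply, LinearMap.add_apply, map_add, DirectSum.coeLinearMap_lof,
        parityProj_coe, sgn_zero, sgn_one, LinearMap.id_apply]
      rw [← smul_add, one_smul, neg_one_smul, add_add_add_comm, add_neg_cancel, add_zero,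
        ← two_smul K a, smul_smul]
      simp)
    (by
      have h2 (a : A) : (2⁻¹ : K) • (a + a) = a := by rw [← two_smul K a, smul_smul]; simp
      ext i ⟨a, ha⟩ : 2
      have ha' := mem_parityGrading.1 ha
      simp only [LinearMap.comp_apply, LinearMap.add_apply, DirectSum.coeLinearMap_lof,
        LinearMap.id_apply]
      rcases zmod2_cases i with rfl | rfl
      · have e0 : parityProj θ hθ 0 a = ⟨a, ha⟩ := by
          ext; simp only [parityProj_coe, ha', sgn_zero, one_smul, h2]
        have e1 : parityProj θ hθ 1 a = 0 := by
          ext; simp [parityProj_coe, ha', sgn_zero, sgn_one]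
        rw [e0, e1, map_zero, add_zero]
      · have e0 : parityProj θ hθ 0 a = 0 := by
          ext; simp [parityProj_coe, ha', sgn_zero, sgn_one]
        have e1 : parityProj θ hθ 1 a = ⟨a, ha⟩ := by
          ext; simp only [parityProj_coe, ha', sgn_one, neg_one_smul, neg_neg, h2]
        rw [e0, e1, map_zero, zero_add])

end Parity

/-! ### The orthosymplectic `R`-matrix -/

/-- The ground field `ℂ(q)`. -/
abbrev Kq : Type := RatFunc ℂ

/-- The indeterminate `q`. -/
abbrev q : Kq := RatFunc.X

/-- The data of an ordered homogeneous basis `v_1, …, v_N` of `V`, with parities `par i`, and of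
the signs `ϑ_i` fixing the orthosymplectic form. The involution `i ↦ i' = N + 1 - i` is `Fin.rev`.
The odd part of `V` has even dimension. -/
structure OspDatum (N : ℕ) where
  par : Fin N → ZMod 2
  par_rev : ∀ i, par i.rev = par i
  even_card_odd : Even (Finset.univ.filter fun i => par i = 1).card
  theta : Fin N → ℤˣ
  theta_even : ∀ i, par i = 0 → theta i = 1
  theta_odd : ∀ i, par i = 1 → theta i = -theta i.rev

/-- The weight `ε_i` of the Cartan subalgebra of `osp(V)`, recorded by its values
`δ_{ki} - δ_{ki'}` on the diagonal matrices `X_kk = E_kk - E_k'k'`. -/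
def eps {N : ℕ} (i : Fin N) : Fin N → ℤ :=
  fun k => (if k = i then 1 else 0) - (if k = i.rev then 1 else 0)

namespace OspDatum

variable {N : ℕ} (D : OspDatum N)

/-- The bilinear form on weights, with `(ε_i, ε_j) = δ_ij (-1)^{|i|}` for `i, j ≤ ⌊N/2⌋`. -/
def form (μ ν : Fin N → ℤ) : ℤ :=
  ∑ k with k < Fin.rev k, sgn ℤ (D.par k) * μ k * ν k

/-- Twice the Weyl vector, `2ρ = ∑ (even positive roots) - ∑ (odd positive roots)`. The positive
roots are `ε_a - ε_b` for `a < b < a'`, of parity `|a| + |b|`, and `2ε_a` for `a < a'`, `a` odd,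
which are even. -/
def twoRho : Fin N → ℤ :=
  (∑ a, ∑ b with a < b ∧ b < Fin.rev a, sgn ℤ (D.par a + D.par b) • (eps a - eps b)) +
    ∑ a with a < Fin.rev a ∧ D.par a = 1, 2 • eps a

/-- The exponent `(ρ, ε_i - ε_j) - (ε_i, ε_i)/2 + (ε_j, ε_j)/2`; it is an integer, see
`two_mul_rExp`. -/
def rExp (i j : Fin N) : ℤ :=
  (D.form D.twoRho (eps i - eps j) - D.form (eps i) (eps i) + D.form (eps j) (eps j)) / 2

/-- The coefficient of `E_ij ⊗ E_kl` in the `R`-matrix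
`q^{-1} ∑_{i,k} q^{-(ε_i, ε_k)} E_ii ⊗ E_kk - (q - q^{-1}) q^{-1} ∑_{i<j} (-1)^{|j|} E_ij ⊗
(E_ji - (-1)^{|j|(|i|+|j|)} ϑ_i ϑ_j q^{(ρ, ε_i - ε_j) - (ε_i, ε_i)/2 + (ε_j, ε_j)/2} E_i'j')`. -/
def R (i j k l : Fin N) : Kq :=
  (if i = j ∧ k = l then q⁻¹ * q ^ (-D.form (eps i) (eps k)) else 0) -
    (if i < j then
      (q - q⁻¹) * q⁻¹ * sgn Kq (D.par j) *
        ((if k = j ∧ l = i then 1 else 0) -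
          (if k = i.rev ∧ l = j.rev then
            sgn Kq (D.par j * (D.par i + D.par j)) * ((D.theta i * D.theta j : ℤˣ) : ℤ) *
              q ^ D.rExp i j
          else 0))
    else 0)

theorem R_even {i j k l : Fin N} (h : D.R i j k l ≠ 0) :
    D.par i + D.par j + D.par k + D.par l = 0 := by
  by_contra hne
  apply h
  have aux (x y : ZMod 2) : x + x + y + y = 0 := by revert x y; decide
  have aux2 (x y : ZMod 2) : x + y + y + x = 0 := by revert x y; decide
  have aux3 (x y : ZMod 2) : x + y + x + y = 0 := by revert x y; decide
  have h1 : ¬(i = j ∧ k = l) := by rintro ⟨rfl, rfl⟩; exact hne (aux _ _)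
  have h2 : ¬(k = j ∧ l = i) := by rintro ⟨rfl, rfl⟩; exact hne (aux2 _ _)
  have h3 : ¬(k = i.rev ∧ l = j.rev) := by
    rintro ⟨rfl, rfl⟩; rw [D.par_rev, D.par_rev] at hne; exact hne (aux3 _ _)
  simp [R, h1, h2, h3]

end OspDatum

theorem eps_cast {N : ℕ} (i k : Fin N) (hk : k < k.rev) : ((eps i k : ℤ) : ZMod 2) =
    if i = k ∨ i = k.rev then 1 else 0 := by
  have h1 : k = i.rev ↔ i = k.rev := by
    constructor
    · rintro rfl; simp
    · rintro rfl; simp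
  have hne : k ≠ k.rev := hk.ne
  by_cases ha : i = k
  · subst ha
    simp [eps, hne]
  · by_cases hb : i = k.rev
    · simp [eps, hb, hne]
    · have : k ≠ i := fun h => ha h.symm
      simp [eps, h1, hb, ha, this]

theorem sgn_cast (x : ZMod 2) : ((sgn ℤ x : ℤ) : ZMod 2) = 1 := by
  rcases zmod2_cases x with rfl | rfl
  · simp [sgn_zero]
  · simp [sgn_one]

theorem eps_rev {N : ℕ} (i : Fin N) : eps i.rev = -eps i := by
  ext k; simp [eps]

namespace OspDatum

variable {N : ℕ} (D : OspDatum N)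

theorem sum_eps_eq_zero (a : Fin N) :
    ∑ b with a < b ∧ b < Fin.rev a, sgn ℤ (D.par a + D.par b) • eps b = 0 := by
  have h : ∑ b with a < b ∧ b < Fin.rev a, sgn ℤ (D.par a + D.par b) • eps b =
      ∑ b with a < b ∧ b < Fin.rev a, sgn ℤ (D.par a + D.par b) • -eps b := by
    refine Finset.sum_bij' (fun b _ => b.rev) (fun b _ => b.rev) ?_ ?_ ?_ ?_ ?_
    · intro b hb
      simp only [Finset.mem_filter, Finset.mem_univ, true_and] at hb ⊢
      exact ⟨by rw [Fin.lt_rev_iff]; exact hb.2, by rw [Fin.rev_lt_rev]; exact hb.1⟩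
    · intro b hb
      simp only [Finset.mem_filter, Finset.mem_univ, true_and] at hb ⊢
      exact ⟨by rw [Fin.lt_rev_iff]; exact hb.2, by rw [Fin.rev_lt_rev]; exact hb.1⟩
    · intro b _; simp
    · intro b _; simp
    · intro b _; rw [D.par_rev, eps_rev, neg_neg]
  simp only [smul_neg, Finset.sum_neg_distrib] at h
  exact self_eq_neg.1 h

theorem card_aux (k : Fin N) (hk : k < k.rev) :
    (((Finset.univ.filter fun b => k < b ∧ b < Fin.rev k).card : ℕ) : ZMod 2) = N := by
  have : (Finset.univ.filter fun b => k < b ∧ b < Fin.rev k) = Finset.Ioo k k.rev := by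
    ext; simp
  rw [this, Fin.card_Ioo]
  have h : (k.rev : ℕ) - k - 1 + 2 * (k + 1) = N := by
    have := Fin.val_rev k
    have := Fin.lt_def.1 hk
    omega
  have h2 : (2 : ZMod 2) = 0 := rfl
  have h3 := congrArg (Nat.cast (R := ZMod 2)) h
  push_cast at h3
  rw [h2, zero_mul, add_zero] at h3
  exact h3

theorem twoRho_cast (k : Fin N) (hk : k < k.rev) : ((D.twoRho k : ℤ) : ZMod 2) = N := by
  have hne : k ≠ k.rev := hk.ne
  unfold twoRho
  simp only [smul_sub, Finset.sum_sub_distrib, sum_eps_eq_zero, sub_zero, Pi.add_apply,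
    Finset.sum_apply, Pi.smul_apply, smul_eq_mul, Int.cast_add, Int.cast_sum,
    Int.cast_mul, sgn_cast, eps_cast _ k hk]
  rw [Finset.sum_eq_zero (s := Finset.univ.filter fun x => x < Fin.rev x ∧ D.par x = 1)
    (fun x _ => by
      rw [two_nsmul, Int.cast_add]; exact CharTwo.add_self_eq_zero _), add_zero]
  simp only [one_mul, Finset.sum_const, nsmul_eq_mul]
  rw [Finset.sum_eq_single k]
  · simp [card_aux k hk]
  · intro b _ hb
    by_cases hb' : b = k.rev
    · subst hb'
      have : (Finset.univ.filter fun b => k.rev < b ∧ b < Fin.rev k.rev) = ∅ := by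
        ext b
        simp only [Fin.rev_rev, Finset.mem_filter, Finset.mem_univ, true_and, Finset.notMem_empty,
          iff_false, not_and, not_lt]
        intro h
        exact (hk.trans h).le
      rw [this]; simp
    · simp [hb, hb']
  · simp

theorem form_cast (μ ν : Fin N → ℤ) : ((D.form μ ν : ℤ) : ZMod 2) =
    ∑ k with k < Fin.rev k, ((μ k : ℤ) : ZMod 2) * ((ν k : ℤ) : ZMod 2) := by
  simp [form, sgn_cast]

theorem two_mul_rExp (i j : Fin N) : 2 * D.rExp i j =
    D.form D.twoRho (eps i - eps j) - D.form (eps i) (eps i) + D.form (eps j) (eps j) := by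
  refine Int.mul_ediv_cancel' ?_
  refine (ZMod.intCast_zmod_eq_zero_iff_dvd _ 2).1 ?_
  have hsq (i : Fin N) : ((D.form (eps i) (eps i) : ℤ) : ZMod 2) =
      ∑ k with k < Fin.rev k, ((eps i k : ℤ) : ZMod 2) := by
    rw [form_cast]
    refine Finset.sum_congr rfl fun k _ => ?_
    generalize ((eps i k : ℤ) : ZMod 2) = x
    revert x; decide
  have hone (i : Fin N) : ((N : ZMod 2) - 1) *
      ∑ k with k < Fin.rev k, ((eps i k : ℤ) : ZMod 2) = (N : ZMod 2) - 1 := by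
    by_cases hi : i = i.rev
    · have hN : (N : ZMod 2) = 1 := by
        have h1 : N = 2 * (i : ℕ) + 1 := by
          have h1 := congrArg Fin.val hi
          have h2 := Fin.val_rev i
          have := i.2
          omega
        have h2 : (2 : ZMod 2) = 0 := rfl
        rw [h1]; push_cast; rw [h2]; ring
      rw [hN]; simp
    · suffices ∑ k with k < Fin.rev k, ((eps i k : ℤ) : ZMod 2) = 1 by rw [this, mul_one]
      rcases lt_or_gt_of_ne hi with h | h
      · rw [Finset.sum_eq_single_of_mem i (by simpa using h)]
        · rw [eps_cast i i h]; simp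
        · intro k hk hki
          simp only [Finset.mem_filter, Finset.mem_univ, true_and] at hk
          rw [eps_cast i k hk, if_neg]
          rintro (rfl | rfl)
          · exact hki rfl
          · rw [Fin.rev_rev] at h; exact lt_asymm hk h
      · rw [Finset.sum_eq_single_of_mem i.rev (by simpa using h)]
        · rw [eps_cast i i.rev (by simpa using h)]; simp
        · intro k hk hki
          simp only [Finset.mem_filter, Finset.mem_univ, true_and] at hk
          rw [eps_cast i k hk, if_neg]
          rintro (rfl | rfl)
          · exact lt_asymm hk h
          · simp at hki
  have hrho : ((D.form D.twoRho (eps i - eps j) : ℤ) : ZMod 2) =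
      N * (∑ k with k < Fin.rev k, ((eps i k : ℤ) : ZMod 2) -
        ∑ k with k < Fin.rev k, ((eps j k : ℤ) : ZMod 2)) := by
    rw [form_cast, ← Finset.sum_sub_distrib, Finset.mul_sum]
    refine Finset.sum_congr rfl fun k hk => ?_
    simp only [Finset.mem_filter, Finset.mem_univ, true_and] at hk
    rw [D.twoRho_cast k hk]; simp
  push_cast
  rw [hrho, hsq, hsq]
  linear_combination hone i - hone j

end OspDatum

/-! ### The superalgebras `U^±(R)` and `U(R)`

The coefficients of the matrix equations are taken in `A ⊗ End(V) ⊗ End(V)`, with the Koszul sign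
rule; `E_ij` and `l_ij` have parity `|i| + |j|`. -/

section RLL

variable {N : ℕ} (D : OspDatum N) {A B : Type*} [Ring A] [Algebra Kq A] [Ring B] [Algebra Kq B]

/-- The coefficient of `E_ij ⊗ E_kl` in `R_12 L_1 M_2`, for `L = ∑ l_ij ⊗ E_ij`,
`M = ∑ m_ij ⊗ E_ij`. The terms are `(1 ⊗ E_ia ⊗ E_kb) (l_aj ⊗ E_aj ⊗ 1) (m_bl ⊗ 1 ⊗ E_bl)` with
coefficient the `(ia, kb)`-entry of `R`: moving `m_bl` past `E_aj` and `E_kb` past `E_aj` gives the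
sign `(|a|+|j|)(|b|+|l|) + (|k|+|b|)(|a|+|j|) = (|a|+|j|)(|k|+|l|)`, and `R` is even. -/
def rllLeft (L M : Fin N → Fin N → A) (i j k l : Fin N) : A :=
  ∑ a, ∑ b, (sgn Kq ((D.par a + D.par j) * (D.par k + D.par l)) * D.R i a k b) • (L a j * M b l)

/-- The coefficient of `E_ij ⊗ E_kl` in `M_2 L_1 R_12`. The terms are
`(m_kb ⊗ 1 ⊗ E_kb) (l_ia ⊗ E_ia ⊗ 1) (1 ⊗ E_aj ⊗ E_bl)`: moving `E_kb` past `l_ia` and then past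
`E_ia` gives no sign in total, and moving `E_kb` past `E_aj` gives `(|k|+|b|)(|a|+|j|)`. -/
def rllRight (L M : Fin N → Fin N → A) (i j k l : Fin N) : A :=
  ∑ a, ∑ b, (sgn Kq ((D.par k + D.par b) * (D.par a + D.par j)) * D.R a j b l) • (M k b * L i a)

theorem map_rllLeft (f : A →ₐ[Kq] B) (L M : Fin N → Fin N → A) (i j k l : Fin N) :
    f (rllLeft D L M i j k l) = rllLeft D (fun a b => f (L a b)) (fun a b => f (M a b)) i j k l := by
  simp [rllLeft, map_sum]

theorem map_rllRight (f : A →ₐ[Kq] B) (L M : Fin N → Fin N → A) (i j k l : Fin N) :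
    f (rllRight D L M i j k l) =
      rllRight D (fun a b => f (L a b)) (fun a b => f (M a b)) i j k l := by
  simp [rllRight, map_sum]

/-- `L` with each entry multiplied by the sign of its parity. -/
def signMat (L : Fin N → Fin N → A) (i j : Fin N) : A := sgn Kq (D.par i + D.par j) • L i j

theorem rllLeft_signMat (L M : Fin N → Fin N → A) (i j k l : Fin N) :
    rllLeft D (signMat D L) (signMat D M) i j k l =
      sgn Kq (D.par i + D.par j + D.par k + D.par l) • rllLeft D L M i j k l := by
  simp only [rllLeft, Finset.smul_sum]
  refine Finset.sum_congr rfl fun a _ => Finset.sum_congr rfl fun b _ => ?_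
  by_cases h : D.R i a k b = 0
  · simp [h]
  · have h1 := D.R_even h
    have h2 : D.par i + D.par j + D.par k + D.par l =
        (D.par a + D.par j) + (D.par b + D.par l) := by
      generalize D.par i = i at *; generalize D.par j = j at *; generalize D.par k = k at *
      generalize D.par l = l at *; generalize D.par a = a at *; generalize D.par b = b at *
      revert h1; revert i j k l a b; decide
    rw [h2, sgn_add (K := Kq) (D.par a + D.par j)]
    simp only [signMat, smul_mul_smul_comm, smul_smul]
    congr 1; ring

theorem rllRight_signMat (L M : Fin N → Fin N → A) (i j k l : Fin N) :
    rllRight D (signMat D L) (signMat D M) i j k l =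
      sgn Kq (D.par i + D.par j + D.par k + D.par l) • rllRight D L M i j k l := by
  simp only [rllRight, Finset.smul_sum]
  refine Finset.sum_congr rfl fun a _ => Finset.sum_congr rfl fun b _ => ?_
  by_cases h : D.R a j b l = 0
  · simp [h]
  · have h1 := D.R_even h
    have h2 : D.par i + D.par j + D.par k + D.par l =
        (D.par k + D.par b) + (D.par i + D.par a) := by
      generalize D.par i = i at *; generalize D.par j = j at *; generalize D.par k = k at *
      generalize D.par l = l at *; generalize D.par a = a at *; generalize D.par b = b at *
      revert h1; revert i j k l a b; decide
    rw [h2, sgn_add (K := Kq) (D.par k + D.par b)]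
    simp only [signMat, smul_mul_smul_comm, smul_smul]
    congr 1; ring

end RLL

/-- The shape of `L^±` (`true` is the sign `+`): `L^+` is upper and `L^-` lower triangular. -/
def Tri {N : ℕ} : Bool → Fin N → Fin N → Prop
  | true, i, j => i ≤ j
  | false, i, j => j ≤ i

theorem Tri.trans_or {N : ℕ} {s : Bool} {i j : Fin N} (h : ¬Tri s i j) (k : Fin N) :
    ¬Tri s i k ∨ ¬Tri s k j := by
  cases s <;> simp only [Tri] at * <;> omega

/-- The generators `l^+_ij`, `l^-_ji` for `i ≤ j`, of a fixed sign. -/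
abbrev Gen (N : ℕ) (s : Bool) : Type := {x : Fin N × Fin N // Tri s x.1 x.2}

open Classical in
/-- A triangular matrix from its entries, the other entries being zero. -/
def triMat {N : ℕ} {A : Type*} [Zero A] (s : Bool) (f : Gen N s → A) (i j : Fin N) : A :=
  if h : Tri s i j then f ⟨(i, j), h⟩ else 0

namespace UHalf

variable {N : ℕ} (D : OspDatum N) (s : Bool)

/-- The relations `R_12 L_1 L_2 = L_2 L_1 R_12`, for `L = L^+` or `L = L^-`. -/
inductive Rel : FreeAlgebra Kq (Gen N s) → FreeAlgebra Kq (Gen N s) → Prop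
  | rll (i j k l : Fin N) : Rel
      (rllLeft D (triMat s (FreeAlgebra.ι Kq)) (triMat s (FreeAlgebra.ι Kq)) i j k l)
      (rllRight D (triMat s (FreeAlgebra.ι Kq)) (triMat s (FreeAlgebra.ι Kq)) i j k l)

end UHalf

/-- The algebra `U^+(R)` (`s = true`) or `U^-(R)` (`s = false`). -/
abbrev UHalf {N : ℕ} (D : OspDatum N) (s : Bool) : Type := RingQuot (UHalf.Rel D s)

namespace UHalf

variable {N : ℕ} (D : OspDatum N) (s : Bool)

/-- The entries `l^±_ij` of the matrix `L^±`. -/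
def gen (i j : Fin N) : UHalf D s :=
  triMat s (fun x => RingQuot.mkAlgHom Kq (Rel D s) (FreeAlgebra.ι Kq x)) i j

theorem gen_of_tri {i j : Fin N} (h : Tri s i j) :
    gen D s i j = RingQuot.mkAlgHom Kq (Rel D s) (FreeAlgebra.ι Kq ⟨(i, j), h⟩) := dif_pos h

theorem gen_eq_zero {i j : Fin N} (h : ¬Tri s i j) : gen D s i j = 0 := dif_neg h

theorem mk_triMat (i j : Fin N) : RingQuot.mkAlgHom Kq (Rel D s)
    (triMat s (FreeAlgebra.ι Kq) i j) = gen D s i j := by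
  by_cases h : Tri s i j
  · rw [gen_of_tri D s h, triMat, dif_pos h]
  · rw [gen_eq_zero D s h, triMat, dif_neg h, map_zero]

theorem gen_rel (i j k l : Fin N) :
    rllLeft D (gen D s) (gen D s) i j k l = rllRight D (gen D s) (gen D s) i j k l := by
  have h := RingQuot.mkAlgHom_rel Kq (Rel.rll (D := D) (s := s) i j k l)
  rw [map_rllLeft, map_rllRight] at h
  simp only [mk_triMat] at h
  exact h

variable {D s} {A : Type*} [Ring A] [Algebra Kq A]

/-- The universal property of `U^±(R)`. -/
def lift (M : Fin N → Fin N → A) (h0 : ∀ i j, ¬Tri s i j → M i j = 0)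
    (hM : ∀ i j k l, rllLeft D M M i j k l = rllRight D M M i j k l) : UHalf D s →ₐ[Kq] A :=
  RingQuot.liftAlgHom Kq ⟨FreeAlgebra.lift Kq fun x : Gen N s => M x.1.1 x.1.2, by
    have h1 : ∀ i j, FreeAlgebra.lift Kq (fun x : Gen N s => M x.1.1 x.1.2)
        (triMat s (FreeAlgebra.ι Kq) i j) = M i j := by
      intro i j
      unfold triMat
      split_ifs with h
      · simp
      · rw [map_zero, h0 i j h]
    rintro _ _ ⟨i, j, k, l⟩
    rw [map_rllLeft, map_rllRight]
    simp only [h1]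
    exact hM i j k l⟩

theorem lift_gen (M : Fin N → Fin N → A) (h0 : ∀ i j, ¬Tri s i j → M i j = 0)
    (hM : ∀ i j k l, rllLeft D M M i j k l = rllRight D M M i j k l) (i j : Fin N) :
    lift M h0 hM (gen D s i j) = M i j := by
  by_cases h : Tri s i j
  · rw [gen_of_tri D s h, lift, RingQuot.liftAlgHom_mkAlgHom_apply, FreeAlgebra.lift_ι_apply]
  · rw [gen_eq_zero D s h, map_zero, h0 i j h]

theorem hom_ext {f g : UHalf D s →ₐ[Kq] A} (h : ∀ i j, f (gen D s i j) = g (gen D s i j)) :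
    f = g := by
  refine RingQuot.ringQuot_ext' Kq f g (FreeAlgebra.hom_ext (funext fun x => ?_))
  have := h x.1.1 x.1.2
  rw [gen_of_tri D s x.2] at this
  exact this

variable (D s)

/-- The parity involution `l_ij ↦ (-1)^{|i|+|j|} l_ij`. -/
def parity : UHalf D s →ₐ[Kq] UHalf D s :=
  lift (signMat D (gen D s)) (fun i j h => by rw [signMat, gen_eq_zero D s h, smul_zero])
    (fun i j k l => by rw [rllLeft_signMat, rllRight_signMat, gen_rel])

theorem parity_gen (i j : Fin N) :
    parity D s (gen D s i j) = sgn Kq (D.par i + D.par j) • gen D s i j := lift_gen _ _ _ _ _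

theorem parity_parity (a : UHalf D s) : parity D s (parity D s a) = a := by
  have h : (parity D s).comp (parity D s) = AlgHom.id Kq _ := hom_ext fun i j => by
    simp [parity_gen, smul_smul, sgn_mul_self]
  exact DFunLike.congr_fun h a

/-- The `ℤ/2`-grading of `U^±(R)`, in which `l^±_ij` has degree `|i| + |j|`. -/
def grading : ZMod 2 → Submodule Kq (UHalf D s) := parityGrading (parity D s)

instance : GradedAlgebra (grading D s) := parityGradedAlgebra (parity D s) (parity_parity D s)

theorem gen_mem (i j : Fin N) : gen D s i j ∈ grading D s (D.par i + D.par j) :=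
  mem_parityGrading.2 (parity_gen D s i j)

/-- The counit, `ε(L) = I`. -/
def counitHom : UHalf D s →ₐ[Kq] Kq :=
  lift (fun i j => if i = j then 1 else 0)
    (fun i j h => by
      rw [if_neg]
      rintro rfl
      cases s <;> exact h le_rfl)
    (fun i j k l => by
      rw [rllLeft, rllRight, Finset.sum_eq_single j, Finset.sum_eq_single l,
        Finset.sum_eq_single i, Finset.sum_eq_single k]
      · have h (x : ZMod 2) : x + x = 0 := by revert x; decide
        simp [h]
      · intro b _ hb; simp [hb.symm]
      · simp
      · intro a _ ha; simp [ha.symm]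
      · simp
      · intro b _ hb; simp [hb]
      · simp
      · intro a _ ha; simp [ha]
      · simp)

open GradedTensorProduct

/-- The matrix `Δ(L)`, with `Δ(l_ij) = ∑_k (-1)^{(|i|+|k|)(|k|+|j|)} l_ik ⊗ l_kj`, whose entries lie
in the tensor product of superalgebras. -/
def comulMat (i j : Fin N) : GradedTensorProduct Kq (grading D s) (grading D s) :=
  ∑ k, sgn Kq ((D.par i + D.par k) * (D.par k + D.par j)) •
    (gen D s i k ᵍ⊗ₜ[Kq] gen D s k j : GradedTensorProduct Kq (grading D s) (grading D s))

theorem gen_tmul_mul (i j k l i' j' k' l' : Fin N) :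
    (gen D s i j ᵍ⊗ₜ[Kq] gen D s k l : GradedTensorProduct Kq (grading D s) (grading D s)) *
      (gen D s i' j' ᵍ⊗ₜ[Kq] gen D s k' l') =
    sgn Kq ((D.par k + D.par l) * (D.par i' + D.par j')) •
      ((gen D s i j * gen D s i' j') ᵍ⊗ₜ[Kq] (gen D s k l * gen D s k' l')) := by
  rw [← uzpow_smul_eq]
  exact tmul_coe_mul_coe_tmul (grading D s) (grading D s) (gen D s i j)
    ⟨gen D s k l, gen_mem D s k l⟩ ⟨gen D s i' j', gen_mem D s i' j'⟩ (gen D s k' l')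

/-- A sum of tensors with left factors `l_ac l_bd` and right factors `l_cj l_dl`. -/
theorem comulMat_mul (i j k l : Fin N) :
    comulMat D s i j * comulMat D s k l = ∑ c, ∑ d,
      sgn Kq ((D.par i + D.par c) * (D.par c + D.par j) + (D.par k + D.par d) * (D.par d + D.par l)
        + (D.par c + D.par j) * (D.par k + D.par d)) •
      ((gen D s i c * gen D s k d) ᵍ⊗ₜ[Kq] (gen D s c j * gen D s d l) :
        GradedTensorProduct Kq (grading D s) (grading D s)) := by
  simp only [comulMat, Finset.sum_mul_sum]
  refine Finset.sum_congr rfl fun c _ => Finset.sum_congr rfl fun d _ => ?_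
  rw [smul_mul_smul_comm, gen_tmul_mul, smul_smul, ← sgn_add, ← sgn_add]

theorem sign1 : ∀ i j k l a b c d : ZMod 2, i + a + k + b = 0 →
    (a + j) * (k + l) + ((a + c) * (c + j) + (b + d) * (d + l) + (c + j) * (b + d)) =
      (j * (k + l) + c * (c + j) + (k + d + i) * (d + l + c + j) + c * (k + d)) +
        (a + c) * (k + d) := by
  decide

theorem sign2 : ∀ i j k l a b c d : ZMod 2, a + c + b + d = 0 →
    (j * (k + l) + c * (c + j) + (k + d + i) * (d + l + c + j) + c * (k + d)) +
        (k + b) * (a + c) =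
      (j * (k + l) + (k + (a + b) + i) * (a + b + l + j) + (k + b) * a + j * (b + l)) +
        (c + j) * (b + l) := by
  decide

theorem sign3 : ∀ i j k l a b c d : ZMod 2, c + j + d + l = 0 →
    (j * (k + l) + (k + (a + b) + i) * (a + b + l + j) + (k + b) * a + j * (b + l)) +
        (b + d) * (c + j) =
      (k + d) * (c + j) + ((k + b) * (b + d) + (i + a) * (a + c) + (b + d) * (i + a)) := by
  decide

theorem comulMat_rel (i j k l : Fin N) :
    rllLeft D (comulMat D s) (comulMat D s) i j k l =
      rllRight D (comulMat D s) (comulMat D s) i j k l := by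
  set p := D.par with hp
  let L := gen D s
  let T (x y : UHalf D s) : GradedTensorProduct Kq (grading D s) (grading D s) := x ᵍ⊗ₜ[Kq] y
  have hT1 (x : UHalf D s) {ι : Type} (t : Finset ι) (f : ι → UHalf D s) :
      T x (∑ i ∈ t, f i) = ∑ i ∈ t, T x (f i) := by
    simp only [T, tmul, TensorProduct.tmul_sum, map_sum]
  have hT2 (x : UHalf D s) {ι : Type} (t : Finset ι) (f : ι → UHalf D s) :
      T (∑ i ∈ t, f i) x = ∑ i ∈ t, T (f i) x := by
    simp only [T, tmul, TensorProduct.sum_tmul, map_sum]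
  have hT3 (r : Kq) (x y : UHalf D s) : T (r • x) y = r • T x y := by
    simp only [T, tmul, ← TensorProduct.smul_tmul', map_smul]
  have hT4 (r : Kq) (x y : UHalf D s) : T x (r • y) = r • T x y := by
    simp only [T, tmul, TensorProduct.tmul_smul, map_smul]
  let e1 (c d : Fin N) : ZMod 2 := p j * (p k + p l) + p c * (p c + p j) +
    (p k + p d + p i) * (p d + p l + p c + p j) + p c * (p k + p d)
  let e2 (a b : Fin N) : ZMod 2 := p j * (p k + p l) +
    (p k + (p a + p b) + p i) * (p a + p b + p l + p j) + (p k + p b) * p a + p j * (p b + p l)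
  calc rllLeft D (comulMat D s) (comulMat D s) i j k l
      = ∑ a, ∑ b, ∑ c, ∑ d, (sgn Kq (e1 c d) *
          (sgn Kq ((p a + p c) * (p k + p d)) * D.R i a k b)) •
            T (L a c * L b d) (L c j * L d l) := by
        simp only [rllLeft, comulMat_mul, Finset.smul_sum, smul_smul]
        refine Finset.sum_congr rfl fun a _ => Finset.sum_congr rfl fun b _ =>
          Finset.sum_congr rfl fun c _ => Finset.sum_congr rfl fun d _ => ?_
        by_cases h : D.R i a k b = 0
        · simp [h]
        · have := sign1 (p i) (p j) (p k) (p l) (p a) (p b) (p c) (p d) (D.R_even h)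
          congr 1
          rw [mul_right_comm, ← sgn_add, ← mul_assoc, ← sgn_add]
          congr 2
    _ = ∑ c, ∑ d, sgn Kq (e1 c d) • T (rllLeft D L L i c k d) (L c j * L d l) := by
        simp only [rllLeft, hT2, hT3, Finset.smul_sum, smul_smul]
        rw [Finset.sum_congr rfl fun a _ => Finset.sum_comm]
        rw [Finset.sum_comm]
        refine Finset.sum_congr rfl fun c _ => ?_
        rw [Finset.sum_congr rfl fun a _ => Finset.sum_comm]
        rw [Finset.sum_comm]
    _ = ∑ c, ∑ d, sgn Kq (e1 c d) • T (rllRight D L L i c k d) (L c j * L d l) := by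
        simp only [L, gen_rel]
    _ = ∑ c, ∑ d, ∑ a, ∑ b, (sgn Kq (e2 a b) *
          (sgn Kq ((p c + p j) * (p b + p l)) * D.R a c b d)) •
            T (L k b * L i a) (L c j * L d l) := by
        simp only [rllRight, hT2, hT3, Finset.smul_sum, smul_smul]
        refine Finset.sum_congr rfl fun c _ => Finset.sum_congr rfl fun d _ =>
          Finset.sum_congr rfl fun a _ => Finset.sum_congr rfl fun b _ => ?_
        by_cases h : D.R a c b d = 0
        · simp [h]
        · have := sign2 (p i) (p j) (p k) (p l) (p a) (p b) (p c) (p d) (D.R_even h)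
          congr 1
          rw [← mul_assoc, ← sgn_add, ← mul_assoc, ← sgn_add]
          congr 2
    _ = ∑ a, ∑ b, sgn Kq (e2 a b) • T (L k b * L i a) (rllLeft D L L a j b l) := by
        simp only [rllLeft, hT1, hT4, Finset.smul_sum, smul_smul]
        rw [Finset.sum_congr rfl fun a _ => Finset.sum_comm]
        rw [Finset.sum_comm]
        refine Finset.sum_congr rfl fun c _ => ?_
        rw [Finset.sum_congr rfl fun a _ => Finset.sum_comm]
        rw [Finset.sum_comm]
    _ = ∑ a, ∑ b, sgn Kq (e2 a b) • T (L k b * L i a) (rllRight D L L a j b l) := by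
        simp only [L, gen_rel]
    _ = ∑ a, ∑ b, ∑ c, ∑ d, (sgn Kq ((p k + p d) * (p c + p j)) * D.R c j d l *
          sgn Kq ((p k + p b) * (p b + p d) + (p i + p a) * (p a + p c) +
            (p b + p d) * (p i + p a))) • T (L k b * L i a) (L b d * L a c) := by
        simp only [rllRight, hT1, hT4, Finset.smul_sum, smul_smul]
        refine Finset.sum_congr rfl fun a _ => Finset.sum_congr rfl fun b _ =>
          Finset.sum_congr rfl fun c _ => Finset.sum_congr rfl fun d _ => ?_
        by_cases h : D.R c j d l = 0
        · simp [h]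
        · have := sign3 (p i) (p j) (p k) (p l) (p a) (p b) (p c) (p d) (D.R_even h)
          congr 1
          rw [← mul_assoc, ← sgn_add, mul_right_comm, ← sgn_add]
          congr 2
    _ = rllRight D (comulMat D s) (comulMat D s) i j k l := by
        simp only [rllRight, comulMat_mul, Finset.smul_sum, smul_smul]
        rw [Finset.sum_congr rfl fun a _ => Finset.sum_comm]
        rw [Finset.sum_comm]
        refine Finset.sum_congr rfl fun c _ => ?_
        rw [Finset.sum_congr rfl fun a _ => Finset.sum_comm]
        rw [Finset.sum_comm]
        refine Finset.sum_congr rfl fun d _ => ?_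
        rw [Finset.sum_comm]

theorem comulMat_eq_zero (i j : Fin N) (h : ¬Tri s i j) : comulMat D s i j = 0 := by
  refine Finset.sum_eq_zero fun k _ => ?_
  rcases Tri.trans_or h k with h | h
  · simp [gen_eq_zero D s h]
  · simp [gen_eq_zero D s h]

/-- The comultiplication, the morphism of superalgebras with `Δ(L) = L_(1) L_(2)`. -/
def comulHom : UHalf D s →ₐ[Kq] GradedTensorProduct Kq (grading D s) (grading D s) :=
  lift (comulMat D s) (comulMat_eq_zero D s) (comulMat_rel D s)

theorem comulHom_gen (i j : Fin N) : comulHom D s (gen D s i j) = comulMat D s i j :=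
  lift_gen _ _ _ _ _

instance : CoalgebraStruct Kq (UHalf D s) where
  comul := (GradedTensorProduct.of Kq (grading D s) (grading D s)).symm.toLinearMap ∘ₗ
    (comulHom D s).toLinearMap
  counit := (counitHom D s).toLinearMap

theorem comul_gen (i j : Fin N) : CoalgebraStruct.comul (R := Kq) (gen D s i j) =
    ∑ k, sgn Kq ((D.par i + D.par k) * (D.par k + D.par j)) •
      (gen D s i k ⊗ₜ[Kq] gen D s k j) := by
  change (GradedTensorProduct.of Kq (grading D s) (grading D s)).symm
    (comulHom D s (gen D s i j)) = _
  rw [comulHom_gen, comulMat, map_sum]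
  rfl

theorem counit_gen (i j : Fin N) :
    CoalgebraStruct.counit (R := Kq) (gen D s i j) = if i = j then 1 else 0 := lift_gen _ _ _ _ _

end UHalf

/-- All generators `l^+_ij`, `l^-_ji`, `i ≤ j`, with their sign. -/
abbrev GenAll (N : ℕ) : Type := Σ s : Bool, Gen N s

namespace UR

variable {N : ℕ} (D : OspDatum N)

/-- The matrices `L^±` over the free algebra on all the generators. -/
def freeMat (N : ℕ) (s : Bool) : Fin N → Fin N → FreeAlgebra Kq (GenAll N) :=
  triMat s fun x => FreeAlgebra.ι Kq ⟨s, x⟩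

/-- The defining relations of `U(R)`. -/
inductive Rel : FreeAlgebra Kq (GenAll N) → FreeAlgebra Kq (GenAll N) → Prop
  | diag (s : Bool) (i : Fin N) : Rel (freeMat N s i i * freeMat N (!s) i i) 1
  | rll (s : Bool) (i j k l : Fin N) : Rel
      (rllLeft D (freeMat N s) (freeMat N s) i j k l)
      (rllRight D (freeMat N s) (freeMat N s) i j k l)
  | cross (i j k l : Fin N) : Rel
      (rllLeft D (freeMat N true) (freeMat N false) i j k l)
      (rllRight D (freeMat N true) (freeMat N false) i j k l)

end UR

/-- The algebra `U(R)`. -/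
abbrev UR {N : ℕ} (D : OspDatum N) : Type := RingQuot (UR.Rel D)

namespace UR

variable {N : ℕ} (D : OspDatum N)

/-- The entries `l^±_ij` of the matrices `L^±` over `U(R)`. -/
def gen (s : Bool) (i j : Fin N) : UR D := RingQuot.mkAlgHom Kq (Rel D) (freeMat N s i j)

/-- The parity involution on the free algebra. -/
def freeParity : FreeAlgebra Kq (GenAll N) →ₐ[Kq] FreeAlgebra Kq (GenAll N) :=
  FreeAlgebra.lift Kq fun x =>
    sgn Kq (D.par x.2.1.1 + D.par x.2.1.2) • FreeAlgebra.ι Kq x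

theorem freeParity_freeMat (s : Bool) (i j : Fin N) :
    freeParity D (freeMat N s i j) = signMat D (freeMat N s) i j := by
  unfold signMat freeMat triMat
  split_ifs with h
  · simp [freeParity]
  · simp

/-- The parity involution `l^±_ij ↦ (-1)^{|i|+|j|} l^±_ij` of `U(R)`. -/
def parity : UR D →ₐ[Kq] UR D :=
  RingQuot.liftAlgHom Kq ⟨(RingQuot.mkAlgHom Kq (Rel D)).comp (freeParity D), by
    rintro _ _ (⟨s, i⟩ | ⟨s, i, j, k, l⟩ | ⟨i, j, k, l⟩)
    · have h (x : ZMod 2) : x + x = 0 := by revert x; decide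
      simp only [AlgHom.comp_apply, map_mul, freeParity_freeMat, signMat, h, sgn_zero, one_smul,
        map_one]
      rw [← map_mul, RingQuot.mkAlgHom_rel Kq (Rel.diag s i), map_one]
    · simp only [AlgHom.comp_apply, map_rllLeft D (freeParity D), map_rllRight D (freeParity D),
        freeParity_freeMat]
      rw [rllLeft_signMat, rllRight_signMat, map_smul, map_smul,
        RingQuot.mkAlgHom_rel Kq (Rel.rll s i j k l)]
    · simp only [AlgHom.comp_apply, map_rllLeft D (freeParity D), map_rllRight D (freeParity D),
        freeParity_freeMat]
      rw [rllLeft_signMat, rllRight_signMat, map_smul, map_smul,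
        RingQuot.mkAlgHom_rel Kq (Rel.cross i j k l)]⟩

theorem parity_gen (s : Bool) (i j : Fin N) :
    parity D (gen D s i j) = sgn Kq (D.par i + D.par j) • gen D s i j := by
  rw [gen, parity, RingQuot.liftAlgHom_mkAlgHom_apply, AlgHom.comp_apply, freeParity_freeMat,
    signMat, map_smul]

/-- The `ℤ/2`-grading of `U(R)`, in which `l^±_ij` has degree `|i| + |j|`. -/
def grading : ZMod 2 → Submodule Kq (UR D) := parityGrading (parity D)

theorem parity_parity (a : UR D) : parity D (parity D a) = a := by
  have h : (parity D).comp (parity D) = AlgHom.id Kq _ := by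
    refine RingQuot.ringQuot_ext' Kq _ _ (FreeAlgebra.hom_ext (funext fun x => ?_))
    have := parity_gen D x.1 x.2.1.1 x.2.1.2
    have hx : gen D x.1 x.2.1.1 x.2.1.2 = RingQuot.mkAlgHom Kq (Rel D) (FreeAlgebra.ι Kq x) := by
      rw [gen, freeMat, triMat, dif_pos x.2.2]
    rw [hx] at this
    simp [this, smul_smul, sgn_mul_self]
  exact DFunLike.congr_fun h a

instance : GradedAlgebra (grading D) := parityGradedAlgebra (parity D) (parity_parity D)

end UR

/-! ### Skew-pairings and generalized doubles of superbialgebras -/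

section Double

open CoalgebraStruct

variable {K : Type*} [Field K]
variable {X Y P Q P' Q' : Type*} [AddCommGroup X] [Module K X] [AddCommGroup Y] [Module K Y]
  [AddCommGroup P] [Module K P] [AddCommGroup Q] [Module K Q]
  [AddCommGroup P'] [Module K P'] [AddCommGroup Q'] [Module K Q']

/-- `id ⊗ f ⊗ id`, applied to the two middle factors. -/
def midMap (f : P ⊗[K] Q →ₗ[K] P' ⊗[K] Q') :
    (X ⊗[K] P) ⊗[K] (Q ⊗[K] Y) →ₗ[K] (X ⊗[K] P') ⊗[K] (Q' ⊗[K] Y) :=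
  (TensorProduct.assoc K X P' (Q' ⊗[K] Y)).symm.toLinearMap ∘ₗ
    LinearMap.lTensor X ((TensorProduct.assoc K P' Q' Y).toLinearMap ∘ₗ
      LinearMap.rTensor Y f ∘ₗ (TensorProduct.assoc K P Q Y).symm.toLinearMap) ∘ₗ
    (TensorProduct.assoc K X P (Q ⊗[K] Y)).toLinearMap

variable {A B : Type*} [Ring A] [Algebra K A] [Ring B] [Algebra K B]
variable (𝒜 : ZMod 2 → Submodule K A) (ℬ : ZMod 2 → Submodule K B)
variable [GradedAlgebra 𝒜] [GradedAlgebra ℬ]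

/-- The braiding `a ⊗ b ↦ (-1)^{|a||b|} b ⊗ a` of superspaces. -/
def braid : A ⊗[K] B →ₗ[K] B ⊗[K] A :=
  (GradedTensorProduct.of K ℬ 𝒜).symm.toLinearMap ∘ₗ
    (GradedTensorProduct.comm 𝒜 ℬ).toLinearMap ∘ₗ
    (GradedTensorProduct.of K 𝒜 ℬ).toLinearMap

theorem braid_tmul {i j : ZMod 2} {a : A} {b : B} (ha : a ∈ 𝒜 i) (hb : b ∈ ℬ j) :
    braid 𝒜 ℬ (a ⊗ₜ b) = sgn K (i * j) • b ⊗ₜ a := by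
  have h := GradedTensorProduct.comm_coe_tmul_coe (R := K) 𝒜 ℬ ⟨a, ha⟩ ⟨b, hb⟩
  rw [uzpow_smul_eq (K := K), mul_comm] at h
  exact h

/-- `(a ⊗ a', b ⊗ b') = (-1)^{|a'||b|} (a, b) (a', b')`. -/
def pairing₂ (σ : A ⊗[K] B →ₗ[K] K) : (A ⊗[K] A) ⊗[K] (B ⊗[K] B) →ₗ[K] K :=
  LinearMap.mul' K K ∘ₗ TensorProduct.map σ σ ∘ₗ midMap (braid 𝒜 ℬ)

/-- A bilinear map `A ⊗ B → K` is a morphism of superspaces if it vanishes on `a ⊗ b` for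
homogeneous `a`, `b` of different parities. -/
def IsEvenPairing (σ : A ⊗[K] B →ₗ[K] K) : Prop :=
  ∀ ⦃i j : ZMod 2⦄, i ≠ j → ∀ a ∈ 𝒜 i, ∀ b ∈ ℬ j, σ (a ⊗ₜ b) = 0

variable [CoalgebraStruct K A] [CoalgebraStruct K B]

/-- A skew-pairing of superbialgebras: `(aa', b) = (a ⊗ a', Δ(b))` and
`(a, bb') = (Δ^op(a), b ⊗ b')`, with `(1, b) = ε(b)` and `(a, 1) = ε(a)`. -/
structure IsSkewPairing (σ : A ⊗[K] B →ₗ[K] K) : Prop where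
  even : IsEvenPairing 𝒜 ℬ σ
  one_left : ∀ b : B, σ (1 ⊗ₜ b) = counit (R := K) b
  one_right : ∀ a : A, σ (a ⊗ₜ 1) = counit (R := K) a
  mul_left : ∀ (a a' : A) (b : B),
    σ ((a * a') ⊗ₜ b) = pairing₂ 𝒜 ℬ σ ((a ⊗ₜ a') ⊗ₜ comul (R := K) b)
  mul_right : ∀ (a : A) (b b' : B),
    σ (a ⊗ₜ (b * b')) = pairing₂ 𝒜 ℬ σ (braid 𝒜 𝒜 (comul (R := K) a) ⊗ₜ (b ⊗ₜ b'))

/-- The comultiplication of the tensor product of supercoalgebras,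
`Δ(a ⊗ b) = ∑ (-1)^{|a_2||b_1|} (a_1 ⊗ b_1) ⊗ (a_2 ⊗ b_2)`. -/
def comulTensor : A ⊗[K] B →ₗ[K] (A ⊗[K] B) ⊗[K] (A ⊗[K] B) :=
  midMap (braid 𝒜 ℬ) ∘ₗ TensorProduct.map (comul (R := K)) (comul (R := K))

/-- The counit `a ⊗ b ↦ ε(a) ε(b)` of the tensor product. -/
def counitTensor (K A B : Type*) [Field K] [Ring A] [Algebra K A] [Ring B] [Algebra K B]
    [CoalgebraStruct K A] [CoalgebraStruct K B] : A ⊗[K] B →ₗ[K] K :=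
  LinearMap.mul' K K ∘ₗ TensorProduct.map (counit (R := K)) (counit (R := K))

/-- The convolution product of bilinear maps,
`(φ ⋆ ψ)(a ⊗ b) = ∑ (-1)^{|a_2||b_1|} φ(a_1 ⊗ b_1) ψ(a_2 ⊗ b_2)`. -/
def conv (φ ψ : A ⊗[K] B →ₗ[K] K) : A ⊗[K] B →ₗ[K] K :=
  LinearMap.mul' K K ∘ₗ TensorProduct.map φ ψ ∘ₗ comulTensor 𝒜 ℬ

/-- `σ'` is the convolution inverse of `σ`. -/
structure IsConvInverse (σ σ' : A ⊗[K] B →ₗ[K] K) : Prop where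
  even : IsEvenPairing 𝒜 ℬ σ'
  conv_right : conv 𝒜 ℬ σ σ' = counitTensor K A B
  conv_left : conv 𝒜 ℬ σ' σ = counitTensor K A B

/-- The cross-multiplication `b ⊗ a ↦ (1 ⊗ b)(a ⊗ 1)` of the double: with the Koszul sign of the
rearrangement of `b_1 b_2 b_3 a_1 a_2 a_3` into `a_1 b_1 a_2 b_2 a_3 b_3`, it is
`∑ ± (a_1, b_1) (a_3, b_3)' a_2 ⊗ b_2`. For even pairings the sign is
`(-1)^{(|a|-|a_3|)(|b|-|b_1|) + |b_1| + |a_3|}`. -/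
def cross (σ σ' : A ⊗[K] B →ₗ[K] K) : B ⊗[K] A →ₗ[K] A ⊗[K] B :=
  (TensorProduct.rid K (A ⊗[K] B)).toLinearMap ∘ₗ
    TensorProduct.map ((TensorProduct.lid K (A ⊗[K] B)).toLinearMap ∘ₗ
      LinearMap.rTensor (A ⊗[K] B) σ) σ' ∘ₗ
    LinearMap.rTensor (A ⊗[K] B) (comulTensor 𝒜 ℬ) ∘ₗ comulTensor 𝒜 ℬ ∘ₗ braid ℬ 𝒜

/-- The multiplication of the double on `A ⊗ B`,
`(a ⊗ b)(a' ⊗ b') = (a ⊗ 1) ((1 ⊗ b)(a' ⊗ 1)) (1 ⊗ b')`, where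
`(a ⊗ 1)(x ⊗ y)(1 ⊗ b') = ax ⊗ yb'`. -/
def doubleMul (σ σ' : A ⊗[K] B →ₗ[K] K) : (A ⊗[K] B) ⊗[K] (A ⊗[K] B) →ₗ[K] A ⊗[K] B :=
  TensorProduct.map (LinearMap.mul' K A) (LinearMap.mul' K B) ∘ₗ midMap (cross 𝒜 ℬ σ σ')

/-- `doubleMul` is an associative multiplication with unit `1 ⊗ 1`. -/
structure IsDouble (σ σ' : A ⊗[K] B →ₗ[K] K) : Prop where
  one_mul : ∀ x, doubleMul 𝒜 ℬ σ σ' ((1 ⊗ₜ 1) ⊗ₜ x) = x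
  mul_one : ∀ x, doubleMul 𝒜 ℬ σ σ' (x ⊗ₜ (1 ⊗ₜ 1)) = x
  mul_assoc : ∀ x y z, doubleMul 𝒜 ℬ σ σ' (doubleMul 𝒜 ℬ σ σ' (x ⊗ₜ y) ⊗ₜ z) =
    doubleMul 𝒜 ℬ σ σ' (x ⊗ₜ doubleMul 𝒜 ℬ σ σ' (y ⊗ₜ z))

variable {𝒜 ℬ}

/-- The generalized double `D(A, B)`: the space `A ⊗ B` with the multiplication `doubleMul`. -/
@[nolint unusedArguments]
def GenDouble {σ σ' : A ⊗[K] B →ₗ[K] K} (_ : IsDouble 𝒜 ℬ σ σ') : Type _ := A ⊗[K] B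

namespace GenDouble

variable {σ σ' : A ⊗[K] B →ₗ[K] K} (h : IsDouble 𝒜 ℬ σ σ')

instance : AddCommGroup (GenDouble h) := inferInstanceAs (AddCommGroup (A ⊗[K] B))

instance : Module K (GenDouble h) := inferInstanceAs (Module K (A ⊗[K] B))

/-- The identity, from `A ⊗ B` to the double. -/
def of : A ⊗[K] B ≃ₗ[K] GenDouble h := LinearEquiv.refl K _

instance : Ring (GenDouble h) where
  __ := (inferInstance : AddCommGroup (GenDouble h))
  mul x y := of h (doubleMul 𝒜 ℬ σ σ' ((of h).symm x ⊗ₜ (of h).symm y))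
  one := of h (1 ⊗ₜ 1)
  one_mul := h.one_mul
  mul_one := h.mul_one
  mul_assoc := h.mul_assoc
  left_distrib x y z := by
    change of h (doubleMul 𝒜 ℬ σ σ' ((of h).symm x ⊗ₜ (of h).symm (y + z))) = _
    rw [map_add, TensorProduct.tmul_add, map_add, map_add]; rfl
  right_distrib x y z := by
    change of h (doubleMul 𝒜 ℬ σ σ' ((of h).symm (x + y) ⊗ₜ (of h).symm z)) = _
    rw [map_add, TensorProduct.add_tmul, map_add, map_add]; rfl
  zero_mul x := by
    change of h (doubleMul 𝒜 ℬ σ σ' ((of h).symm 0 ⊗ₜ (of h).symm x)) = _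
    rw [map_zero, TensorProduct.zero_tmul, map_zero, map_zero]
  mul_zero x := by
    change of h (doubleMul 𝒜 ℬ σ σ' ((of h).symm x ⊗ₜ (of h).symm 0)) = _
    rw [map_zero, TensorProduct.tmul_zero, map_zero, map_zero]

theorem mul_def (x y : GenDouble h) :
    x * y = of h (doubleMul 𝒜 ℬ σ σ' ((of h).symm x ⊗ₜ (of h).symm y)) := rfl

instance : Algebra K (GenDouble h) := Algebra.ofModule
  (fun r x y => by
    rw [mul_def, map_smul, ← TensorProduct.smul_tmul', map_smul, map_smul, ← mul_def])
  (fun r x y => by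
    rw [mul_def, map_smul, TensorProduct.tmul_smul, map_smul, map_smul, ← mul_def])

end GenDouble

end Double

/-! ### The double of `U^+(R)` and `U^-(R)` -/

section RDouble

variable {N : ℕ} (D : OspDatum N)

/-- `σ` is a skew-pairing of `U^+(R)` and `U^-(R)` with
`∑ (-1)^{(|i|+|j|)(|k|+|l|)} (l^+_ij, l^-_kl) E_ij ⊗ E_kl = R`. -/
def IsRPairing (σ : UHalf D true ⊗[Kq] UHalf D false →ₗ[Kq] Kq) : Prop :=
  IsSkewPairing (UHalf.grading D true) (UHalf.grading D false) σ ∧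
    ∀ i j k l : Fin N, sgn Kq ((D.par i + D.par j) * (D.par k + D.par l)) *
      σ (UHalf.gen D true i j ⊗ₜ UHalf.gen D false k l) = D.R i j k l

variable {D} {σ σ' : UHalf D true ⊗[Kq] UHalf D false →ₗ[Kq] Kq}
  (h : IsDouble (UHalf.grading D true) (UHalf.grading D false) σ σ')

/-- `l^+_ij` in the double. -/
def doublePlus (i j : Fin N) : GenDouble h := GenDouble.of h (UHalf.gen D true i j ⊗ₜ 1)

/-- `l^-_ij` in the double. -/
def doubleMinus (i j : Fin N) : GenDouble h := GenDouble.of h (1 ⊗ₜ UHalf.gen D false i j)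

/-- The relations `l^±_ii l^∓_ii = 1` in the double. -/
inductive DiagRel : GenDouble h → GenDouble h → Prop
  | plus (i : Fin N) : DiagRel (doublePlus h i i * doubleMinus h i i) 1
  | minus (i : Fin N) : DiagRel (doubleMinus h i i * doublePlus h i i) 1

/-- The quotient of the double by the relations `l^±_ii l^∓_ii = 1`. -/
abbrev DoubleQuot : Type := RingQuot (DiagRel h)

/-- The class in the quotient of an element of the double. -/
def DoubleQuot.mk : UHalf D true ⊗[Kq] UHalf D false →ₗ[Kq] DoubleQuot h :=
  (RingQuot.mkAlgHom Kq (DiagRel h)).toLinearMap ∘ₗ (GenDouble.of h).toLinearMap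

end RDouble

end

end OspRTT

set_option linter.unusedSimpArgs false

/-! The axioms of a skew-pairing express its values on products of generators through its values on
single generators, so uniqueness is formal and the content is existence, invertibility and the
comparison with U(R).

Signs are removed at the start. After rescaling by signs, the generators form a "comatrix": a
homogeneous matrix with Δ(t_xy) = ∑ t_xz ⊗ t_zy and no sign. Products of comatrices are comatrices,
and the entries of the powers of the generating one span the algebra, so linear identities need only
be checked on such entries. There the Koszul signs of a pairing can be absorbed in one factor
(`Comat.pairMat`), and the pairing axioms become identities between ordinary matrices. In the same
way R becomes q⁻¹ S, where S is the matrix of a vertex model without signs (`OspDatum.sgn_mul_R`,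
`OspDatum.rll_iff`).

The Yang–Baxter equation for S (`VertexWeights.yangBaxterAt`) is proved one component at a time. The
E_ij component in the first factor says that S intertwines T_ij = ∑ L_ia ⊗ L_aj with its flip. It is
trivial for j < i, a weight count for j = i, and an explicit computation for j = i + 1. A larger gap
is filled by induction: the components already known imply an RTT relation that writes T_jj T_ik or
T_ik T_jj, up to a nonzero scalar, through T_ij and T_jk, and T_jj is invertible. Only a gap of two
that contains the middle pair needs separate care.

Existence (`OspDatum.isRPairing_rPairing`): by Yang–Baxter, R defines an anti-representation of
U^-(R) on V, whose matrix coefficients serve as the linear forms b ↦ (t_ij, b). A linear form φ acts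
on U^-(R) by b ↦ ± φ(b_2) b_1. These operators satisfy the relations of U^+(R), by Yang–Baxter
again, so U^+(R) acts on U^-(R), and (a, b) = ε(a · b) is the pairing.

Invertibility (`OspDatum.exists_isConvInverse`): S is triangular with nonzero diagonal, hence
invertible, and invertibility passes to products of comatrices. The operator c ↦ σ(c_1) c_2 on U^+ ⊗
U^- is therefore injective, and a left inverse of it composed with the counit is the convolution
inverse.

The double: on comatrices the cross-multiplication is P W P⁻¹, where P is the matrix of the pairing
and W that of the products t u. Multiplicativity of P and P⁻¹ gives associativity (`isDouble`). For
the generators, V = P W P⁻¹, with V the matrix of the products u t, is equivalent to P W = V P,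
which is the relation R_12 L^+_1 L^-_2 = L^-_2 L^+_1 R_12 (`OspDatum.rll_cross_iff`). Hence the
quotient of the double and U(R) have the same presentation. -/

namespace OspRTT
noncomputable section

/-! ### Vertex models and the intertwining property of adjacent matrix entries -/

/-- The weights of an orthosymplectic vertex model: diagonal weights `w i k`, the coefficients
`c i / c j` of the transitions `(j, j') → (i, i')`, and the weight `-κ` of the transpositions. -/
structure VertexWeights (K : Type*) [Field K] (N : ℕ) where
  w : Fin N → Fin N → K
  c : Fin N → K
  κ : K
  w_ne : ∀ i k, w i k ≠ 0
  c_ne : ∀ i, c i ≠ 0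
  κ_ne : κ ≠ 0
  w_comm : ∀ i k, w i k = w k i
  w_rev : ∀ i k, w i k.rev = (w i k)⁻¹
  w_sq : ∀ i k, k ≠ i → k ≠ i.rev → w i k * w i k = 1
  w_mid : ∀ i, i = i.rev → w i i = 1
  w_hecke : ∀ i, i ≠ i.rev → w i i * w i i + κ * w i i = 1
  c_succ : ∀ i j : Fin N, (i : ℕ) + 1 = j → j ≠ i.rev →
    c i * c j.rev * (w i i * w j j) = c j * c i.rev
  c_mid : ∀ i j : Fin N, (i : ℕ) + 1 = j → j = i.rev →
    c i = c j ∨ (c i ≠ c j ∧ c i * (w i i * w i i) = - c j)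

namespace VertexWeights

variable {K : Type*} [Field K] {N : ℕ} (W : VertexWeights K N)

/-- The entry of the `R`-matrix in row `(i, k)` and column `(j, l)`. -/
def S (i k j l : Fin N) : K :=
  (if j = i ∧ l = k then W.w i k else 0) - (if i < j ∧ k = j ∧ l = i then W.κ else 0) +
    (if i < j ∧ k = i.rev ∧ l = j.rev then W.κ * (W.c i * (W.c j)⁻¹) else 0)

theorem w_rev_left (i k : Fin N) : W.w i.rev k = (W.w i k)⁻¹ := by
  rw [W.w_comm, W.w_rev, W.w_comm]

theorem w_rev_rev (i k : Fin N) : W.w i.rev k.rev = W.w i k := by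
  rw [W.w_rev, W.w_rev_left, inv_inv]

section Base

variable {M : Type*} [AddCommGroup M] [Module K M] {v : Fin N → Fin N → M} {S T T' : M →ₗ[K] M}

/-- The image of the basis vector `v m n` under the `R`-matrix. -/
def SCol (v : Fin N → Fin N → M) (m n : Fin N) : M :=
  W.w m n • v m n - (if n < m then W.κ else 0) • v n m +
    (if n = m.rev then W.κ * (W.c m)⁻¹ else 0) • ∑ k with k < m, W.c k • v k k.rev

/-- The image of `v m n` under `l_ii ⊗ e + e ⊗ l_jj`, where `e = E_ji - g E_i'j'`. -/
def TCol (v : Fin N → Fin N → M) (i j : Fin N) (g : K) (m n : Fin N) : M :=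
  (if n = i then W.w i m else 0) • v m j - (if n = j.rev then g * W.w i m else 0) • v m i.rev +
    ((if m = i then W.w j n else 0) • v j n - (if m = j.rev then g * W.w j n else 0) • v i.rev n)

/-- The image of `v m n` under `e ⊗ l_ii + l_jj ⊗ e`, where `e = E_ji - g E_i'j'`. -/
def TColOp (v : Fin N → Fin N → M) (i j : Fin N) (g : K) (m n : Fin N) : M :=
  (if m = i then W.w i n else 0) • v j n - (if m = j.rev then g * W.w i n else 0) • v i.rev n +
    ((if n = i then W.w j m else 0) • v m j - (if n = j.rev then g * W.w j m else 0) • v m i.rev)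

/-- Only the summands k = i, j, i', j' of a truncated cup vector are moved. They contribute in two
pairs to the vectors v i' j and v j i', and inside each pair the two terms differ only in the
cut-off from which they are present. -/
theorem map_cupSum {i j : Fin N} {g : K} (hT : ∀ m n, T (v m n) = W.TCol v i j g m n)
    (m : Fin N) : T (∑ k with k < m, W.c k • v k k.rev) =
      ((if i.rev < m then W.c i.rev * (W.w i i)⁻¹ else 0) -
        (if j.rev < m then g * W.c j.rev * W.w j j else 0)) • v i.rev j +
      ((if i < m then W.c i * (W.w i j)⁻¹ else 0) -
        (if j < m then g * W.c j * W.w i j else 0)) • v j i.rev := by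
  have h1 (k a : Fin N) : k.rev = a ↔ k = a.rev := by
    constructor <;> rintro rfl <;> simp
  simp only [map_sum, map_smul, hT, TCol, h1, Fin.rev_rev, smul_add, smul_sub, smul_ite, smul_zero, mul_ite, mul_zero,
    Finset.sum_add_distrib, Finset.sum_sub_distrib, Finset.sum_ite_eq', Finset.mem_filter,
    Finset.mem_univ, true_and, smul_smul, sub_smul, ite_smul, zero_smul]
  simp only [W.w_rev, W.w_comm j i]
  split_ifs <;> module

-- The generic adjacent case, where neither index is the midpoint and the two are not mirror images.
-- The operator of a simple root almost annihilates every truncated cup vector, by `c_succ`; what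
-- survives at the cuts m = i' and m = j is balanced by the transposition and diagonal terms through
-- the Hecke relation `w_hecke`.
set_option maxHeartbeats 4000000 in
theorem intertwine_adjacent {i j : Fin N} (hij : (i : ℕ) + 1 = j) (hi : i ≠ i.rev)
    (hj : j ≠ j.rev) (hne : j ≠ i.rev)
    (hS : ∀ m n, S (v m n) = W.SCol v m n)
    (hT : ∀ m n, T (v m n) = W.TCol v i j (W.c i * (W.c j)⁻¹) m n)
    (hT' : ∀ m n, T' (v m n) = W.TColOp v i j (W.c i * (W.c j)⁻¹) m n) (m n : Fin N) :
    T (S (v m n)) = S (T' (v m n)) := by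
  have hcs := W.c_succ i j hij hne
  have v1 := Fin.val_rev i
  have v2 := Fin.val_rev j
  have lt1 : i < j := by omega
  have lt2 : j.rev < i.rev := by omega
  have lt3 : ¬ j < i := by omega
  have lt4 : ¬ i.rev < j.rev := by omega
  have r1 : ∀ x, x ≠ i → x ≠ j → (x < j ↔ x < i) := by intros; omega
  have r2 : ∀ x, x ≠ i → x ≠ j → (j < x ↔ i < x) := by intros; omega
  have r3 : ∀ x, x ≠ i.rev → x ≠ j.rev → (x < i.rev ↔ x < j.rev) := by intros; omega
  have r4 : ∀ x, x ≠ i.rev → x ≠ j.rev → (i.rev < x ↔ j.rev < x) := by intros; omega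
  have n1 : i ≠ j := by omega
  have n2 : i ≠ j.rev := by omega
  have n3 : j.rev ≠ i.rev := by omega
  have hci := W.c_ne i
  have hcj := W.c_ne j
  have hci' := W.c_ne i.rev
  have hcj' := W.c_ne j.rev
  have hai := W.w_ne i i
  have hbi := W.w_ne j j
  have hsi := W.w_ne i j
  have hss := W.w_sq i j n1.symm hne
  have ha := W.w_hecke i hi
  have hb := W.w_hecke j hj
  have hs' : (W.w i j)⁻¹ = W.w i j := by field_simp; linear_combination -hss
  have ha' : (W.w i i)⁻¹ = W.w i i + W.κ := by field_simp; linear_combination -ha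
  have hb' : (W.w j j)⁻¹ = W.w j j + W.κ := by field_simp; linear_combination -hb
  have ha'' : (W.w i i + W.κ)⁻¹ = W.w i i := by rw [← ha', inv_inv]
  have hb'' : (W.w j j + W.κ)⁻¹ = W.w j j := by rw [← hb', inv_inv]
  -- The two members of each pair in `map_cupSum` have equal weight by `c_succ`. They therefore
  -- cancel unless the cut separates j' from i', or i from j, that is, unless m = i' or m = j.
  have hcup : ∀ m, T (∑ k with k < m, W.c k • v k k.rev) =
      (if m = i.rev then - (W.c i.rev * (W.w i i)⁻¹) else 0) • v i.rev j +
      (if m = j then W.c i * W.w i j else 0) • v j i.rev := by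
    intro m
    rw [W.map_cupSum hT]
    have e1 : W.c i * (W.c j)⁻¹ * W.c j.rev * W.w j j = W.c i.rev * (W.w i i)⁻¹ := by
      field_simp; linear_combination hcs
    have e2 : W.c i * (W.c j)⁻¹ * W.c j * W.w i j = W.c i * W.w i j := by field_simp
    rw [e1, e2, hs']
    congr 2
    · by_cases h : m = i.rev
      · subst h; simp [lt2]
      · by_cases h' : m = j.rev
        · subst h'; simp [lt4, n3]
        · simp [h, r4 m h h']
    · by_cases h : m = j
      · subst h; simp [lt1]
      · by_cases h' : m = i
        · subst h'; simp [lt3, n1]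
        · simp [h, r2 m h' h]
  have hω1 : ∑ k with k < j, W.c k • v k k.rev =
      ∑ k with k < i, W.c k • v k k.rev + W.c i • v i i.rev := by
    have : (Finset.univ.filter fun k => k < j) = insert i (Finset.univ.filter fun k => k < i) := by
      ext k; simp; omega
    rw [this, Finset.sum_insert (by simp), add_comm]
  have hω2 : ∑ k with k < i.rev, W.c k • v k k.rev =
      ∑ k with k < j.rev, W.c k • v k k.rev + W.c j.rev • v j.rev j := by
    have : (Finset.univ.filter fun k => k < i.rev) =
        insert j.rev (Finset.univ.filter fun k => k < j.rev) := by
      ext k; simp; omega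
    rw [this, Finset.sum_insert (by simp), add_comm, Fin.rev_rev]
  have hji : W.w j i = W.w i j := W.w_comm _ _
  have l1 := r1 i.rev hi.symm hne.symm
  have l2 := r2 i.rev hi.symm hne.symm
  have l3 := r1 j.rev n2.symm hj.symm
  have l4 := r2 j.rev n2.symm hj.symm
  have l5 := r3 i hi n2
  have l6 := r4 i hi n2
  have rr (x y : Fin N) : x ≠ y.rev → y ≠ x.rev := by rintro h rfl; simp at h
  have cs (x : Fin N) : i = x ∨ j = x ∨ i.rev = x ∨ j.rev = x ∨
      (x ≠ i ∧ x ≠ j ∧ x ≠ i.rev ∧ x ≠ j.rev) := by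
    by_cases h1 : i = x; · exact .inl h1
    by_cases h2 : j = x; · exact .inr (.inl h2)
    by_cases h3 : i.rev = x; · exact .inr (.inr (.inl h3))
    by_cases h4 : j.rev = x; · exact .inr (.inr (.inr (.inl h4)))
    exact .inr (.inr (.inr (.inr ⟨Ne.symm h1, Ne.symm h2, Ne.symm h3, Ne.symm h4⟩)))
  -- Each of m and n is one of the four distinguished indices or unrelated to them. For an unrelated
  -- index x the weights w i x and w j x square to one, and x lies on the same side of i as of j,
  -- and of i' as of j'. If both are unrelated, both sides vanish.
  rcases cs m with rfl | rfl | rfl | rfl | ⟨hm1, hm2, hm3, hm4⟩ <;>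
  rcases cs n with rfl | rfl | rfl | rfl | ⟨hn1, hn2, hn3, hn4⟩
  on_goal 25 =>
    simp only [hS, hT, hT', hcup, map_add, map_sub, map_smul, SCol, TCol, TColOp, if_false,
      hm1, hm2, hm3, hm4, hn1, hn2, hn3, hn4]
    simp
  on_goal 24 =>
    have q1 := W.w_sq i m hm1 hm3
    have q2 := W.w_sq j m hm2 hm4
    have q3 := inv_eq_of_mul_eq_one_right q1
    have q4 := inv_eq_of_mul_eq_one_right q2
    simp only [hS, hT, hT', hcup, map_add, map_sub, map_smul, SCol, TCol, TColOp, Fin.rev_rev,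
      Fin.rev_inj, n1, n1.symm, n2, n2.symm, n3, n3.symm, hne, hne.symm, hi, hi.symm, hj, hj.symm,
      lt1, lt2, lt3, lt4, if_true, if_false, W.w_rev, W.w_rev_left, hji, ha', hb', ha'', hb'', hs', map_zero,
      zero_add, add_zero, sub_zero, smul_zero, zero_smul, lt_irrefl, inv_inv, hω1, hω2, hm1, hm2, hm3,
      hm4, hm1.symm, hm2.symm, hm3.symm, hm4.symm, rr m i hm3, rr m j hm4,
      r1 m hm1 hm2, r2 m hm1 hm2, r3 m hm3 hm4, r4 m hm3 hm4,
      W.w_comm m i, W.w_comm m j, q3, q4]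
    try (match_scalars <;> clear * - hci' hcj' hss ha hb hcs hci hcj hs' ha' hb' q1 q2 <;> grind)
  on_goal 23 =>
    have q1 := W.w_sq i m hm1 hm3
    have q2 := W.w_sq j m hm2 hm4
    have q3 := inv_eq_of_mul_eq_one_right q1
    have q4 := inv_eq_of_mul_eq_one_right q2
    simp only [hS, hT, hT', hcup, map_add, map_sub, map_smul, SCol, TCol, TColOp, Fin.rev_rev,
      Fin.rev_inj, n1, n1.symm, n2, n2.symm, n3, n3.symm, hne, hne.symm, hi, hi.symm, hj, hj.symm,
      lt1, lt2, lt3, lt4, if_true, if_false, W.w_rev, W.w_rev_left, hji, ha', hb', ha'', hb'', hs', map_zero,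
      zero_add, add_zero, sub_zero, smul_zero, zero_smul, lt_irrefl, inv_inv, hω1, hω2, hm1, hm2, hm3,
      hm4, hm1.symm, hm2.symm, hm3.symm, hm4.symm, rr m i hm3, rr m j hm4,
      r1 m hm1 hm2, r2 m hm1 hm2, r3 m hm3 hm4, r4 m hm3 hm4,
      W.w_comm m i, W.w_comm m j, q3, q4]
    try (match_scalars <;> clear * - hci' hcj' hss ha hb hcs hci hcj hs' ha' hb' q1 q2 <;> grind)
  on_goal 22 =>
    have q1 := W.w_sq i m hm1 hm3
    have q2 := W.w_sq j m hm2 hm4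
    have q3 := inv_eq_of_mul_eq_one_right q1
    have q4 := inv_eq_of_mul_eq_one_right q2
    simp only [hS, hT, hT', hcup, map_add, map_sub, map_smul, SCol, TCol, TColOp, Fin.rev_rev,
      Fin.rev_inj, n1, n1.symm, n2, n2.symm, n3, n3.symm, hne, hne.symm, hi, hi.symm, hj, hj.symm,
      lt1, lt2, lt3, lt4, if_true, if_false, W.w_rev, W.w_rev_left, hji, ha', hb', ha'', hb'', hs', map_zero,
      zero_add, add_zero, sub_zero, smul_zero, zero_smul, lt_irrefl, inv_inv, hω1, hω2, hm1, hm2, hm3,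
      hm4, hm1.symm, hm2.symm, hm3.symm, hm4.symm, rr m i hm3, rr m j hm4,
      r1 m hm1 hm2, r2 m hm1 hm2, r3 m hm3 hm4, r4 m hm3 hm4,
      W.w_comm m i, W.w_comm m j, q3, q4]
    try (match_scalars <;> clear * - hci' hcj' hss ha hb hcs hci hcj hs' ha' hb' q1 q2 <;> grind)
  on_goal 21 =>
    have q1 := W.w_sq i m hm1 hm3
    have q2 := W.w_sq j m hm2 hm4
    have q3 := inv_eq_of_mul_eq_one_right q1
    have q4 := inv_eq_of_mul_eq_one_right q2
    simp only [hS, hT, hT', hcup, map_add, map_sub, map_smul, SCol, TCol, TColOp, Fin.rev_rev,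
      Fin.rev_inj, n1, n1.symm, n2, n2.symm, n3, n3.symm, hne, hne.symm, hi, hi.symm, hj, hj.symm,
      lt1, lt2, lt3, lt4, if_true, if_false, W.w_rev, W.w_rev_left, hji, ha', hb', ha'', hb'', hs', map_zero,
      zero_add, add_zero, sub_zero, smul_zero, zero_smul, lt_irrefl, inv_inv, hω1, hω2, hm1, hm2, hm3,
      hm4, hm1.symm, hm2.symm, hm3.symm, hm4.symm, rr m i hm3, rr m j hm4,
      r1 m hm1 hm2, r2 m hm1 hm2, r3 m hm3 hm4, r4 m hm3 hm4,
      W.w_comm m i, W.w_comm m j, q3, q4]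
    try (match_scalars <;> clear * - hci' hcj' hss ha hb hcs hci hcj hs' ha' hb' q1 q2 <;> grind)
  on_goal 20 =>
    have q1 := W.w_sq i n hn1 hn3
    have q2 := W.w_sq j n hn2 hn4
    have q3 := inv_eq_of_mul_eq_one_right q1
    have q4 := inv_eq_of_mul_eq_one_right q2
    simp only [hS, hT, hT', hcup, map_add, map_sub, map_smul, SCol, TCol, TColOp, Fin.rev_rev,
      Fin.rev_inj, n1, n1.symm, n2, n2.symm, n3, n3.symm, hne, hne.symm, hi, hi.symm, hj, hj.symm,
      lt1, lt2, lt3, lt4, if_true, if_false, W.w_rev, W.w_rev_left, hji, ha', hb', ha'', hb'', hs', map_zero,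
      zero_add, add_zero, sub_zero, smul_zero, zero_smul, lt_irrefl, inv_inv, hω1, hω2, hn1, hn2, hn3,
      hn4, hn1.symm, hn2.symm, hn3.symm, hn4.symm, rr n i hn3, rr n j hn4,
      r1 n hn1 hn2, r2 n hn1 hn2, r3 n hn3 hn4, r4 n hn3 hn4,
      W.w_comm n i, W.w_comm n j, q3, q4]
    try (match_scalars <;> clear * - hci' hcj' hss ha hb hcs hci hcj hs' ha' hb' q1 q2 <;> grind)
  on_goal 15 =>
    have q1 := W.w_sq i n hn1 hn3
    have q2 := W.w_sq j n hn2 hn4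
    have q3 := inv_eq_of_mul_eq_one_right q1
    have q4 := inv_eq_of_mul_eq_one_right q2
    simp only [hS, hT, hT', hcup, map_add, map_sub, map_smul, SCol, TCol, TColOp, Fin.rev_rev,
      Fin.rev_inj, n1, n1.symm, n2, n2.symm, n3, n3.symm, hne, hne.symm, hi, hi.symm, hj, hj.symm,
      lt1, lt2, lt3, lt4, if_true, if_false, W.w_rev, W.w_rev_left, hji, ha', hb', ha'', hb'', hs', map_zero,
      zero_add, add_zero, sub_zero, smul_zero, zero_smul, lt_irrefl, inv_inv, hω1, hω2, hn1, hn2, hn3,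
      hn4, hn1.symm, hn2.symm, hn3.symm, hn4.symm, rr n i hn3, rr n j hn4,
      r1 n hn1 hn2, r2 n hn1 hn2, r3 n hn3 hn4, r4 n hn3 hn4,
      W.w_comm n i, W.w_comm n j, q3, q4]
    try (match_scalars <;> clear * - hci' hcj' hss ha hb hcs hci hcj hs' ha' hb' q1 q2 <;> grind)
  on_goal 10 =>
    have q1 := W.w_sq i n hn1 hn3
    have q2 := W.w_sq j n hn2 hn4
    have q3 := inv_eq_of_mul_eq_one_right q1
    have q4 := inv_eq_of_mul_eq_one_right q2
    simp only [hS, hT, hT', hcup, map_add, map_sub, map_smul, SCol, TCol, TColOp, Fin.rev_rev,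
      Fin.rev_inj, n1, n1.symm, n2, n2.symm, n3, n3.symm, hne, hne.symm, hi, hi.symm, hj, hj.symm,
      lt1, lt2, lt3, lt4, if_true, if_false, W.w_rev, W.w_rev_left, hji, ha', hb', ha'', hb'', hs', map_zero,
      zero_add, add_zero, sub_zero, smul_zero, zero_smul, lt_irrefl, inv_inv, hω1, hω2, hn1, hn2, hn3,
      hn4, hn1.symm, hn2.symm, hn3.symm, hn4.symm, rr n i hn3, rr n j hn4,
      r1 n hn1 hn2, r2 n hn1 hn2, r3 n hn3 hn4, r4 n hn3 hn4,
      W.w_comm n i, W.w_comm n j, q3, q4]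
    try (match_scalars <;> clear * - hci' hcj' hss ha hb hcs hci hcj hs' ha' hb' q1 q2 <;> grind)
  on_goal 5 =>
    have q1 := W.w_sq i n hn1 hn3
    have q2 := W.w_sq j n hn2 hn4
    have q3 := inv_eq_of_mul_eq_one_right q1
    have q4 := inv_eq_of_mul_eq_one_right q2
    simp only [hS, hT, hT', hcup, map_add, map_sub, map_smul, SCol, TCol, TColOp, Fin.rev_rev,
      Fin.rev_inj, n1, n1.symm, n2, n2.symm, n3, n3.symm, hne, hne.symm, hi, hi.symm, hj, hj.symm,
      lt1, lt2, lt3, lt4, if_true, if_false, W.w_rev, W.w_rev_left, hji, ha', hb', ha'', hb'', hs', map_zero,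
      zero_add, add_zero, sub_zero, smul_zero, zero_smul, lt_irrefl, inv_inv, hω1, hω2, hn1, hn2, hn3,
      hn4, hn1.symm, hn2.symm, hn3.symm, hn4.symm, rr n i hn3, rr n j hn4,
      r1 n hn1 hn2, r2 n hn1 hn2, r3 n hn3 hn4, r4 n hn3 hn4,
      W.w_comm n i, W.w_comm n j, q3, q4]
    try (match_scalars <;> clear * - hci' hcj' hss ha hb hcs hci hcj hs' ha' hb' q1 q2 <;> grind)
  all_goals
    simp only [hS, hT, hT', hcup, map_add, map_sub, map_smul, SCol, TCol, TColOp, Fin.rev_rev,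
      Fin.rev_inj, n1, n1.symm, n2, n2.symm, n3, n3.symm, hne, hne.symm, hi, hi.symm, hj, hj.symm,
      lt1, lt2, lt3, lt4, if_true, if_false, W.w_rev, W.w_rev_left, hji, ha', hb', ha'', hb'', hs', map_zero,
      zero_add, add_zero, sub_zero, smul_zero, zero_smul, lt_irrefl, inv_inv, hω1, hω2, l1, l2, l3, l4, l5, l6]
    try (match_scalars <;> clear * - hci' hcj' hss ha hb hcs hci hcj hs' ha' hb' <;> grind)

-- The case of an odd number of indices with j the midpoint: j' = j and w j j = 1, so the
-- distinguished indices are i, j, i' and only w i i enters the Hecke relation.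
set_option maxHeartbeats 1000000 in
theorem intertwine_left_of_mid {i j : Fin N} (hij : (i : ℕ) + 1 = j) (hj : j = j.rev)
    (hS : ∀ m n, S (v m n) = W.SCol v m n)
    (hT : ∀ m n, T (v m n) = W.TCol v i j (W.c i * (W.c j)⁻¹) m n)
    (hT' : ∀ m n, T' (v m n) = W.TColOp v i j (W.c i * (W.c j)⁻¹) m n) (m n : Fin N) :
    T (S (v m n)) = S (T' (v m n)) := by
  have v1 := Fin.val_rev i
  have v2 := Fin.val_rev j
  have lt1 : i < j := by omega
  have lt3 : ¬ j < i := by omega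
  have hci := W.c_ne i
  have hcj := W.c_ne j
  have hai := W.w_ne i i
  have hbi := W.w_ne j j
  have hsi := W.w_ne i j
  have hji : W.w j i = W.w i j := W.w_comm _ _
  have n1 : i ≠ j := by omega
  have hcs := W.c_succ i j hij (by omega)
  have hw := W.w_mid j hj
  rw [← hj, hw, mul_one] at hcs
  have hci' := W.c_ne i.rev
  have lt2 : j < i.rev := by omega
  have lt4 : ¬ i.rev < j := by omega
  have lt5 : i < i.rev := by omega
  have lt6 : ¬ i.rev < i := by omega
  have r1 : ∀ x, x ≠ i → x ≠ j → x ≠ i.rev → (x < j ↔ x < i) := by intros; omega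
  have r2 : ∀ x, x ≠ i → x ≠ j → x ≠ i.rev → (j < x ↔ i < x) := by intros; omega
  have r3 : ∀ x, x ≠ i → x ≠ j → x ≠ i.rev → (x < i.rev ↔ x < i) := by intros; omega
  have r4 : ∀ x, x ≠ i → x ≠ j → x ≠ i.rev → (i.rev < x ↔ i < x) := by intros; omega
  have n2 : j ≠ i.rev := by omega
  have n3 : i ≠ i.rev := by omega
  have ha := W.w_hecke i n3
  have hss := W.w_sq i j n1.symm n2
  have hs' : (W.w i j)⁻¹ = W.w i j := by field_simp; linear_combination -hss
  have ha' : (W.w i i)⁻¹ = W.w i i + W.κ := by field_simp; linear_combination -ha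
  have ha'' : (W.w i i + W.κ)⁻¹ = W.w i i := by rw [← ha', inv_inv]
  have hcup : ∀ m, T (∑ k with k < m, W.c k • v k k.rev) =
      (if m = i.rev then - W.c i else 0) • v i.rev j +
      (if m = j then W.c i * W.w i j else 0) • v j i.rev := by
    intro m
    rw [W.map_cupSum hT, ← hj, hw, hs']
    have e1 : W.c i.rev * (W.w i i)⁻¹ = W.c i := by field_simp; apply mul_left_cancel₀ hcj; linear_combination -hcs
    rw [e1]
    congr 2 <;> clear hT hT' hS <;> rcases lt_trichotomy m j with h | h | h <;> grind
  have hω1 : ∑ k with k < j, W.c k • v k k.rev =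
      ∑ k with k < i, W.c k • v k k.rev + W.c i • v i i.rev := by
    have : (Finset.univ.filter fun k => k < j) = insert i (Finset.univ.filter fun k => k < i) := by
      ext k; simp; omega
    rw [this, Finset.sum_insert (by simp), add_comm]
  have hω2 : ∑ k with k < i.rev, W.c k • v k k.rev =
      ∑ k with k < j, W.c k • v k k.rev + W.c j • v j j := by
    have : (Finset.univ.filter fun k => k < i.rev) =
        insert j (Finset.univ.filter fun k => k < j) := by
      ext k; simp; omega
    rw [this, Finset.sum_insert (by simp), add_comm, ← hj]
  have rr (x y : Fin N) : x ≠ y.rev → y ≠ x.rev := by rintro h rfl; simp at h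
  have cs (x : Fin N) : i = x ∨ j = x ∨ i.rev = x ∨ (x ≠ i ∧ x ≠ j ∧ x ≠ i.rev) := by
    by_cases h1 : i = x; · exact .inl h1
    by_cases h2 : j = x; · exact .inr (.inl h2)
    by_cases h3 : i.rev = x; · exact .inr (.inr (.inl h3))
    exact .inr (.inr (.inr (⟨Ne.symm h1, Ne.symm h2, Ne.symm h3⟩)))
  rcases cs m with rfl | rfl | rfl | ⟨hm1, hm2, hm3⟩ <;>
  rcases cs n with rfl | rfl | rfl | ⟨hn1, hn2, hn3⟩
  on_goal 16 =>
    simp only [hS, hT, hT', hcup, map_add, map_sub, map_smul, SCol, TCol, TColOp, if_false,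
      hj.symm, hw, hji, n1, n1.symm, n2, n2.symm, n3, n3.symm, lt1, lt2, lt3, lt4, lt5, lt6, ha', ha'', hs', hω1, hω2, hm1, hm2, hm3, hn1, hn2, hn3]
    simp
  on_goal 15 =>
    have q1 := W.w_sq i m hm1 hm3
    have q2 := inv_eq_of_mul_eq_one_right q1
    have q3 := W.w_sq j m hm2 (hj ▸ hm2)
    have q4 := inv_eq_of_mul_eq_one_right q3
    simp only [hS, hT, hT', hcup, map_add, map_sub, map_smul, SCol, TCol, TColOp, Fin.rev_rev,
      Fin.rev_inj, if_true, if_false, W.w_rev, W.w_rev_left, map_zero,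
      zero_add, add_zero, sub_zero, smul_zero, zero_smul, lt_irrefl, inv_inv, inv_one, hj.symm, hw, hji, n1, n1.symm, n2, n2.symm, n3, n3.symm, lt1, lt2, lt3, lt4, lt5, lt6, ha', ha'', hs', hω1, hω2, hm1, hm2, hm3, hm1.symm, hm2.symm, hm3.symm, r1 m hm1 hm2 hm3, r2 m hm1 hm2 hm3, r3 m hm1 hm2 hm3, r4 m hm1 hm2 hm3, rr m i hm3, rr m j (hj ▸ hm2), W.w_comm m i, W.w_comm m j, q2, q4]
    try (match_scalars <;> clear * - hcs hci hcj hci' ha hss hs' ha' q1 q3 <;> grind)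
  on_goal 14 =>
    have q1 := W.w_sq i m hm1 hm3
    have q2 := inv_eq_of_mul_eq_one_right q1
    have q3 := W.w_sq j m hm2 (hj ▸ hm2)
    have q4 := inv_eq_of_mul_eq_one_right q3
    simp only [hS, hT, hT', hcup, map_add, map_sub, map_smul, SCol, TCol, TColOp, Fin.rev_rev,
      Fin.rev_inj, if_true, if_false, W.w_rev, W.w_rev_left, map_zero,
      zero_add, add_zero, sub_zero, smul_zero, zero_smul, lt_irrefl, inv_inv, inv_one, hj.symm, hw, hji, n1, n1.symm, n2, n2.symm, n3, n3.symm, lt1, lt2, lt3, lt4, lt5, lt6, ha', ha'', hs', hω1, hω2, hm1, hm2, hm3, hm1.symm, hm2.symm, hm3.symm, r1 m hm1 hm2 hm3, r2 m hm1 hm2 hm3, r3 m hm1 hm2 hm3, r4 m hm1 hm2 hm3, rr m i hm3, rr m j (hj ▸ hm2), W.w_comm m i, W.w_comm m j, q2, q4]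
    try (match_scalars <;> clear * - hcs hci hcj hci' ha hss hs' ha' q1 q3 <;> grind)
  on_goal 13 =>
    have q1 := W.w_sq i m hm1 hm3
    have q2 := inv_eq_of_mul_eq_one_right q1
    have q3 := W.w_sq j m hm2 (hj ▸ hm2)
    have q4 := inv_eq_of_mul_eq_one_right q3
    simp only [hS, hT, hT', hcup, map_add, map_sub, map_smul, SCol, TCol, TColOp, Fin.rev_rev,
      Fin.rev_inj, if_true, if_false, W.w_rev, W.w_rev_left, map_zero,
      zero_add, add_zero, sub_zero, smul_zero, zero_smul, lt_irrefl, inv_inv, inv_one, hj.symm, hw, hji, n1, n1.symm, n2, n2.symm, n3, n3.symm, lt1, lt2, lt3, lt4, lt5, lt6, ha', ha'', hs', hω1, hω2, hm1, hm2, hm3, hm1.symm, hm2.symm, hm3.symm, r1 m hm1 hm2 hm3, r2 m hm1 hm2 hm3, r3 m hm1 hm2 hm3, r4 m hm1 hm2 hm3, rr m i hm3, rr m j (hj ▸ hm2), W.w_comm m i, W.w_comm m j, q2, q4]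
    try (match_scalars <;> clear * - hcs hci hcj hci' ha hss hs' ha' q1 q3 <;> grind)
  on_goal 12 =>
    have q1 := W.w_sq i n hn1 hn3
    have q2 := inv_eq_of_mul_eq_one_right q1
    have q3 := W.w_sq j n hn2 (hj ▸ hn2)
    have q4 := inv_eq_of_mul_eq_one_right q3
    simp only [hS, hT, hT', hcup, map_add, map_sub, map_smul, SCol, TCol, TColOp, Fin.rev_rev,
      Fin.rev_inj, if_true, if_false, W.w_rev, W.w_rev_left, map_zero,
      zero_add, add_zero, sub_zero, smul_zero, zero_smul, lt_irrefl, inv_inv, inv_one, hj.symm, hw, hji, n1, n1.symm, n2, n2.symm, n3, n3.symm, lt1, lt2, lt3, lt4, lt5, lt6, ha', ha'', hs', hω1, hω2, hn1, hn2, hn3, hn1.symm, hn2.symm, hn3.symm, r1 n hn1 hn2 hn3, r2 n hn1 hn2 hn3, r3 n hn1 hn2 hn3, r4 n hn1 hn2 hn3, rr n i hn3, rr n j (hj ▸ hn2), W.w_comm n i, W.w_comm n j, q2, q4]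
    try (match_scalars <;> clear * - hcs hci hcj hci' ha hss hs' ha' q1 q3 <;> grind)
  on_goal 8 =>
    have q1 := W.w_sq i n hn1 hn3
    have q2 := inv_eq_of_mul_eq_one_right q1
    have q3 := W.w_sq j n hn2 (hj ▸ hn2)
    have q4 := inv_eq_of_mul_eq_one_right q3
    simp only [hS, hT, hT', hcup, map_add, map_sub, map_smul, SCol, TCol, TColOp, Fin.rev_rev,
      Fin.rev_inj, if_true, if_false, W.w_rev, W.w_rev_left, map_zero,
      zero_add, add_zero, sub_zero, smul_zero, zero_smul, lt_irrefl, inv_inv, inv_one, hj.symm, hw, hji, n1, n1.symm, n2, n2.symm, n3, n3.symm, lt1, lt2, lt3, lt4, lt5, lt6, ha', ha'', hs', hω1, hω2, hn1, hn2, hn3, hn1.symm, hn2.symm, hn3.symm, r1 n hn1 hn2 hn3, r2 n hn1 hn2 hn3, r3 n hn1 hn2 hn3, r4 n hn1 hn2 hn3, rr n i hn3, rr n j (hj ▸ hn2), W.w_comm n i, W.w_comm n j, q2, q4]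
    try (match_scalars <;> clear * - hcs hci hcj hci' ha hss hs' ha' q1 q3 <;> grind)
  on_goal 4 =>
    have q1 := W.w_sq i n hn1 hn3
    have q2 := inv_eq_of_mul_eq_one_right q1
    have q3 := W.w_sq j n hn2 (hj ▸ hn2)
    have q4 := inv_eq_of_mul_eq_one_right q3
    simp only [hS, hT, hT', hcup, map_add, map_sub, map_smul, SCol, TCol, TColOp, Fin.rev_rev,
      Fin.rev_inj, if_true, if_false, W.w_rev, W.w_rev_left, map_zero,
      zero_add, add_zero, sub_zero, smul_zero, zero_smul, lt_irrefl, inv_inv, inv_one, hj.symm, hw, hji, n1, n1.symm, n2, n2.symm, n3, n3.symm, lt1, lt2, lt3, lt4, lt5, lt6, ha', ha'', hs', hω1, hω2, hn1, hn2, hn3, hn1.symm, hn2.symm, hn3.symm, r1 n hn1 hn2 hn3, r2 n hn1 hn2 hn3, r3 n hn1 hn2 hn3, r4 n hn1 hn2 hn3, rr n i hn3, rr n j (hj ▸ hn2), W.w_comm n i, W.w_comm n j, q2, q4]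
    try (match_scalars <;> clear * - hcs hci hcj hci' ha hss hs' ha' q1 q3 <;> grind)
  all_goals
    simp only [hS, hT, hT', hcup, map_add, map_sub, map_smul, SCol, TCol, TColOp, Fin.rev_rev,
      Fin.rev_inj, if_true, if_false, W.w_rev, W.w_rev_left, map_zero,
      zero_add, add_zero, sub_zero, smul_zero, zero_smul, lt_irrefl, inv_inv, inv_one, hj.symm, hw, hji, n1, n1.symm, n2, n2.symm, n3, n3.symm, lt1, lt2, lt3, lt4, lt5, lt6, ha', ha'', hs', hω1, hω2, hij]
    try (match_scalars <;> clear * - hcs hci hcj hci' ha hss hs' ha' <;> grind)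

-- The mirror image of the preceding case: i is the midpoint and the distinguished indices are j',
-- i, j.
set_option maxHeartbeats 1000000 in
theorem intertwine_right_of_mid {i j : Fin N} (hij : (i : ℕ) + 1 = j) (hi : i = i.rev)
    (hS : ∀ m n, S (v m n) = W.SCol v m n)
    (hT : ∀ m n, T (v m n) = W.TCol v i j (W.c i * (W.c j)⁻¹) m n)
    (hT' : ∀ m n, T' (v m n) = W.TColOp v i j (W.c i * (W.c j)⁻¹) m n) (m n : Fin N) :
    T (S (v m n)) = S (T' (v m n)) := by
  have v1 := Fin.val_rev i
  have v2 := Fin.val_rev j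
  have lt1 : i < j := by omega
  have lt3 : ¬ j < i := by omega
  have hci := W.c_ne i
  have hcj := W.c_ne j
  have hai := W.w_ne i i
  have hbi := W.w_ne j j
  have hsi := W.w_ne i j
  have hji : W.w j i = W.w i j := W.w_comm _ _
  have n1 : i ≠ j := by omega
  have hcs := W.c_succ i j hij (by omega)
  have hw := W.w_mid i hi
  rw [← hi, hw, one_mul, mul_comm (W.c j)] at hcs
  have hcj' := W.c_ne j.rev
  have lt2 : j.rev < i := by omega
  have lt4 : ¬ i < j.rev := by omega
  have lt5 : j.rev < j := by omega
  have lt6 : ¬ j < j.rev := by omega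
  have r1 : ∀ x, x ≠ i → x ≠ j → x ≠ j.rev → (x < j ↔ x < i) := by intros; omega
  have r2 : ∀ x, x ≠ i → x ≠ j → x ≠ j.rev → (j < x ↔ i < x) := by intros; omega
  have r3 : ∀ x, x ≠ i → x ≠ j → x ≠ j.rev → (x < j.rev ↔ x < i) := by intros; omega
  have r4 : ∀ x, x ≠ i → x ≠ j → x ≠ j.rev → (j.rev < x ↔ i < x) := by intros; omega
  have n2 : i ≠ j.rev := by omega
  have n3 : j ≠ j.rev := by omega
  have ha := W.w_hecke j n3
  have hss := W.w_sq i j n1.symm (by omega)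
  have hs' : (W.w i j)⁻¹ = W.w i j := by field_simp; linear_combination -hss
  have ha' : (W.w j j)⁻¹ = W.w j j + W.κ := by field_simp; linear_combination -ha
  have ha'' : (W.w j j + W.κ)⁻¹ = W.w j j := by rw [← ha', inv_inv]
  have hcup : ∀ m, T (∑ k with k < m, W.c k • v k k.rev) =
      (if m = i then - W.c i else 0) • v i j +
      (if m = j then W.c i * W.w i j else 0) • v j i := by
    intro m
    rw [W.map_cupSum hT, ← hi, hw, hs']
    have e1 : W.c i * (W.c j)⁻¹ * W.c j.rev * W.w j j = W.c i := by
      field_simp; apply mul_left_cancel₀ hci; linear_combination hcs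
    rw [e1]
    congr 2 <;> clear hT hT' hS <;> rcases lt_trichotomy m i with h | h | h <;> grind
  have hω1 : ∑ k with k < j, W.c k • v k k.rev =
      ∑ k with k < i, W.c k • v k k.rev + W.c i • v i i := by
    have : (Finset.univ.filter fun k => k < j) = insert i (Finset.univ.filter fun k => k < i) := by
      ext k; simp; omega
    rw [this, Finset.sum_insert (by simp), add_comm, ← hi]
  have hω2 : ∑ k with k < i, W.c k • v k k.rev =
      ∑ k with k < j.rev, W.c k • v k k.rev + W.c j.rev • v j.rev j := by
    have : (Finset.univ.filter fun k => k < i) =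
        insert j.rev (Finset.univ.filter fun k => k < j.rev) := by
      ext k; simp; omega
    rw [this, Finset.sum_insert (by simp), add_comm, Fin.rev_rev]
  have rr (x y : Fin N) : x ≠ y.rev → y ≠ x.rev := by rintro h rfl; simp at h
  have cs (x : Fin N) : i = x ∨ j = x ∨ j.rev = x ∨ (x ≠ i ∧ x ≠ j ∧ x ≠ j.rev) := by
    by_cases h1 : i = x; · exact .inl h1
    by_cases h2 : j = x; · exact .inr (.inl h2)
    by_cases h3 : j.rev = x; · exact .inr (.inr (.inl h3))
    exact .inr (.inr (.inr (⟨Ne.symm h1, Ne.symm h2, Ne.symm h3⟩)))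
  rcases cs m with rfl | rfl | rfl | ⟨hm1, hm2, hm3⟩ <;>
  rcases cs n with rfl | rfl | rfl | ⟨hn1, hn2, hn3⟩
  on_goal 16 =>
    simp only [hS, hT, hT', hcup, map_add, map_sub, map_smul, SCol, TCol, TColOp, if_false,
      hi.symm, hw, hji, n1, n1.symm, n2, n2.symm, n3, n3.symm, lt1, lt2, lt3, lt4, lt5, lt6, ha', ha'', hs', hω1, hω2, hm1, hm2, hm3, hn1, hn2, hn3]
    simp
  on_goal 15 =>
    have q1 := W.w_sq i m hm1 (hi ▸ hm1)
    have q2 := inv_eq_of_mul_eq_one_right q1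
    have q3 := W.w_sq j m hm2 hm3
    have q4 := inv_eq_of_mul_eq_one_right q3
    simp only [hS, hT, hT', hcup, map_add, map_sub, map_smul, SCol, TCol, TColOp, Fin.rev_rev,
      Fin.rev_inj, if_true, if_false, W.w_rev, W.w_rev_left, map_zero,
      zero_add, add_zero, sub_zero, smul_zero, zero_smul, lt_irrefl, inv_inv, inv_one, hi.symm, hw, hji, n1, n1.symm, n2, n2.symm, n3, n3.symm, lt1, lt2, lt3, lt4, lt5, lt6, ha', ha'', hs', hω1, hω2, hm1, hm2, hm3, hm1.symm, hm2.symm, hm3.symm, r1 m hm1 hm2 hm3, r2 m hm1 hm2 hm3, r3 m hm1 hm2 hm3, r4 m hm1 hm2 hm3, rr m j hm3, rr m i (hi ▸ hm1), W.w_comm m i, W.w_comm m j, q2, q4]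
    try (match_scalars <;> clear * - hcs hci hcj hcj' ha hss hs' ha' q1 q3 <;> grind)
  on_goal 14 =>
    have q1 := W.w_sq i m hm1 (hi ▸ hm1)
    have q2 := inv_eq_of_mul_eq_one_right q1
    have q3 := W.w_sq j m hm2 hm3
    have q4 := inv_eq_of_mul_eq_one_right q3
    simp only [hS, hT, hT', hcup, map_add, map_sub, map_smul, SCol, TCol, TColOp, Fin.rev_rev,
      Fin.rev_inj, if_true, if_false, W.w_rev, W.w_rev_left, map_zero,
      zero_add, add_zero, sub_zero, smul_zero, zero_smul, lt_irrefl, inv_inv, inv_one, hi.symm, hw, hji, n1, n1.symm, n2, n2.symm, n3, n3.symm, lt1, lt2, lt3, lt4, lt5, lt6, ha', ha'', hs', hω1, hω2, hm1, hm2, hm3, hm1.symm, hm2.symm, hm3.symm, r1 m hm1 hm2 hm3, r2 m hm1 hm2 hm3, r3 m hm1 hm2 hm3, r4 m hm1 hm2 hm3, rr m j hm3, rr m i (hi ▸ hm1), W.w_comm m i, W.w_comm m j, q2, q4]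
    try (match_scalars <;> clear * - hcs hci hcj hcj' ha hss hs' ha' q1 q3 <;> grind)
  on_goal 13 =>
    have q1 := W.w_sq i m hm1 (hi ▸ hm1)
    have q2 := inv_eq_of_mul_eq_one_right q1
    have q3 := W.w_sq j m hm2 hm3
    have q4 := inv_eq_of_mul_eq_one_right q3
    simp only [hS, hT, hT', hcup, map_add, map_sub, map_smul, SCol, TCol, TColOp, Fin.rev_rev,
      Fin.rev_inj, if_true, if_false, W.w_rev, W.w_rev_left, map_zero,
      zero_add, add_zero, sub_zero, smul_zero, zero_smul, lt_irrefl, inv_inv, inv_one, hi.symm, hw, hji, n1, n1.symm, n2, n2.symm, n3, n3.symm, lt1, lt2, lt3, lt4, lt5, lt6, ha', ha'', hs', hω1, hω2, hm1, hm2, hm3, hm1.symm, hm2.symm, hm3.symm, r1 m hm1 hm2 hm3, r2 m hm1 hm2 hm3, r3 m hm1 hm2 hm3, r4 m hm1 hm2 hm3, rr m j hm3, rr m i (hi ▸ hm1), W.w_comm m i, W.w_comm m j, q2, q4]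
    try (match_scalars <;> clear * - hcs hci hcj hcj' ha hss hs' ha' q1 q3 <;> grind)
  on_goal 12 =>
    have q1 := W.w_sq i n hn1 (hi ▸ hn1)
    have q2 := inv_eq_of_mul_eq_one_right q1
    have q3 := W.w_sq j n hn2 hn3
    have q4 := inv_eq_of_mul_eq_one_right q3
    simp only [hS, hT, hT', hcup, map_add, map_sub, map_smul, SCol, TCol, TColOp, Fin.rev_rev,
      Fin.rev_inj, if_true, if_false, W.w_rev, W.w_rev_left, map_zero,
      zero_add, add_zero, sub_zero, smul_zero, zero_smul, lt_irrefl, inv_inv, inv_one, hi.symm, hw, hji, n1, n1.symm, n2, n2.symm, n3, n3.symm, lt1, lt2, lt3, lt4, lt5, lt6, ha', ha'', hs', hω1, hω2, hn1, hn2, hn3, hn1.symm, hn2.symm, hn3.symm, r1 n hn1 hn2 hn3, r2 n hn1 hn2 hn3, r3 n hn1 hn2 hn3, r4 n hn1 hn2 hn3, rr n j hn3, rr n i (hi ▸ hn1), W.w_comm n i, W.w_comm n j, q2, q4]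
    try (match_scalars <;> clear * - hcs hci hcj hcj' ha hss hs' ha' q1 q3 <;> grind)
  on_goal 8 =>
    have q1 := W.w_sq i n hn1 (hi ▸ hn1)
    have q2 := inv_eq_of_mul_eq_one_right q1
    have q3 := W.w_sq j n hn2 hn3
    have q4 := inv_eq_of_mul_eq_one_right q3
    simp only [hS, hT, hT', hcup, map_add, map_sub, map_smul, SCol, TCol, TColOp, Fin.rev_rev,
      Fin.rev_inj, if_true, if_false, W.w_rev, W.w_rev_left, map_zero,
      zero_add, add_zero, sub_zero, smul_zero, zero_smul, lt_irrefl, inv_inv, inv_one, hi.symm, hw, hji, n1, n1.symm, n2, n2.symm, n3, n3.symm, lt1, lt2, lt3, lt4, lt5, lt6, ha', ha'', hs', hω1, hω2, hn1, hn2, hn3, hn1.symm, hn2.symm, hn3.symm, r1 n hn1 hn2 hn3, r2 n hn1 hn2 hn3, r3 n hn1 hn2 hn3, r4 n hn1 hn2 hn3, rr n j hn3, rr n i (hi ▸ hn1), W.w_comm n i, W.w_comm n j, q2, q4]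
    try (match_scalars <;> clear * - hcs hci hcj hcj' ha hss hs' ha' q1 q3 <;> grind)
  on_goal 4 =>
    have q1 := W.w_sq i n hn1 (hi ▸ hn1)
    have q2 := inv_eq_of_mul_eq_one_right q1
    have q3 := W.w_sq j n hn2 hn3
    have q4 := inv_eq_of_mul_eq_one_right q3
    simp only [hS, hT, hT', hcup, map_add, map_sub, map_smul, SCol, TCol, TColOp, Fin.rev_rev,
      Fin.rev_inj, if_true, if_false, W.w_rev, W.w_rev_left, map_zero,
      zero_add, add_zero, sub_zero, smul_zero, zero_smul, lt_irrefl, inv_inv, inv_one, hi.symm, hw, hji, n1, n1.symm, n2, n2.symm, n3, n3.symm, lt1, lt2, lt3, lt4, lt5, lt6, ha', ha'', hs', hω1, hω2, hn1, hn2, hn3, hn1.symm, hn2.symm, hn3.symm, r1 n hn1 hn2 hn3, r2 n hn1 hn2 hn3, r3 n hn1 hn2 hn3, r4 n hn1 hn2 hn3, rr n j hn3, rr n i (hi ▸ hn1), W.w_comm n i, W.w_comm n j, q2, q4]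
    try (match_scalars <;> clear * - hcs hci hcj hcj' ha hss hs' ha' q1 q3 <;> grind)
  all_goals
    simp only [hS, hT, hT', hcup, map_add, map_sub, map_smul, SCol, TCol, TColOp, Fin.rev_rev,
      Fin.rev_inj, if_true, if_false, W.w_rev, W.w_rev_left, map_zero,
      zero_add, add_zero, sub_zero, smul_zero, zero_smul, lt_irrefl, inv_inv, inv_one, hi.symm, hw, hji, n1, n1.symm, n2, n2.symm, n3, n3.symm, lt1, lt2, lt3, lt4, lt5, lt6, ha', ha'', hs', hω1, hω2, hij]
    try (match_scalars <;> clear * - hcs hci hcj hcj' ha hss hs' ha' <;> grind)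

-- The two middle indices when their number is even, in the symplectic-like situation c i (w i i)² =
-- -c j. Here e = E_ji - g E_i'j' is a multiple of the single matrix unit E_ji, attached to the long
-- root 2ε_i.
set_option maxHeartbeats 1000000 in
theorem intertwine_mid {i j : Fin N} (hij : (i : ℕ) + 1 = j) (hj : j = i.rev)
    (hcs : W.c i * (W.w i i * W.w i i) = - W.c j)
    (hS : ∀ m n, S (v m n) = W.SCol v m n)
    (hT : ∀ m n, T (v m n) = W.TCol v i j (W.c i * (W.c j)⁻¹) m n)
    (hT' : ∀ m n, T' (v m n) = W.TColOp v i j (W.c i * (W.c j)⁻¹) m n) (m n : Fin N) :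
    T (S (v m n)) = S (T' (v m n)) := by
  have v1 := Fin.val_rev i
  have v2 := Fin.val_rev j
  have lt1 : i < j := by omega
  have lt3 : ¬ j < i := by omega
  have hci := W.c_ne i
  have hcj := W.c_ne j
  have hai := W.w_ne i i
  have hbi := W.w_ne j j
  have hsi := W.w_ne i j
  have hji : W.w j i = W.w i j := W.w_comm _ _
  have n1 : i ≠ j := by omega
  have hir : i.rev = j := hj.symm
  have hjr : j.rev = i := by omega
  have hij' : W.w i j = (W.w i i)⁻¹ := by rw [hj, W.w_rev]
  have hjj : W.w j j = W.w i i := by rw [hj, W.w_rev_rev]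
  have r1 : ∀ x, x ≠ i → x ≠ j → (x < j ↔ x < i) := by intros; omega
  have r2 : ∀ x, x ≠ i → x ≠ j → (j < x ↔ i < x) := by intros; omega
  have ha := W.w_hecke i (by omega)
  have ha' : (W.w i i)⁻¹ = W.w i i + W.κ := by field_simp; linear_combination -ha
  have ha'' : (W.w i i + W.κ)⁻¹ = W.w i i := by rw [← ha', inv_inv]
  -- Since i' = j, all four contributions are multiples of v j j. The assumption `hcs` makes the
  -- total supported at the single cut m = j.
  have hcup : ∀ m, T (∑ k with k < m, W.c k • v k k.rev) =
      (if m = j then W.c i * W.w i i + W.c i * (W.w i i)⁻¹ else 0) • v j j := by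
    intro m
    rw [W.map_cupSum hT, hir, hjr, hij', hjj, inv_inv, ← add_smul]
    have e1 : W.c i * (W.c j)⁻¹ * W.c j = W.c i := by field_simp
    have e2 : W.c j * (W.w i i)⁻¹ = - (W.c i * W.w i i) := by
      field_simp; linear_combination hcs
    have e3 : W.c i * (W.c j)⁻¹ * W.c i * W.w i i = - (W.c i * (W.w i i)⁻¹) := by
      field_simp; linear_combination hcs
    rw [e1, e2, e3]
    congr 2
    clear hT hT' hS
    rcases lt_trichotomy m i with h | h | h <;> grind
  have hω1 : ∑ k with k < j, W.c k • v k k.rev =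
      ∑ k with k < i, W.c k • v k k.rev + W.c i • v i j := by
    have : (Finset.univ.filter fun k => k < j) = insert i (Finset.univ.filter fun k => k < i) := by
      ext k; simp; omega
    rw [this, Finset.sum_insert (by simp), add_comm, hir]
  have rr (x y : Fin N) : x ≠ y.rev → y ≠ x.rev := by rintro h rfl; simp at h
  have cs (x : Fin N) : i = x ∨ j = x ∨ (x ≠ i ∧ x ≠ j) := by
    by_cases h1 : i = x; · exact .inl h1
    by_cases h2 : j = x; · exact .inr (.inl h2)
    exact .inr (.inr ⟨Ne.symm h1, Ne.symm h2⟩)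
  rcases cs m with rfl | rfl | ⟨hm1, hm2⟩ <;>
  rcases cs n with rfl | rfl | ⟨hn1, hn2⟩
  on_goal 9 =>
    simp only [hS, hT, hT', hcup, map_add, map_sub, map_smul, SCol, TCol, TColOp, if_false,
      hir, hjr, hm1, hm2, hn1, hn2]
    simp
  on_goal 8 =>
    have q1 := W.w_sq i m hm1 (hj ▸ hm2)
    have q2 := inv_eq_of_mul_eq_one_right q1
    have q3 : W.w j m = W.w i m := by rw [hj, W.w_rev_left, q2]
    simp only [hS, hT, hT', hcup, map_add, map_sub, map_smul, SCol, TCol, TColOp, Fin.rev_rev,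
      Fin.rev_inj, if_true, if_false, W.w_rev, W.w_rev_left, map_zero,
      zero_add, add_zero, sub_zero, smul_zero, zero_smul, lt_irrefl, inv_inv, inv_one, hir, hjr, hji, hij', hjj, n1, n1.symm, lt1, lt3, ha', ha'', hω1, hm1, hm2, hm1.symm, hm2.symm, rr m i (hj ▸ hm2), rr m j (hjr.symm ▸ hm1),
      r1 m hm1 hm2, r2 m hm1 hm2, W.w_comm m i, W.w_comm m j, q2, q3]
    try (match_scalars <;> clear * - hcs hci hcj ha ha' ha'' q1 <;> grind)
  on_goal 7 =>
    have q1 := W.w_sq i m hm1 (hj ▸ hm2)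
    have q2 := inv_eq_of_mul_eq_one_right q1
    have q3 : W.w j m = W.w i m := by rw [hj, W.w_rev_left, q2]
    simp only [hS, hT, hT', hcup, map_add, map_sub, map_smul, SCol, TCol, TColOp, Fin.rev_rev,
      Fin.rev_inj, if_true, if_false, W.w_rev, W.w_rev_left, map_zero,
      zero_add, add_zero, sub_zero, smul_zero, zero_smul, lt_irrefl, inv_inv, inv_one, hir, hjr, hji, hij', hjj, n1, n1.symm, lt1, lt3, ha', ha'', hω1, hm1, hm2, hm1.symm, hm2.symm, rr m i (hj ▸ hm2), rr m j (hjr.symm ▸ hm1),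
      r1 m hm1 hm2, r2 m hm1 hm2, W.w_comm m i, W.w_comm m j, q2, q3]
    try (match_scalars <;> clear * - hcs hci hcj ha ha' ha'' q1 <;> grind)
  on_goal 6 =>
    have q1 := W.w_sq i n hn1 (hj ▸ hn2)
    have q2 := inv_eq_of_mul_eq_one_right q1
    have q3 : W.w j n = W.w i n := by rw [hj, W.w_rev_left, q2]
    simp only [hS, hT, hT', hcup, map_add, map_sub, map_smul, SCol, TCol, TColOp, Fin.rev_rev,
      Fin.rev_inj, if_true, if_false, W.w_rev, W.w_rev_left, map_zero,
      zero_add, add_zero, sub_zero, smul_zero, zero_smul, lt_irrefl, inv_inv, inv_one, hir, hjr, hji, hij', hjj, n1, n1.symm, lt1, lt3, ha', ha'', hω1, hn1, hn2, hn1.symm, hn2.symm, rr n i (hj ▸ hn2), rr n j (hjr.symm ▸ hn1),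
      r1 n hn1 hn2, r2 n hn1 hn2, W.w_comm n i, W.w_comm n j, q2, q3]
    try (match_scalars <;> clear * - hcs hci hcj ha ha' ha'' q1 <;> grind)
  on_goal 3 =>
    have q1 := W.w_sq i n hn1 (hj ▸ hn2)
    have q2 := inv_eq_of_mul_eq_one_right q1
    have q3 : W.w j n = W.w i n := by rw [hj, W.w_rev_left, q2]
    simp only [hS, hT, hT', hcup, map_add, map_sub, map_smul, SCol, TCol, TColOp, Fin.rev_rev,
      Fin.rev_inj, if_true, if_false, W.w_rev, W.w_rev_left, map_zero,
      zero_add, add_zero, sub_zero, smul_zero, zero_smul, lt_irrefl, inv_inv, inv_one, hir, hjr, hji, hij', hjj, n1, n1.symm, lt1, lt3, ha', ha'', hω1, hn1, hn2, hn1.symm, hn2.symm, rr n i (hj ▸ hn2), rr n j (hjr.symm ▸ hn1),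
      r1 n hn1 hn2, r2 n hn1 hn2, W.w_comm n i, W.w_comm n j, q2, q3]
    try (match_scalars <;> clear * - hcs hci hcj ha ha' ha'' q1 <;> grind)
  all_goals
    simp only [hS, hT, hT', hcup, map_add, map_sub, map_smul, SCol, TCol, TColOp, Fin.rev_rev,
      Fin.rev_inj, if_true, if_false, W.w_rev, W.w_rev_left, map_zero,
      zero_add, add_zero, sub_zero, smul_zero, zero_smul, lt_irrefl, inv_inv, inv_one, hir, hjr, hji, hij', hjj, n1, n1.symm, lt1, lt3, ha', ha'', hω1, hij]
    try (match_scalars <;> clear * - hcs hci hcj ha ha' ha'' <;> grind)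

end Base
end VertexWeights

/-! ### The Yang–Baxter equation by induction on the gap between indices -/

namespace VertexWeights
open scoped Kronecker

variable {K : Type*} [Field K] {N : ℕ} (W : VertexWeights K N)

/-- The component of the Yang–Baxter equation `R₁₂R₁₃R₂₃ = R₂₃R₁₃R₁₂` with indices `i`, `j` in the
first tensor factor. -/
def YangBaxterAt (i j : Fin N) : Prop := ∀ k m l n,
  ∑ a, ∑ b, ∑ c, W.S i k a b * W.S a m j c * W.S b c l n =
    ∑ a, ∑ b, ∑ c, W.S k m b c * W.S i c a n * W.S a b j l

/-- The entry of `R` at `E_ij` in the first tensor factor. -/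
def L (i j : Fin N) : Matrix (Fin N) (Fin N) K := Matrix.of fun k m => W.S i k j m

/-- The `R`-matrix. -/
def mat : Matrix (Fin N × Fin N) (Fin N × Fin N) K := Matrix.of fun x y => W.S x.1 x.2 y.1 y.2

/-- The entry of `R₁₂R₁₃` at `E_ij` in the first tensor factor. -/
def T (i j : Fin N) : Matrix (Fin N × Fin N) (Fin N × Fin N) K := ∑ a, W.L i a ⊗ₖ W.L a j

/-- The entry of `R₁₃R₁₂` at `E_ij` in the first tensor factor. -/
def TOp (i j : Fin N) : Matrix (Fin N × Fin N) (Fin N × Fin N) K := ∑ a, W.L a j ⊗ₖ W.L i a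

/-- Grouping the three sums as matrix products on the last two tensor factors turns a component of
the equation into an intertwining property, the form in which it can be multiplied and cancelled. -/
theorem yangBaxterAt_iff (i j : Fin N) :
    W.YangBaxterAt i j ↔ W.T i j * W.mat = W.mat * W.TOp i j := by
  rw [← Matrix.ext_iff]
  simp only [Prod.forall, YangBaxterAt, Matrix.mul_apply, T, TOp, Matrix.sum_apply, mat, L,
    Matrix.kroneckerMap_apply, Matrix.of_apply, Fintype.sum_prod_type, Finset.sum_mul,
    Finset.mul_sum]
  refine forall_congr' fun k => forall_congr' fun m => forall_congr' fun l =>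
    forall_congr' fun n => ?_
  have h1 : ∑ a, ∑ b, ∑ c, W.S i k a b * W.S a m j c * W.S b c l n =
      ∑ b, ∑ c, ∑ a, W.S i k a b * W.S a m j c * W.S b c l n := by
    rw [Finset.sum_comm]
    exact Finset.sum_congr rfl fun b _ => Finset.sum_comm
  have h2 : ∑ a, ∑ b, ∑ c, W.S k m b c * W.S i c a n * W.S a b j l =
      ∑ b, ∑ c, ∑ a, W.S k m b c * (W.S a b j l * W.S i c a n) := by
    rw [Finset.sum_comm]
    refine Finset.sum_congr rfl fun b _ => ?_
    rw [Finset.sum_comm]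
    refine Finset.sum_congr rfl fun c _ => Finset.sum_congr rfl fun a _ => by ring
  rw [h1, h2]

/-- The same component with the third tensor factor kept as the matrix space: the entries of R in
one factor satisfy the RLL relation. -/
theorem rll_of_yangBaxterAt {i j : Fin N} (h : W.YangBaxterAt i j) (p b : Fin N) :
    ∑ x, ∑ y, W.S i p x y • (W.L x j * W.L y b) =
      ∑ x, ∑ y, W.S x y j b • (W.L p y * W.L i x) := by
  ext r t
  have := h p r b t
  simp only [Matrix.sum_apply, Matrix.smul_apply, Matrix.mul_apply, L, Matrix.of_apply,
    smul_eq_mul, Finset.mul_sum]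
  refine Eq.trans ?_ (this.trans ?_)
  · refine Finset.sum_congr rfl fun x _ => Finset.sum_congr rfl fun y _ =>
      Finset.sum_congr rfl fun z _ => by ring
  · refine Finset.sum_congr rfl fun x _ => Finset.sum_congr rfl fun y _ =>
      Finset.sum_congr rfl fun z _ => by ring

theorem S_eq_zero {i j : Fin N} (h : j < i) (k l : Fin N) : W.S i k j l = 0 := by
  simp [S, h.ne, not_lt.2 h.le]

theorem L_eq_zero {i j : Fin N} (h : j < i) : W.L i j = 0 := by
  ext k l; exact W.S_eq_zero h k l

theorem T_eq_zero {i j : Fin N} (h : j < i) : W.T i j = 0 := by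
  refine Finset.sum_eq_zero fun a _ => ?_
  rcases lt_or_ge a i with h' | h'
  · simp [W.L_eq_zero h']
  · simp [W.L_eq_zero (h.trans_le h')]

theorem TOp_eq_zero {i j : Fin N} (h : j < i) : W.TOp i j = 0 := by
  refine Finset.sum_eq_zero fun a _ => ?_
  rcases lt_or_ge a i with h' | h'
  · simp [W.L_eq_zero h']
  · simp [W.L_eq_zero (h.trans_le h')]

theorem yangBaxterAt_of_lt {i j : Fin N} (h : j < i) : W.YangBaxterAt i j := by
  rw [yangBaxterAt_iff, T_eq_zero _ h, TOp_eq_zero _ h, zero_mul, mul_zero]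

theorem kronecker_sum {ι m n p q : Type*} (A : Matrix m n K) (s : Finset ι)
    (f : ι → Matrix p q K) : A ⊗ₖ (∑ i ∈ s, f i) = ∑ i ∈ s, A ⊗ₖ f i := by
  ext; simp [Matrix.sum_apply, Finset.mul_sum]

theorem sum_kronecker {ι m n p q : Type*} (A : Matrix m n K) (s : Finset ι)
    (f : ι → Matrix p q K) : (∑ i ∈ s, f i) ⊗ₖ A = ∑ i ∈ s, f i ⊗ₖ A := by
  ext; simp [Matrix.sum_apply, Finset.sum_mul]

theorem T_mul_T (x j y k : Fin N) : W.T x j * W.T y k =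
    ∑ a, ∑ b, (W.L x a * W.L y b) ⊗ₖ (W.L a j * W.L b k) := by
  simp only [T, Finset.sum_mul_sum, Matrix.mul_kronecker_mul]

/-- The relation `R₁₂ T₁ T₂ = T₂ T₁ R₁₂`, in the components for which it follows from the given
components of the Yang–Baxter equation. -/
theorem rtt {i j : Fin N} (h1 : ∀ a ≤ j, W.YangBaxterAt i a) (h2 : ∀ a, i ≤ a → W.YangBaxterAt a j)
    (p k : Fin N) :
    ∑ x, ∑ y, W.S i p x y • (W.T x j * W.T y k) =
      ∑ x, ∑ y, W.S x y j k • (W.T p y * W.T i x) := by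
  calc ∑ x, ∑ y, W.S i p x y • (W.T x j * W.T y k)
      = ∑ a, ∑ b, (∑ x, ∑ y, W.S i p x y • (W.L x a * W.L y b)) ⊗ₖ (W.L a j * W.L b k) := by
        simp only [T_mul_T, Finset.smul_sum, sum_kronecker, Matrix.smul_kronecker]
        rw [Finset.sum_congr rfl fun x _ => Finset.sum_comm, Finset.sum_comm]
        refine Finset.sum_congr rfl fun a _ => ?_
        rw [Finset.sum_congr rfl fun x _ => Finset.sum_comm, Finset.sum_comm]
    _ = ∑ a, ∑ b, (∑ x, ∑ y, W.S x y a b • (W.L p y * W.L i x)) ⊗ₖ (W.L a j * W.L b k) := by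
        refine Finset.sum_congr rfl fun a _ => Finset.sum_congr rfl fun b _ => ?_
        -- For a > j the right factor contains L a j = 0, so only components already assumed are
        -- used; the second exchange is restricted to i ≤ x in the same way. This is what makes the
        -- relation available inside the induction.
        rcases le_or_gt a j with h | h
        · rw [W.rll_of_yangBaxterAt (h1 a h)]
        · simp [W.L_eq_zero h]
    _ = ∑ x, ∑ y, (W.L p y * W.L i x) ⊗ₖ (∑ a, ∑ b, W.S x y a b • (W.L a j * W.L b k)) := by
        simp only [sum_kronecker, kronecker_sum, Matrix.smul_kronecker, Matrix.kronecker_smul]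
        rw [Finset.sum_congr rfl fun x _ => Finset.sum_comm, Finset.sum_comm]
        refine Finset.sum_congr rfl fun a _ => ?_
        rw [Finset.sum_congr rfl fun x _ => Finset.sum_comm, Finset.sum_comm]
    _ = ∑ x, ∑ y, (W.L p y * W.L i x) ⊗ₖ (∑ a, ∑ b, W.S a b j k • (W.L y b * W.L x a)) := by
        refine Finset.sum_congr rfl fun x _ => Finset.sum_congr rfl fun y _ => ?_
        rcases le_or_gt i x with h | h
        · rw [W.rll_of_yangBaxterAt (h2 x h)]
        · simp [W.L_eq_zero h]
    _ = ∑ x, ∑ y, W.S x y j k • (W.T p y * W.T i x) := by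
        simp only [T_mul_T, Finset.smul_sum, kronecker_sum, Matrix.kronecker_smul]
        rw [Finset.sum_congr rfl fun x _ => Finset.sum_comm, Finset.sum_comm]
        refine Finset.sum_congr rfl fun a _ => ?_
        rw [Finset.sum_congr rfl fun x _ => Finset.sum_comm, Finset.sum_comm]
        refine Finset.sum_congr rfl fun b _ => Finset.sum_comm

/-- Conjugation by the flip of the tensor factors. -/
def flipEquiv (K : Type*) [Field K] (N : ℕ) : Matrix (Fin N × Fin N) (Fin N × Fin N) K ≃ₐ[K]
    Matrix (Fin N × Fin N) (Fin N × Fin N) K :=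
  Matrix.reindexAlgEquiv K K (Equiv.prodComm (Fin N) (Fin N))

theorem flipEquiv_T (i j : Fin N) : flipEquiv K N (W.T i j) = W.TOp i j := by
  ext ⟨a, b⟩ ⟨c, d⟩
  simp [flipEquiv, T, TOp, Matrix.sum_apply, mul_comm]

theorem sum_row {M : Type*} [AddCommGroup M] [Module K M] {i j : Fin N} (hij : i < j)
    (f : Fin N → Fin N → M) : ∑ x, ∑ y, W.S i j x y • f x y =
      W.w i j • f i j - W.κ • f j i +
        (if j = i.rev then ∑ x with i < x, (W.κ * (W.c i * (W.c x)⁻¹)) • f x x.rev else 0) := by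
  simp only [S, add_smul, sub_smul, Finset.sum_add_distrib, Finset.sum_sub_distrib, ite_smul,
    zero_smul, ite_and, Finset.sum_ite_eq', Finset.mem_univ, if_true]
  congr 1
  · congr 1
    · simp
    · rw [Finset.sum_eq_single j]
      · simp [hij]
      · intro b _ hb
        simp [hb.symm]
      · simp
  · split_ifs with h
    · simp [Finset.sum_filter]
    · simp

theorem sum_col {M : Type*} [AddCommGroup M] [Module K M] (j k : Fin N)
    (f : Fin N → Fin N → M) : ∑ x, ∑ y, W.S x y j k • f x y =
      W.w j k • f j k - (if k < j then W.κ • f k j else 0) +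
        (if k = j.rev then ∑ x with x < j, (W.κ * (W.c x * (W.c j)⁻¹)) • f x x.rev else 0) := by
  simp only [S, add_smul, sub_smul, Finset.sum_add_distrib, Finset.sum_sub_distrib, ite_smul,
    zero_smul, ite_and]
  congr 1
  · congr 1
    · rw [Finset.sum_eq_single j]
      · simp
      · intro b _ hb; simp [hb.symm]
      · simp
    · rw [Finset.sum_eq_single k]
      · rw [Finset.sum_eq_single j]
        · simp
        · intro b _ hb; simp [hb]
        · simp
      · intro b _ hb
        refine Finset.sum_eq_zero fun y _ => ?_
        simp [hb.symm]
      · simp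
  · split_ifs with h
    · rw [Finset.sum_filter]
      refine Finset.sum_congr rfl fun x _ => ?_
      rw [Finset.sum_eq_single x.rev]
      · simp
      · intro b _ hb; simp [hb]
      · simp
    · simp

theorem L_self (i : Fin N) : W.L i i = Matrix.diagonal (W.w i) := by
  ext k l
  simp only [L, S, Matrix.of_apply, true_and, lt_irrefl, false_and, if_false, sub_zero, add_zero,
    Matrix.diagonal_apply, eq_comm]

theorem T_self (i : Fin N) :
    W.T i i = Matrix.diagonal (fun x : Fin N × Fin N => W.w i x.1 * W.w i x.2) := by
  rw [T, Finset.sum_eq_single i]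
  · rw [L_self, Matrix.diagonal_kronecker_diagonal]
  · intro b _ hb
    rcases lt_or_gt_of_ne hb with h | h
    · simp [W.L_eq_zero h]
    · simp [W.L_eq_zero h]
  · simp

theorem TOp_self (i : Fin N) : W.TOp i i = W.T i i := by
  rw [← flipEquiv_T, T_self]
  ext ⟨a, b⟩ ⟨c, d⟩
  simp [flipEquiv, Matrix.diagonal_apply, mul_comm, and_comm]

theorem isUnit_T_self (i : Fin N) : IsUnit (W.T i i) := by
  rw [T_self, Matrix.isUnit_diagonal]
  rw [Pi.isUnit_iff]
  intro x
  exact (mul_ne_zero (W.w_ne _ _) (W.w_ne _ _)).isUnit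

/-- T i i is diagonal with entries w i k * w i m, and this weight is conserved by every transition
of S: it is symmetric under transposition, and equals 1 on all pairs (k, k'). -/
theorem yangBaxterAt_self (i : Fin N) : W.YangBaxterAt i i := by
  rw [yangBaxterAt_iff, TOp_self, T_self]
  ext ⟨k, m⟩ ⟨l, n⟩
  rw [Matrix.diagonal_mul, Matrix.mul_diagonal]
  simp only [mat, Matrix.of_apply, S]
  by_cases h1 : l = k ∧ n = m
  · obtain ⟨rfl, rfl⟩ := h1; ring
  by_cases h2 : m = l ∧ n = k
  · obtain ⟨rfl, rfl⟩ := h2; ring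
  by_cases h3 : m = k.rev ∧ n = l.rev
  · obtain ⟨rfl, rfl⟩ := h3
    rw [W.w_rev i k, W.w_rev i l, mul_inv_cancel₀ (W.w_ne _ _), mul_inv_cancel₀ (W.w_ne _ _)]; ring
  simp [h1, h2, h3]

/-- Intertwining is inherited by sums and products, so it holds for T_jj T_ik, and the invertible
intertwiner T_jj can be cancelled. The primed variant cancels T_jj on the right. -/
theorem yangBaxterAt_of_mul {i j k : Fin N} {α β γ : K} (hα : α ≠ 0)
    (h1 : W.YangBaxterAt i j) (h2 : W.YangBaxterAt j k)
    (h : α • (W.T j j * W.T i k) = β • (W.T i j * W.T j k) + γ • (W.T j k * W.T i j)) :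
    W.YangBaxterAt i k := by
  have h3 := W.yangBaxterAt_self j
  rw [yangBaxterAt_iff] at *
  -- Conjugation by the flip is an algebra automorphism sending each T to the corresponding TOp, so
  -- the relation assumed for T holds for TOp as well.
  have h' := congrArg (flipEquiv K N) h
  simp only [map_add, map_smul, map_mul, flipEquiv_T] at h'
  rw [TOp_self] at h' h3
  have key : (α • (W.T j j * W.T i k)) * W.mat = W.mat * (α • (W.T j j * W.TOp i k)) := by
    rw [h, h']
    simp only [add_mul, mul_add, smul_mul_assoc, mul_smul_comm]
    rw [mul_assoc (W.T i j), h2, ← mul_assoc, h1, mul_assoc (W.T j k), h1, ← mul_assoc (W.T j k),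
      h2]
    simp only [mul_assoc]
  rw [smul_mul_assoc, mul_smul_comm] at key
  have key := smul_right_injective _ hα key
  rw [mul_assoc, ← mul_assoc W.mat, ← h3, mul_assoc] at key
  exact (W.isUnit_T_self j).mul_left_cancel key

theorem yangBaxterAt_of_mul' {i j k : Fin N} {α β γ : K} (hα : α ≠ 0)
    (h1 : W.YangBaxterAt i j) (h2 : W.YangBaxterAt j k)
    (h : α • (W.T i k * W.T j j) = β • (W.T i j * W.T j k) + γ • (W.T j k * W.T i j)) :
    W.YangBaxterAt i k := by
  have h3 := W.yangBaxterAt_self j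
  rw [yangBaxterAt_iff] at *
  have h' := congrArg (flipEquiv K N) h
  simp only [map_add, map_smul, map_mul, flipEquiv_T] at h'
  rw [TOp_self] at h' h3
  have key : (α • (W.T i k * W.T j j)) * W.mat = W.mat * (α • (W.TOp i k * W.T j j)) := by
    rw [h, h']
    simp only [add_mul, mul_add, smul_mul_assoc, mul_smul_comm]
    rw [mul_assoc (W.T i j), h2, ← mul_assoc, h1, mul_assoc (W.T j k), h1, ← mul_assoc (W.T j k),
      h2]
    simp only [mul_assoc]
  rw [smul_mul_assoc, mul_smul_comm] at key
  have key := smul_right_injective _ hα key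
  rw [mul_assoc, h3, ← mul_assoc, ← mul_assoc] at key
  exact (W.isUnit_T_self j).mul_right_cancel key

/-- The RTT relation in row (i, j) and column (j, k): the two inequalities with mirror images remove
the cup terms, and the transposition term yields κ T_jj T_ik = w_ij T_ij T_jk - w_jk T_jk T_ij. -/
theorem yangBaxterAt_trans {i j k : Fin N} (hij : i < j) (hjk : j < k) (h1 : j ≠ i.rev)
    (h2 : k ≠ j.rev) (H1 : ∀ a ≤ j, W.YangBaxterAt i a) (H2 : ∀ a, i ≤ a → W.YangBaxterAt a j)
    (h3 : W.YangBaxterAt j k) : W.YangBaxterAt i k := by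
  have h := W.rtt H1 H2 j k
  rw [W.sum_row hij fun x y => W.T x j * W.T y k, W.sum_col j k fun x y => W.T j y * W.T i x,
    if_neg h1, if_neg h2, if_neg hjk.not_gt] at h
  refine W.yangBaxterAt_of_mul (α := W.κ) (β := W.w i j) (γ := - W.w j k) W.κ_ne (H1 j le_rfl) h3 ?_
  rw [add_zero, sub_zero, add_zero] at h
  rw [neg_smul, ← h]
  abel

/-- When j, k is the middle pair the cup term cannot be avoided, but triangularity leaves just one
summand of it, again a multiple of T_ik T_jj. The total coefficient κ (c_j / c_k - 1) is nonzero
precisely because c_j ≠ c_k. -/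
theorem yangBaxterAt_trans_mid_left {i j k : Fin N} (hij : i < j) (hjk : (j : ℕ) + 1 = k)
    (h2 : k = j.rev) (hc : W.c j ≠ W.c k) (H1 : ∀ a ≤ k, W.YangBaxterAt j a)
    (H2 : ∀ a, j ≤ a → W.YangBaxterAt a k)
    (h3 : W.YangBaxterAt i j) : W.YangBaxterAt i k := by
  have h := W.rtt H1 H2 i j
  have hjk' : j < k := by omega
  have h2' : j = k.rev := by rw [h2, Fin.rev_rev]
  have hr : ∑ x, ∑ y, W.S j i x y • (W.T x k * W.T y j) = W.w j i • (W.T j k * W.T i j) := by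
    rw [Finset.sum_eq_single j, Finset.sum_eq_single i]
    · simp [S]
    · intro b _ hb
      simp [S, hb]
    · simp
    · intro b _ hb
      refine Finset.sum_eq_zero fun y _ => ?_
      have e1 : ¬ (j < b ∧ i = b ∧ y = j) := by rintro ⟨h, rfl, _⟩; exact lt_asymm h hij
      have e2 : ¬ (j < b ∧ i = j.rev ∧ y = b.rev) := by rintro ⟨_, h, _⟩; exact (hij.trans hjk').ne (h.trans h2.symm)
      simp only [S, hb, e1, e2, false_and, if_false, sub_zero, add_zero, zero_smul]
    · simp
  have hs : ∑ x with x < k, (W.κ * (W.c x * (W.c k)⁻¹)) • (W.T i x.rev * W.T j x) =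
      (W.κ * (W.c j * (W.c k)⁻¹)) • (W.T i k * W.T j j) := by
    rw [Finset.sum_eq_single_of_mem j (by simpa using hjk'), ← h2]
    intro b hb hbj
    have hb' : b < k := by simpa using hb
    rw [W.T_eq_zero (i := j) (j := b) (by omega), mul_zero, smul_zero]
  rw [hr, W.sum_col k j fun x y => W.T i y * W.T j x, if_pos hjk', if_pos h2', hs] at h
  have hck := W.c_ne k
  refine W.yangBaxterAt_of_mul' (α := W.κ * (W.c j * (W.c k)⁻¹ - 1)) (β := - W.w k j)
    (γ := W.w j i) (mul_ne_zero W.κ_ne ?_) h3 (H1 k le_rfl) ?_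
  · rw [sub_ne_zero]
    intro h
    exact hc (by field_simp at h; exact h)
  · rw [h]; module

/-- The counterpart with i, j as the middle pair: the surviving cup summand is a multiple of T_jj
T_ik, and the total coefficient is κ (1 - c_i / c_j). -/
theorem yangBaxterAt_trans_mid_right {i j k : Fin N} (hij : (i : ℕ) + 1 = j) (hjk : j < k)
    (h1 : j = i.rev) (hc : W.c i ≠ W.c j) (H1 : ∀ a ≤ j, W.YangBaxterAt i a)
    (H2 : ∀ a, i ≤ a → W.YangBaxterAt a j)
    (h3 : W.YangBaxterAt j k) : W.YangBaxterAt i k := by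
  have h := W.rtt H1 H2 j k
  have hij' : i < j := by omega
  have h2 : k ≠ j.rev := by
    rintro rfl
    rw [h1, Fin.rev_rev] at hjk
    exact lt_asymm hjk (h1 ▸ hij')
  have hs : ∑ x with i < x, (W.κ * (W.c i * (W.c x)⁻¹)) • (W.T x j * W.T x.rev k) =
      (W.κ * (W.c i * (W.c j)⁻¹)) • (W.T j j * W.T i k) := by
    rw [Finset.sum_eq_single_of_mem j (by simpa using hij'), h1, Fin.rev_rev]
    intro b hb hbj
    have hb' : i < b := by simpa using hb
    rw [W.T_eq_zero (i := b) (j := j) (by omega), zero_mul, smul_zero]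
  rw [W.sum_row hij' fun x y => W.T x j * W.T y k, W.sum_col j k fun x y => W.T j y * W.T i x,
    if_pos h1, if_neg h2, if_neg hjk.not_gt, hs] at h
  have hcj := W.c_ne j
  refine W.yangBaxterAt_of_mul (α := W.κ * (1 - W.c i * (W.c j)⁻¹)) (β := W.w i j)
    (γ := - W.w j k) (mul_ne_zero W.κ_ne ?_) (H1 j le_rfl) h3 ?_
  · rw [sub_ne_zero]
    intro h
    exact hc (by field_simp at h; exact h.symm)
  · rw [add_zero, sub_zero] at h
    rw [neg_smul, ← h]; module

theorem mulVec_single_fun {m n : Type*} [Fintype n] [DecidableEq n] (A : Matrix m n K) (y : n) :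
    A.mulVecLin (Pi.single y 1) = fun x => A x y := by
  ext x; simp

theorem mat_mulVec (m n : Fin N) :
    W.mat.mulVecLin (Pi.single (m, n) 1) = W.SCol (fun a b => Pi.single (a, b) 1) m n := by
  rw [mulVec_single_fun]
  ext ⟨k, l⟩
  have h1 : ∑ x with x < m, W.c x * (Pi.single (x, x.rev) 1 : Fin N × Fin N → K) (k, l) =
      if k < m ∧ l = k.rev then W.c k else 0 := by
    rw [Finset.sum_filter, Finset.sum_eq_single k]
    · by_cases h : l = k.rev <;> simp [Pi.single_apply, h]
    · intro b _ hb
      simp [Pi.single_apply, hb.symm]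
    · simp
  simp only [mat, Matrix.of_apply, S, SCol, Pi.add_apply, Pi.sub_apply, Pi.smul_apply,
    Finset.sum_apply, smul_eq_mul, h1]
  simp only [Pi.single_apply, Prod.mk.injEq]
  have h2 : m = k ∧ n = l ↔ k = m ∧ l = n := by constructor <;> rintro ⟨rfl, rfl⟩ <;> simp
  congr 1
  · congr 1
    · simp only [h2]
      by_cases h : k = m ∧ l = n
      · obtain ⟨rfl, rfl⟩ := h; simp
      · simp [h]
    · by_cases h : k = n ∧ l = m
      · obtain ⟨rfl, rfl⟩ := h; simp
      · have : ¬(k < m ∧ l = m ∧ n = k) := by rintro ⟨_, h1, h2⟩; exact h ⟨h2.symm, h1⟩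
        simp [h, this]
  · by_cases h : n = m.rev
    · by_cases h' : k < m ∧ l = k.rev
      · simp [h, h']; ring
      · have : ¬(k < m ∧ l = k.rev ∧ n = m.rev) := fun x => h' ⟨x.1, x.2.1⟩
        simp [h', this]
    · simp [h]

/-- Triangularity forces the summation index to lie between i and i + 1, so T of a neighbouring pair
is a skew-primitive coproduct. -/
theorem T_succ {i j : Fin N} (hij : (i : ℕ) + 1 = j) :
    W.T i j = W.L i i ⊗ₖ W.L i j + W.L i j ⊗ₖ W.L j j := by
  have hij' : i < j := by omega
  rw [T, ← Finset.sum_subset (Finset.subset_univ {i, j}), Finset.sum_pair hij'.ne]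
  intro x _ hx
  simp only [Finset.mem_insert, Finset.mem_singleton, not_or] at hx
  rcases lt_or_gt_of_ne hx.1 with h | h
  · simp [W.L_eq_zero h]
  · have : j < x := by have := hx.2; omega
    simp [W.L_eq_zero this]

theorem L_apply_of_lt {i j : Fin N} (hij : i < j) (k m : Fin N) : W.L i j k m =
    -W.κ * ((if k = j ∧ m = i then 1 else 0) -
      (if k = i.rev ∧ m = j.rev then W.c i * (W.c j)⁻¹ else 0)) := by
  simp only [L, S, Matrix.of_apply, hij, hij.ne', true_and, false_and, if_false]
  split_ifs <;> ring

theorem T_mulVec {i j : Fin N} (hij : (i : ℕ) + 1 = j) (m n : Fin N) :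
    ((-W.κ)⁻¹ • W.T i j).mulVecLin (Pi.single (m, n) 1) =
      W.TCol (fun a b => Pi.single (a, b) 1) i j (W.c i * (W.c j)⁻¹) m n := by
  have hκ := W.κ_ne
  have hij' : i < j := by omega
  rw [mulVec_single_fun]
  ext ⟨k, l⟩
  rw [T_succ W hij]
  simp only [Matrix.smul_apply, Matrix.add_apply, Matrix.kroneckerMap_apply, L_apply_of_lt W hij',
    L_self, Matrix.diagonal_apply, TCol, Pi.add_apply, Pi.sub_apply, Pi.smul_apply, smul_eq_mul,
    Pi.single_apply, Prod.mk.injEq]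
  rw [mul_add]
  congr 1
  · rw [mul_left_comm, inv_mul_cancel_left₀ (neg_ne_zero.2 hκ)]
    by_cases h : k = m
    · subst h; simp only [if_true, true_and, ite_and, mul_sub, mul_ite, mul_one, mul_zero]
      split_ifs <;> ring
    · simp [h]
  · rw [mul_assoc, inv_mul_cancel_left₀ (neg_ne_zero.2 hκ)]
    by_cases h : l = n
    · subst h; simp only [if_true, and_true, ite_and, sub_mul, ite_mul, one_mul, zero_mul, mul_ite,
        mul_one, mul_zero]

    · simp [h]

theorem TOp_mulVec {i j : Fin N} (hij : (i : ℕ) + 1 = j) (m n : Fin N) :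
    ((-W.κ)⁻¹ • W.TOp i j).mulVecLin (Pi.single (m, n) 1) =
      W.TColOp (fun a b => Pi.single (a, b) 1) i j (W.c i * (W.c j)⁻¹) m n := by
  have h := W.T_mulVec hij n m
  rw [mulVec_single_fun] at h ⊢
  rw [← flipEquiv_T]
  ext ⟨k, l⟩
  have h := congrFun h (l, k)
  rw [show ((-W.κ)⁻¹ • flipEquiv K N (W.T i j)) (k, l) (m, n) =
    ((-W.κ)⁻¹ • W.T i j) (l, k) (n, m) from rfl, h]
  have sw (a b c d : Fin N) : (Pi.single (a, b) 1 : Fin N × Fin N → K) (c, d) =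
      (Pi.single (b, a) 1 : Fin N × Fin N → K) (d, c) := by
    simp [Pi.single_apply, and_comm]
  simp only [TCol, TColOp, Pi.add_apply, Pi.sub_apply, Pi.smul_apply]
  simp only [sw _ _ k l]

/-- The position of the pair relative to the midpoint selects one of the four explicit computations.
One case remains: for a middle pair with equal coefficients c, the two terms of L i j are the same
matrix unit with opposite signs, so L i j = 0 and both sides vanish. -/
theorem yangBaxterAt_succ {i j : Fin N} (hij : (i : ℕ) + 1 = j) : W.YangBaxterAt i j := by
  have hij' : i < j := by omega
  have hS := W.mat_mulVec
  have hT := W.T_mulVec hij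
  have hT' := W.TOp_mulVec hij
  have key : (∀ m n, ((-W.κ)⁻¹ • W.T i j).mulVecLin (W.mat.mulVecLin (Pi.single (m, n) 1)) =
      W.mat.mulVecLin (((-W.κ)⁻¹ • W.TOp i j).mulVecLin (Pi.single (m, n) 1))) →
      W.YangBaxterAt i j := by
    intro h
    rw [yangBaxterAt_iff]
    apply smul_right_injective _ (inv_ne_zero (neg_ne_zero.2 W.κ_ne))
    change (-W.κ)⁻¹ • _ = (-W.κ)⁻¹ • _
    rw [← smul_mul_assoc, ← mul_smul_comm]
    refine Matrix.ext_of_mulVec_single fun x => ?_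
    have := h x.1 x.2
    simpa only [Matrix.mulVecLin_apply, Matrix.mulVec_mulVec] using this
  by_cases h1 : j = i.rev
  · rcases W.c_mid i j hij h1 with h | ⟨_, h⟩
    · have hl : W.L i j = 0 := by
        ext k m
        have e : i = j.rev := by rw [h1, Fin.rev_rev]
        rw [L_apply_of_lt W hij', ← h1, ← e, h, mul_inv_cancel₀ (W.c_ne j)]
        simp
      have hT0 : W.T i j = 0 := by rw [T_succ W hij, hl]; simp
      rw [yangBaxterAt_iff, ← flipEquiv_T, hT0, map_zero, zero_mul, mul_zero]
    · exact key (W.intertwine_mid hij h1 h hS hT hT')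
  by_cases h2 : j = j.rev
  · exact key (W.intertwine_left_of_mid hij h2 hS hT hT')
  by_cases h3 : i = i.rev
  · exact key (W.intertwine_right_of_mid hij h3 hS hT hT')
  exact key (W.intertwine_adjacent hij h3 h2 h1 hS hT hT')

/-- The diagram automorphism of type D. Swapping the middle indices preserves weights, coefficients
and mirror images, and it changes the order only on the middle pair itself, where the transposition
and cup terms cancel because c n = c n'. -/
theorem S_swap {n n' : Fin N} (hn : (n : ℕ) + 1 = n') (hr : n' = n.rev) (hc : W.c n = W.c n')
    (i k j l : Fin N) : W.S (Equiv.swap n n' i) (Equiv.swap n n' k) (Equiv.swap n n' j)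
      (Equiv.swap n n' l) = W.S i k j l := by
  have v1 := Fin.val_rev n
  have hr' : n = n'.rev := by rw [hr, Fin.rev_rev]
  have hw (x y : Fin N) : W.w (Equiv.swap n n' x) (Equiv.swap n n' y) = W.w x y := by
    have h1 (x : Fin N) (h : x ≠ n) (h' : x ≠ n') : W.w n' x = W.w n x := by
      rw [hr, W.w_rev_left]
      exact inv_eq_of_mul_eq_one_right (W.w_sq n x h (hr ▸ h'))
    have h2 : W.w n' n' = W.w n n := by rw [hr, W.w_rev_rev]
    have h3 := W.w_comm n n'
    have h4 (y : Fin N) := W.w_comm y n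
    have h5 (y : Fin N) := W.w_comm y n'
    simp only [Equiv.swap_apply_def]
    grind
  have hτc (x : Fin N) : W.c (Equiv.swap n n' x) = W.c x := by
    simp only [Equiv.swap_apply_def]; grind
  have hτr (x : Fin N) : (Equiv.swap n n' x).rev = Equiv.swap n n' x.rev := by
    have h1 : x.rev = n ↔ x = n' := by rw [hr, ← Fin.rev_inj, Fin.rev_rev]
    have h2 : x.rev = n' ↔ x = n := by rw [hr, Fin.rev_inj]
    simp only [Equiv.swap_apply_def, h1, h2]
    grind
  have hinj (x y : Fin N) : Equiv.swap n n' x = Equiv.swap n n' y ↔ x = y :=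
    (Equiv.swap n n').apply_eq_iff_eq
  by_cases h : (i = n ∧ j = n') ∨ (i = n' ∧ j = n)
  · have h0 : W.κ * (W.c n * (W.c n')⁻¹) = W.κ := by
      rw [hc, mul_inv_cancel₀ (W.c_ne _), mul_one]
    simp only [S, hw, hinj, hτr, hτc]
    have hnn : n < n' := by omega
    rcases h with ⟨rfl, rfl⟩ | ⟨rfl, rfl⟩
    · simp [hnn, hnn.not_gt, h0, ← hr, ← hr']
    · simp only [Equiv.swap_apply_left, Equiv.swap_apply_right, hnn, hnn.not_gt, ← hr, ← hr', h0,
        true_and, false_and, if_false]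
      have h1 : W.κ * (W.c i * (W.c j)⁻¹) = W.κ := by
        rw [← hc, mul_inv_cancel₀ (W.c_ne _), mul_one]
      rw [h1, sub_zero, add_zero, sub_add_cancel]
  · have hlt : Equiv.swap n n' i < Equiv.swap n n' j ↔ i < j := by
      simp only [Equiv.swap_apply_def]
      split_ifs <;> omega
    simp only [S, hw, hinj, hτr, hτc, hlt]

theorem yangBaxterAt_swap {n n' : Fin N} (hn : (n : ℕ) + 1 = n') (hr : n' = n.rev)
    (hc : W.c n = W.c n') {i j : Fin N} (h : W.YangBaxterAt i j) :
    W.YangBaxterAt (Equiv.swap n n' i) (Equiv.swap n n' j) := by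
  intro k m l p
  have h := h (Equiv.swap n n' k) (Equiv.swap n n' m) (Equiv.swap n n' l) (Equiv.swap n n' p)
  have hs := W.S_swap hn hr hc
  set τ := Equiv.swap n n' with hτ
  have hττ : ∀ x, τ (τ x) = x := fun x => by simp [hτ]
  refine Eq.trans ?_ (h.trans ?_)
  · rw [← Equiv.sum_comp τ]
    refine Finset.sum_congr rfl fun a _ => ?_
    rw [← Equiv.sum_comp τ]
    refine Finset.sum_congr rfl fun b _ => ?_
    rw [← Equiv.sum_comp τ]
    refine Finset.sum_congr rfl fun c _ => ?_
    rw [← hs i, ← hs a, ← hs b]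
    simp only [hττ]
  · rw [← Equiv.sum_comp τ]
    refine Finset.sum_congr rfl fun a _ => ?_
    rw [← Equiv.sum_comp τ]
    refine Finset.sum_congr rfl fun b _ => ?_
    rw [← Equiv.sum_comp τ]
    refine Finset.sum_congr rfl fun c _ => ?_
    rw [← hs (τ k), ← hs i, ← hs (τ a)]
    simp only [hττ]

/-- The Yang–Baxter equation for the orthosymplectic `R`-matrix. -/
theorem yangBaxterAt (i j : Fin N) : W.YangBaxterAt i j := by
  suffices h : ∀ d : ℕ, ∀ i k : Fin N, (k : ℕ) ≤ i + d → W.YangBaxterAt i k from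
    h j i j (by omega)
  intro d
  induction d with
  | zero =>
    intro i k hk
    rcases eq_or_lt_of_le (Fin.le_def.2 hk) with h | h
    · subst h; exact W.yangBaxterAt_self _
    · exact W.yangBaxterAt_of_lt h
  | succ d ih =>
    intro i k hk
    by_cases hd : (k : ℕ) ≤ i + d
    · exact ih i k hd
    by_cases hd1 : (i : ℕ) + 1 = k
    · exact W.yangBaxterAt_succ hd1
    have v1 := Fin.val_rev i
    have v2 := Fin.val_rev k
    have hkN := k.2
    -- Any intermediate j that avoids both mirror images gives the induction step at once.
    by_cases hex : ∃ j, i < j ∧ j < k ∧ j ≠ i.rev ∧ k ≠ j.rev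
    · obtain ⟨j, h1, h2, h3, h4⟩ := hex
      exact W.yangBaxterAt_trans h1 h2 h3 h4 (fun a ha => ih i a (by omega))
        (fun a ha => ih a j (by omega)) (ih j k (by omega))
    push Not at hex
    have hex' (j : Fin N) (h1 : i < j) (h2 : j < k) : j = i.rev ∨ k = j.rev := by
      by_cases h : j = i.rev
      · exact .inl h
      · exact .inr (hex j h1 h2 h)
    let j : Fin N := ⟨i + 1, by omega⟩
    have hj : (j : ℕ) = i + 1 := rfl
    have v3 := Fin.val_rev j
    -- If no intermediate index is admissible the gap is exactly two: with gap three or more, i + 1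
    -- and i + 2 would both have to be i' or k', which the positions of the mirror images rule out.
    have hk2 : (k : ℕ) = i + 2 := by
      by_contra hne
      let j' : Fin N := ⟨i + 2, by omega⟩
      have hj' : (j' : ℕ) = i + 2 := rfl
      have v4 := Fin.val_rev j'
      have e1 := hex' j (by omega) (by omega)
      have e2 := hex' j' (by omega) (by omega)
      omega
    have hij : YangBaxterAt W i j := ih i j (by omega)
    have hjk : YangBaxterAt W j k := ih j k (by omega)
    rcases hex' j (by omega) (by omega) with h | h
    · rcases W.c_mid i j (by omega) h with hc | ⟨hc, -⟩
      -- For equal coefficients the swap of the middle indices carries the known component (j, k) to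
      -- (i, k); the next branch carries (i, j) to (i, k).
      · have := W.yangBaxterAt_swap (by omega) h hc hjk
        rwa [Equiv.swap_apply_right, Equiv.swap_apply_of_ne_of_ne (by omega) (by omega)] at this
      · exact W.yangBaxterAt_trans_mid_right (by omega) (by omega) h hc
          (fun a ha => ih i a (by omega)) (fun a ha => ih a j (by omega)) hjk
    · rcases W.c_mid j k (by omega) h with hc | ⟨hc, -⟩
      · have := W.yangBaxterAt_swap (by omega) h hc hij
        rwa [Equiv.swap_apply_left, Equiv.swap_apply_of_ne_of_ne (by omega) (by omega)] at this
      · exact W.yangBaxterAt_trans_mid_left (by omega) (by omega) h hc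
          (fun a ha => ih j a (by omega)) (fun a ha => ih a k (by omega)) hij

/-- In the lexicographic order on pairs the matrix is upper triangular with diagonal entries w i k:
off-diagonal transitions strictly raise the first index. -/
theorem isUnit_mat : IsUnit W.mat := by
  rw [Matrix.isUnit_iff_isUnit_det]
  let e : Lex (Fin N × Fin N) ≃ Fin N × Fin N := ofLex
  rw [← Matrix.det_submatrix_equiv_self e, Matrix.det_of_upperTriangular]
  · refine (Finset.prod_ne_zero_iff.2 fun x _ => ?_).isUnit
    simpa [mat, S] using W.w_ne (e x).1 (e x).2
  · intro x y hxy
    have hxy' : (e y).1 < (e x).1 ∨ (e y).1 = (e x).1 ∧ (e y).2 < (e x).2 := by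
      have := Prod.Lex.lt_iff.1 (show y < x from hxy)
      exact this
    rcases hxy' with h | ⟨h1, h2⟩
    · exact W.S_eq_zero h _ _
    · simp [mat, S, h1, h2.ne]

end VertexWeights

/-! ### The orthosymplectic vertex weights: the Weyl vector, the exponents and the signs -/

namespace OspDatum

variable {N : ℕ} (D : OspDatum N)

theorem form_add_right (μ ν ν' : Fin N → ℤ) : D.form μ (ν + ν') = D.form μ ν + D.form μ ν' := by
  simp [form, mul_add, Finset.sum_add_distrib]

theorem form_neg_right (μ ν : Fin N → ℤ) : D.form μ (-ν) = -D.form μ ν := by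
  simp [form]

theorem form_neg_left (μ ν : Fin N → ℤ) : D.form (-μ) ν = -D.form μ ν := by
  simp [form]

theorem form_comm (μ ν : Fin N → ℤ) : D.form μ ν = D.form ν μ := by
  simp [form, mul_right_comm]

theorem form_eps {i : Fin N} (hi : i < i.rev) (μ : Fin N → ℤ) :
    D.form μ (eps i) = sgn ℤ (D.par i) * μ i := by
  rw [form, Finset.sum_eq_single_of_mem i (by simpa using hi)]
  · simp [eps, hi.ne]
  · intro k hk hki
    have hk : k < k.rev := by simpa using hk
    have : k ≠ i.rev := by rintro rfl; rw [Fin.rev_rev] at hk; exact lt_asymm hk hi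
    simp [eps, hki, this]

theorem eps_mid {i : Fin N} (hi : i = i.rev) : eps i = 0 := by
  ext k; simp [eps, ← hi]

/-- An odd midpoint would satisfy ϑ_i = -ϑ_i, impossible for a sign. -/
theorem par_mid {i : Fin N} (hi : i = i.rev) : D.par i = 0 := by
  rcases zmod2_cases (D.par i) with h | h
  · exact h
  · have := D.theta_odd i h
    rw [← hi] at this
    rcases Int.units_eq_one_or (D.theta i) with h' | h' <;> rw [h'] at this <;>
      exact absurd this (by decide)

theorem form_eps_self {i : Fin N} (hi : i ≠ i.rev) : D.form (eps i) (eps i) = sgn ℤ (D.par i) := by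
  rcases lt_or_gt_of_ne hi with h | h
  · rw [D.form_eps h]; simp [eps, hi]
  · have h' : i.rev < i.rev.rev := by simpa using h
    have e : eps i = -eps i.rev := by rw [eps_rev, neg_neg]
    rw [e, D.form_neg_left, D.form_neg_right, neg_neg, D.form_eps h', D.par_rev]
    simp [eps, hi.symm]

theorem form_eps_of_ne {i k : Fin N} (h1 : k ≠ i) (h2 : k ≠ i.rev) :
    D.form (eps i) (eps k) = 0 := by
  have h1' : k.rev ≠ i := by rintro rfl; simp at h2
  rcases lt_trichotomy k k.rev with h | h | h
  · rw [D.form_eps h]; simp [eps, h1, h2]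
  · rw [eps_mid h]; simp [form]
  · have h' : k.rev < k.rev.rev := by simpa using h
    have e : eps k = -eps k.rev := by rw [eps_rev, neg_neg]
    rw [e, D.form_neg_right, D.form_eps h']
    simp [eps, h1, h1', Fin.rev_inj]

/-- For fixed a, the summands in ε_b cancel in mirror pairs b, b'. The coordinate at k thus comes
only from the ε_a summands with a = k and from the long root 2ε_k. -/
theorem twoRho_apply {k : Fin N} (hk : k < k.rev) : D.twoRho k =
    ∑ b with k < b ∧ b < k.rev, sgn ℤ (D.par k + D.par b) + if D.par k = 1 then 2 else 0 := by
  have hne := hk.ne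
  unfold twoRho
  simp only [smul_sub, Finset.sum_sub_distrib, sum_eps_eq_zero, sub_zero, Pi.add_apply,
    Finset.sum_apply, Pi.smul_apply, smul_eq_mul]
  congr 1
  · rw [Finset.sum_eq_single k]
    · simp [eps, hne]
    · intro b _ hb
      by_cases hb' : b = k.rev
      · subst hb'
        refine Finset.sum_eq_zero fun x hx => ?_
        simp only [Fin.rev_rev, Finset.mem_filter, Finset.mem_univ, true_and] at hx
        exact absurd (hx.1.trans hx.2) hk.not_gt
      · have : k ≠ b.rev := by rintro rfl; simp at hb'
        simp [eps, hb.symm, this]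
    · simp
  · rw [Finset.sum_filter, Finset.sum_eq_single k]
    · simp [eps, hne, hk]
    · intro b _ hb
      by_cases hb' : b = k.rev
      · subst hb'
        simp [hk.not_gt]
      · have : k ≠ b.rev := by rintro rfl; simp at hb'
        simp [eps, hb.symm, this]
    · simp

/-- `(2ρ, ε_k)`. -/
def rhoEps (k : Fin N) : ℤ := D.form D.twoRho (eps k)

theorem rhoEps_rev (k : Fin N) : D.rhoEps k.rev = -D.rhoEps k := by
  rw [rhoEps, eps_rev, form_neg_right, rhoEps]

theorem rhoEps_of_lt {k : Fin N} (hk : k < k.rev) : D.rhoEps k =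
    ∑ b with k < b ∧ b < k.rev, sgn ℤ (D.par b) + sgn ℤ (D.par k) - 1 := by
  rw [rhoEps, D.form_eps hk, D.twoRho_apply hk, mul_add, Finset.mul_sum]
  simp only [sgn_add, ← mul_assoc, sgn_mul_self, one_mul]
  rcases zmod2_cases (D.par k) with h | h
  · simp [h, sgn_zero]
  · simp only [h, sgn_one, if_true]; ring

theorem rhoEps_succ_of_lt {i j : Fin N} (hij : (i : ℕ) + 1 = j) (hi : i < i.rev)
    (hne : j ≠ i.rev) : D.rhoEps i - D.rhoEps j =
      D.form (eps i) (eps i) + D.form (eps j) (eps j) := by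
  have v1 := Fin.val_rev i
  have v2 := Fin.val_rev j
  rw [D.rhoEps_of_lt hi, D.form_eps_self hi.ne]
  by_cases hj : j = j.rev
  · have hset : (Finset.univ.filter fun b => i < b ∧ b < i.rev) = {j} := by
      ext b; simp only [Finset.mem_filter, Finset.mem_univ, true_and, Finset.mem_singleton]; omega
    rw [rhoEps, hset, eps_mid hj, Finset.sum_singleton, D.par_mid hj, sgn_zero]
    simp [form]
  · have hj' : j < j.rev := by omega
    have hset : (Finset.univ.filter fun b => i < b ∧ b < i.rev) =
        insert j (insert j.rev (Finset.univ.filter fun b => j < b ∧ b < j.rev)) := by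
      ext b; simp only [Finset.mem_filter, Finset.mem_univ, true_and, Finset.mem_insert]; omega
    rw [D.rhoEps_of_lt hj', D.form_eps_self hj, hset, Finset.sum_insert (by simp [hj]),
      Finset.sum_insert (by simp), D.par_rev]
    ring

/-- The familiar 2(ρ, α) = (α, α) for the simple root α = ε_i - ε_j. It follows from the coordinate
formula for ρ on the left half, and on the right half by applying that to the mirrored pair j', i'.
-/
theorem rhoEps_succ {i j : Fin N} (hij : (i : ℕ) + 1 = j) (hne : j ≠ i.rev) :
    D.rhoEps i - D.rhoEps j = D.form (eps i) (eps i) + D.form (eps j) (eps j) := by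
  have v1 := Fin.val_rev i
  have v2 := Fin.val_rev j
  by_cases hi : i < i.rev
  · exact D.rhoEps_succ_of_lt hij hi hne
  · have h := D.rhoEps_succ_of_lt (i := j.rev) (j := i.rev) (by omega)
      (by rw [Fin.rev_rev]; omega) (by rw [Fin.rev_rev]; omega)
    rw [rhoEps_rev, rhoEps_rev, eps_rev, eps_rev] at h
    simp only [form_neg_left, form_neg_right, neg_neg] at h
    linarith

/-- No index lies strictly between the middle pair, so the sum in `rhoEps_of_lt` is empty. The value
is 0 for even i and -2 for odd i, which separates the two alternatives of `c_mid`. -/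
theorem rhoEps_mid {i : Fin N} (hij : (i : ℕ) + 1 = i.rev) :
    D.rhoEps i = sgn ℤ (D.par i) - 1 := by
  have hset : (Finset.univ.filter fun b => i < b ∧ b < i.rev) = ∅ := by
    ext b; simp only [Finset.mem_filter, Finset.mem_univ, true_and, Finset.notMem_empty, iff_false]
    omega
  rw [D.rhoEps_of_lt (by omega), hset]; simp

/-- Twice the exponent is a difference of a function of i and a function of j. This is what allows
the cup coefficients to be written as quotients c_i / c_j. -/
theorem rExp_add (i j k : Fin N) : D.rExp i j + D.rExp j k = D.rExp i k := by
  have h1 := D.two_mul_rExp i j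
  have h2 := D.two_mul_rExp j k
  have h3 := D.two_mul_rExp i k
  simp only [sub_eq_add_neg, form_add_right, form_neg_right] at h1 h2 h3
  linarith

theorem rExp_rev (i : Fin N) : D.rExp i i.rev = D.rhoEps i := by
  have h1 := D.two_mul_rExp i i.rev
  simp only [sub_eq_add_neg, form_add_right, form_neg_right, form_neg_left, eps_rev, neg_neg] at h1
  rw [rhoEps]; linarith

theorem theta_rev (i : Fin N) : ((D.theta i.rev : ℤ) : Kq) = sgn Kq (D.par i) * (D.theta i : ℤ) := by
  rcases zmod2_cases (D.par i) with h | h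
  · rw [D.theta_even i h, D.theta_even i.rev (by rw [D.par_rev, h]), h, sgn_zero, one_mul]
  · have h' := D.theta_odd i h
    rw [h', h, sgn_one]
    push_cast; ring

theorem theta_sq (i : Fin N) : ((D.theta i : ℤ) : Kq) * (D.theta i : ℤ) = 1 := by
  rcases Int.units_eq_one_or (D.theta i) with h | h <;> rw [h] <;> simp

end OspDatum

theorem q_ne_zero : q ≠ 0 := RatFunc.X_ne_zero

theorem q_sq_ne (a : ℂ) : q * q ≠ RatFunc.C a := by
  intro h
  change (RatFunc.X : RatFunc ℂ) * RatFunc.X = RatFunc.C a at h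
  rw [← RatFunc.algebraMap_X, ← RatFunc.algebraMap_C, ← map_mul] at h
  have h := RatFunc.algebraMap_injective ℂ h
  have h := congrArg (fun p => Polynomial.coeff p 2) h
  simp [← pow_two, Polynomial.coeff_C] at h

theorem q_sq_ne_one : q * q ≠ 1 := by simpa using q_sq_ne 1

theorem q_sq_ne_neg_one : q * q ≠ -1 := by simpa using q_sq_ne (-1)

theorem sgn_ne_zero {K : Type*} [Field K] (x : ZMod 2) : sgn K x ≠ 0 := fun h => by
  have := sgn_mul_self (K := K) x
  rw [h, zero_mul] at this
  exact zero_ne_one this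

namespace OspDatum

variable {N : ℕ} (D : OspDatum N)

/-- The diagonal weight `(-1)^{|i||k|} q^{-(ε_i, ε_k)}`. -/
def diagWeight (i k : Fin N) : Kq :=
  sgn Kq (D.par i * D.par k) * q ^ (-D.form (eps i) (eps k))

theorem diagWeight_rev (i k : Fin N) : D.diagWeight i k.rev = (D.diagWeight i k)⁻¹ := by
  rw [diagWeight, diagWeight, D.par_rev, eps_rev, D.form_neg_right, mul_inv, ← zpow_neg]
  congr 1
  exact (inv_eq_of_mul_eq_one_right (sgn_mul_self _)).symm

theorem diagWeight_self {i : Fin N} (hi : i ≠ i.rev) :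
    D.diagWeight i i = if D.par i = 0 then q⁻¹ else -q := by
  rw [diagWeight, D.form_eps_self hi]
  rcases zmod2_cases (D.par i) with h | h
  · simp [h, sgn_zero]
  · simp [h, sgn_one]

/-- Coefficients with `c_i / c_j = (-1)^{|i|+|j|} ϑ_i ϑ_j q^{(ρ, ε_i - ε_j) - …}`. -/
def cupWeight (i : Fin N) : Kq :=
  sgn Kq (D.par i) * (D.theta i : ℤ) * q ^ D.rExp i ⟨0, i.pos⟩

theorem theta_ne_zero (i : Fin N) : ((D.theta i : ℤ) : Kq) ≠ 0 := fun h => by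
  have := D.theta_sq i
  rw [h, zero_mul] at this
  exact zero_ne_one this

theorem cupWeight_ne_zero (i : Fin N) : D.cupWeight i ≠ 0 :=
  mul_ne_zero (mul_ne_zero (sgn_ne_zero _) (D.theta_ne_zero i)) (zpow_ne_zero _ q_ne_zero)

theorem cupWeight_eq (i j : Fin N) : D.cupWeight i =
    sgn Kq (D.par i + D.par j) * ((D.theta i : ℤ) * (D.theta j : ℤ)) * q ^ D.rExp i j *
      D.cupWeight j := by
  rw [cupWeight, cupWeight, ← D.rExp_add i j, zpow_add₀ q_ne_zero, sgn_add]
  have e : sgn Kq (D.par j) * sgn Kq (D.par j) * ((D.theta j : ℤ) * (D.theta j : ℤ)) = 1 := by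
    rw [sgn_mul_self, D.theta_sq, one_mul]
  linear_combination (- sgn Kq (D.par i) * (D.theta i : ℤ) * q ^ D.rExp i j *
    q ^ D.rExp j ⟨0, i.pos⟩) * e

/-- The ratio c_i / c_i' involves only (2ρ, ε_i) and the parity of i, since the exponent between i
and i' is (2ρ, ε_i) and ϑ_i ϑ_i' is the sign of i. Both `c_succ` and `c_mid` are deduced from it. -/
theorem cupWeight_rev (i : Fin N) : D.cupWeight i =
    sgn Kq (D.par i) * q ^ D.rhoEps i * D.cupWeight i.rev := by
  have h2 : D.par i + D.par i = 0 := CharTwo.add_self_eq_zero _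
  rw [D.cupWeight_eq i i.rev, D.par_rev, h2, sgn_zero, theta_rev, rExp_rev]
  linear_combination (sgn Kq (D.par i) * q ^ D.rhoEps i * D.cupWeight i.rev) * D.theta_sq i

/-- The orthosymplectic `R`-matrix, up to a scalar and signs, as a vertex model. -/
def weights : VertexWeights Kq N where
  w := D.diagWeight
  c := D.cupWeight
  κ := q - q⁻¹
  w_ne i k := mul_ne_zero (sgn_ne_zero _) (zpow_ne_zero _ q_ne_zero)
  c_ne := D.cupWeight_ne_zero
  κ_ne := by
    intro h
    have hq := q_ne_zero
    field_simp at h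
    exact q_sq_ne_one (by linear_combination h)
  w_comm i k := by rw [diagWeight, diagWeight, mul_comm, D.form_comm, mul_comm (D.par i), mul_comm]
  w_rev := D.diagWeight_rev
  w_sq i k h1 h2 := by
    rw [diagWeight, D.form_eps_of_ne h1 h2]
    simp [sgn_mul_self]
  w_mid i hi := by
    rw [diagWeight, eps_mid hi, D.par_mid hi]
    simp [form, sgn_zero]
  w_hecke i hi := by
    have hq := q_ne_zero
    rw [D.diagWeight_self hi]
    split_ifs <;> field_simp <;> ring
  c_succ i j hij hne := by
    rw [D.cupWeight_rev i, D.cupWeight_rev j, diagWeight, diagWeight]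
    have h1 := D.rhoEps_succ hij hne
    have h2 : D.rhoEps i = D.rhoEps j + D.form (eps i) (eps i) + D.form (eps j) (eps j) := by
      linarith
    have h3 : ∀ x : ZMod 2, x * x = x := by decide
    have hq := q_ne_zero
    rw [h2, zpow_add₀ hq, zpow_add₀ hq, h3, h3, zpow_neg, zpow_neg]
    have e1 := sgn_mul_self (K := Kq) (D.par i)
    have hz1 := zpow_ne_zero (D.form (eps i) (eps i)) hq
    have hz2 := zpow_ne_zero (D.form (eps j) (eps j)) hq
    field_simp
    linear_combination D.cupWeight i.rev * D.cupWeight j.rev * sgn Kq (D.par j) * e1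
  c_mid i j hij hr := by
    subst hr
    have h1 := D.cupWeight_rev i
    have hi : i ≠ i.rev := by omega
    have hq := q_ne_zero
    have hc := D.cupWeight_ne_zero i.rev
    rw [D.rhoEps_mid hij] at h1
    -- An even middle pair has c_i = c_i', the type D alternative. An odd one has c_i = -q⁻² c_i'
    -- and w_ii = -q, and these coefficients differ because q² ≠ -1.
    rcases zmod2_cases (D.par i) with h | h
    · left
      rw [h1, h]; simp [sgn_zero]
    · right
      have e : D.cupWeight i = - (q⁻¹ * q⁻¹) * D.cupWeight i.rev := by
        rw [h1, h, sgn_one, sgn_one, show (-1 - 1 : ℤ) = -2 by norm_num, zpow_neg,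
          show (2 : ℤ) = 1 + 1 by norm_num, zpow_add₀ hq, zpow_one, mul_inv]
        ring
      refine ⟨fun h2 => ?_, ?_⟩
      · rw [e] at h2
        have : - (q⁻¹ * q⁻¹) = 1 := mul_right_cancel₀ hc (by rw [h2, one_mul])
        apply q_sq_ne_neg_one
        field_simp at this
        linear_combination -this
      · rw [D.diagWeight_self hi, h, if_neg (by decide), e]
        field_simp

/-- The bosonisation of R: one sign depending only on the parities of i, j and k turns all three
kinds of entries into those of the sign-free vertex model, up to the overall factor q⁻¹. -/
theorem sgn_mul_R (i j k l : Fin N) :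
    sgn Kq (D.par i * D.par j + D.par i * D.par k + D.par j) * D.R i j k l =
      q⁻¹ * D.weights.S i k j l := by
  have sg (x : ZMod 2) : sgn Kq (x + x) = 1 := by
    rw [CharTwo.add_self_eq_zero, sgn_zero]
  have h3 : ∀ x : ZMod 2, x * x = x := by decide
  rw [R, mul_sub, VertexWeights.S, sub_add, mul_sub q⁻¹]
  congr 1
  · by_cases h : i = j ∧ k = l
    · obtain ⟨rfl, rfl⟩ := h
      simp only [and_self, if_true, weights, diagWeight, h3]
      rw [add_right_comm, sgn_add, sg]; ring
    · have h' : ¬(j = i ∧ l = k) := fun x => h ⟨x.1.symm, x.2.symm⟩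
      simp [h, h']
  · by_cases hij : i < j
    · simp only [hij, true_and, if_true]
      have e1 : ((sgn Kq (D.par i * D.par j + D.par i * D.par k + D.par j)) *
          ((q - q⁻¹) * q⁻¹ * sgn Kq (D.par j) * if k = j ∧ l = i then 1 else 0)) =
          q⁻¹ * if k = j ∧ l = i then D.weights.κ else 0 := by
        split_ifs with h
        · rw [h.1, sgn_add, sg, one_mul, weights]
          linear_combination (q - q⁻¹) * q⁻¹ * sgn_mul_self (K := Kq) (D.par j)
        · simp
      have e2 : ((sgn Kq (D.par i * D.par j + D.par i * D.par k + D.par j)) *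
          ((q - q⁻¹) * q⁻¹ * sgn Kq (D.par j) * if k = i.rev ∧ l = j.rev then
            sgn Kq (D.par j * (D.par i + D.par j)) * ((D.theta i * D.theta j : ℤˣ) : ℤ) *
              q ^ D.rExp i j else 0)) =
          q⁻¹ * if k = i.rev ∧ l = j.rev then
            D.weights.κ * (D.weights.c i * (D.weights.c j)⁻¹) else 0 := by
        split_ifs with h
        · have e3 : D.weights.c i * (D.weights.c j)⁻¹ = sgn Kq (D.par i + D.par j) *
              ((D.theta i : ℤ) * (D.theta j : ℤ)) * q ^ D.rExp i j := by
            have := D.cupWeight_ne_zero j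
            change D.cupWeight i * (D.cupWeight j)⁻¹ = _
            rw [D.cupWeight_eq i j]; field_simp
          have e4 : sgn Kq (D.par i * D.par j + D.par i * D.par k + D.par j) *
              sgn Kq (D.par j) * sgn Kq (D.par j * (D.par i + D.par j)) =
              sgn Kq (D.par i + D.par j) := by
            rw [← sgn_add, ← sgn_add, h.1, D.par_rev]
            congr 1
            generalize D.par i = a; generalize D.par j = b; revert a b; decide
          rw [e3, ← e4]
          simp only [weights]
          push_cast
          ring
        · simp
      rw [mul_sub, mul_sub, e1, e2]; ring
    · simp [hij]

end OspDatum

/-! ### Comatrices over a superbialgebra, and pairings on them -/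

open CoalgebraStruct

section Comatrices

variable {K : Type*} [Field K] {A : Type*} [Ring A] [Algebra K A]
  (𝒜 : ZMod 2 → Submodule K A) [GradedAlgebra 𝒜] [CoalgebraStruct K A]

/-- The comultiplication and the counit are morphisms of superalgebras. -/
structure IsSuperbialgebra : Prop where
  comul_one : comul (R := K) (1 : A) = 1 ⊗ₜ 1
  counit_one : counit (R := K) (1 : A) = 1
  counit_mul : ∀ a b : A, counit (R := K) (a * b) = counit (R := K) a * counit (R := K) b
  comul_mul : ∀ a b : A, GradedTensorProduct.of K 𝒜 𝒜 (comul (R := K) (a * b)) =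
    GradedTensorProduct.of K 𝒜 𝒜 (comul (R := K) a) *
      GradedTensorProduct.of K 𝒜 𝒜 (comul (R := K) b)

/-- A homogeneous matrix of elements with `Δ(t_xy) = ∑ t_xz ⊗ t_zy` and `ε(t_xy) = δ_xy`. -/
structure Comat where
  X : Type
  [fin : Fintype X]
  [dec : DecidableEq X]
  p : X → ZMod 2
  t : X → X → A
  mem : ∀ x y, t x y ∈ 𝒜 (p x + p y)
  comul_t : ∀ x y, comul (R := K) (t x y) = ∑ z, t x z ⊗ₜ[K] t z y
  counit_t : ∀ x y, counit (R := K) (t x y) = if x = y then 1 else 0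

attribute [instance] Comat.fin Comat.dec

variable {𝒜}

namespace Comat

theorem mul_tmul_mul {i j : ZMod 2} (a a' : A) {b b' : A} (hb : b ∈ 𝒜 i) (ha' : a' ∈ 𝒜 j) :
    GradedTensorProduct.of K 𝒜 𝒜 (a ⊗ₜ b) * GradedTensorProduct.of K 𝒜 𝒜 (a' ⊗ₜ b') =
      GradedTensorProduct.of K 𝒜 𝒜 (sgn K (i * j) • ((a * a') ⊗ₜ (b * b'))) := by
  have h := GradedTensorProduct.tmul_coe_mul_coe_tmul (R := K) 𝒜 𝒜 a ⟨b, hb⟩ ⟨a', ha'⟩ b'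
  rw [uzpow_smul_eq (K := K)] at h
  rw [map_smul]
  exact h

/-- The trivial comatrix. -/
def one (h : IsSuperbialgebra 𝒜) : Comat 𝒜 where
  X := Unit
  p _ := 0
  t _ _ := 1
  mem _ _ := by simpa using SetLike.one_mem_graded 𝒜
  comul_t _ _ := by simp [h.comul_one]
  counit_t _ _ := by simp [h.counit_one]

/-- The product of two comatrices. -/
def mul (h : IsSuperbialgebra 𝒜) (C E : Comat 𝒜) : Comat 𝒜 where
  X := C.X × E.X
  p x := C.p x.1 + E.p x.2
  t x y := sgn K (E.p x.2 * (C.p x.1 + C.p y.1)) • (C.t x.1 y.1 * E.t x.2 y.2)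
  mem x y := by
    refine Submodule.smul_mem _ _ ?_
    have := SetLike.mul_mem_graded (C.mem x.1 y.1) (E.mem x.2 y.2)
    rwa [add_add_add_comm] at this
  comul_t x y := by
    apply (GradedTensorProduct.of K 𝒜 𝒜).injective
    rw [map_smul, map_smul, h.comul_mul, C.comul_t, E.comul_t, map_sum, map_sum,
      Finset.sum_mul_sum, ← Finset.sum_product', Finset.smul_sum, map_sum]
    refine Finset.sum_congr rfl fun z _ => ?_
    rw [mul_tmul_mul _ _ (C.mem _ _) (E.mem _ _), ← map_smul, smul_smul, ← sgn_add,
      TensorProduct.smul_tmul_smul, ← sgn_add]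
    congr 3
    generalize C.p x.1 = a; generalize C.p y.1 = b; generalize C.p z.1 = c
    generalize E.p x.2 = d; generalize E.p z.2 = e
    revert a b c d e; decide
  counit_t x y := by
    rw [map_smul, h.counit_mul, C.counit_t, E.counit_t]
    have h2 (a : ZMod 2) : a + a = 0 := by revert a; decide
    by_cases h1 : x.1 = y.1
    · by_cases h3 : x.2 = y.2
      · simp [Prod.ext_iff, h1, h3, h2, sgn_zero]
      · simp [Prod.ext_iff, h3]
    · simp [Prod.ext_iff, h1]

/-- The powers of a comatrix. -/
def pow (h : IsSuperbialgebra 𝒜) (C : Comat 𝒜) : ℕ → Comat 𝒜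
  | 0 => one h
  | n + 1 => mul h C (pow h C n)

theorem mul_eq_smul (h : IsSuperbialgebra 𝒜) (C E : Comat 𝒜) (x y : C.X) (z w : E.X) :
    C.t x y * E.t z w = sgn K (E.p z * (C.p x + C.p y)) • (mul h C E).t (x, z) (y, w) := by
  simp [mul, smul_smul, sgn_mul_self]

/-- A superbialgebra generated by a comatrix is spanned by the entries of its powers. -/
theorem span_pow (h : IsSuperbialgebra 𝒜) (C : Comat 𝒜)
    (hC : Algebra.adjoin K {a | ∃ x y, a = C.t x y} = ⊤) :
    Submodule.span K {a | ∃ n x y, a = (pow h C n).t x y} = ⊤ := by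
  set M := Submodule.span K {a | ∃ n x y, a = (pow h C n).t x y}
  have h1 : (1 : A) ∈ M := Submodule.subset_span ⟨0, (), (), rfl⟩
  -- It suffices that the span is a left ideal, since it contains 1. Left multiplication by a
  -- generator sends an entry of the n-th power to an entry of the next one, up to sign.
  have key : ∀ a : A, ∀ b ∈ M, a * b ∈ M := by
    intro a
    have ha : a ∈ Algebra.adjoin K {a | ∃ x y, a = C.t x y} := by rw [hC]; trivial
    induction ha using Algebra.adjoin_induction with
    | mem a ha =>
      obtain ⟨x, y, rfl⟩ := ha
      intro b hb
      induction hb using Submodule.span_induction with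
      | mem b hb =>
        obtain ⟨n, z, w, rfl⟩ := hb
        rw [mul_eq_smul h]
        exact Submodule.smul_mem _ _ (Submodule.subset_span ⟨n + 1, (x, z), (y, w), rfl⟩)
      | zero => rw [mul_zero]; exact M.zero_mem
      | add b c _ _ hb hc => rw [mul_add]; exact M.add_mem hb hc
      | smul r b _ hb => rw [mul_smul_comm]; exact M.smul_mem _ hb
    | algebraMap r => intro b hb; rw [← Algebra.smul_def]; exact M.smul_mem _ hb
    | add a c _ _ ha hc => intro b hb; rw [add_mul]; exact M.add_mem (ha b hb) (hc b hb)
    | mul a c _ _ ha hc => intro b hb; rw [mul_assoc]; exact ha _ (hc b hb)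
  rw [eq_top_iff]
  intro a _
  simpa using key a 1 h1

/-- The comatrix generates the superbialgebra. -/
def Generates (C : Comat 𝒜) : Prop := Algebra.adjoin K {a | ∃ x y, a = C.t x y} = ⊤

theorem Generates.linearMap_ext {C : Comat 𝒜} (hC : C.Generates) (h : IsSuperbialgebra 𝒜)
    {M : Type*} [AddCommMonoid M] [Module K M] {f g : A →ₗ[K] M}
    (hfg : ∀ n x y, f ((pow h C n).t x y) = g ((pow h C n).t x y)) : f = g := by
  refine LinearMap.ext_on_range (v := fun z : Σ n, (pow h C n).X × (pow h C n).X =>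
    (pow h C z.1).t z.2.1 z.2.2) ?_ fun z => hfg _ _ _
  rw [← span_pow h C hC]
  congr 1
  ext a
  constructor
  · rintro ⟨⟨n, x, y⟩, rfl⟩; exact ⟨n, x, y, rfl⟩
  · rintro ⟨n, x, y, rfl⟩; exact ⟨⟨n, x, y⟩, rfl⟩

variable {B : Type*} [Ring B] [Algebra K B] {ℬ : ZMod 2 → Submodule K B} [GradedAlgebra ℬ]
  [CoalgebraStruct K B]

theorem Generates.tensor_ext {C : Comat 𝒜} (hC : C.Generates) (h : IsSuperbialgebra 𝒜)
    {E : Comat ℬ} (hE : E.Generates) (h' : IsSuperbialgebra ℬ)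
    {M : Type*} [AddCommMonoid M] [Module K M] {f g : A ⊗[K] B →ₗ[K] M}
    (hfg : ∀ n m x y z w, f ((pow h C n).t x y ⊗ₜ (pow h' E m).t z w) =
      g ((pow h C n).t x y ⊗ₜ (pow h' E m).t z w)) : f = g := by
  refine TensorProduct.ext (hC.linearMap_ext h fun n x y => hE.linearMap_ext h' fun m z w => ?_)
  exact hfg n m x y z w

/-- Evenness of a pairing on the entries of two comatrices. -/
def EvenOn (σ : A ⊗[K] B →ₗ[K] K) (C : Comat 𝒜) (E : Comat ℬ) : Prop :=
  ∀ x x' y y', C.p x + C.p x' ≠ E.p y + E.p y' → σ (C.t x x' ⊗ₜ E.t y y') = 0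

theorem evenOn_of_isEvenPairing {σ : A ⊗[K] B →ₗ[K] K} (hσ : IsEvenPairing 𝒜 ℬ σ) (C : Comat 𝒜)
    (E : Comat ℬ) : EvenOn σ C E :=
  fun x x' y y' hne => hσ hne _ (C.mem x x') _ (E.mem y y')

/-- Precomposing with the projections to two fixed degrees turns evenness into the vanishing of a
linear map, which can be tested on homogeneous entries. -/
theorem Generates.isEvenPairing {C : Comat 𝒜} (hC : C.Generates) (h : IsSuperbialgebra 𝒜)
    {E : Comat ℬ} (hE : E.Generates) (h' : IsSuperbialgebra ℬ) {σ : A ⊗[K] B →ₗ[K] K}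
    (hσ : ∀ n m, EvenOn σ (pow h C n) (pow h' E m)) : IsEvenPairing 𝒜 ℬ σ := by
  intro i j hij a ha b hb
  have key : σ ∘ₗ TensorProduct.map (GradedAlgebra.proj 𝒜 i) (GradedAlgebra.proj ℬ j) = 0 := by
    refine hC.tensor_ext h hE h' fun n m x y z w => ?_
    have h1 (i : ZMod 2) : GradedAlgebra.proj 𝒜 i ((pow h C n).t x y) =
        if (pow h C n).p x + (pow h C n).p y = i then (pow h C n).t x y else 0 := by
      split_ifs with hi
      · subst hi; exact DirectSum.decompose_of_mem_same _ ((pow h C n).mem x y)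
      · exact DirectSum.decompose_of_mem_ne _ ((pow h C n).mem x y) hi
    have h2 (i : ZMod 2) : GradedAlgebra.proj ℬ i ((pow h' E m).t z w) =
        if (pow h' E m).p z + (pow h' E m).p w = i then (pow h' E m).t z w else 0 := by
      split_ifs with hi
      · subst hi; exact DirectSum.decompose_of_mem_same _ ((pow h' E m).mem z w)
      · exact DirectSum.decompose_of_mem_ne _ ((pow h' E m).mem z w) hi
    rw [LinearMap.comp_apply, TensorProduct.map_tmul, h1, h2]
    split_ifs with e1 e2
    · subst e1 e2; simpa using hσ n m x y z w hij
    · simp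
    · simp
    · simp
  have := LinearMap.congr_fun key (a ⊗ₜ b)
  rw [LinearMap.comp_apply, TensorProduct.map_tmul] at this
  rw [show GradedAlgebra.proj 𝒜 i a = a from DirectSum.decompose_of_mem_same _ ha,
    show GradedAlgebra.proj ℬ j b = b from DirectSum.decompose_of_mem_same _ hb] at this
  simpa using this

/-- The matrix `(-1)^{|x'||y|} (t_xx', u_yy')` of a pairing on two comatrices. -/
def pairMat (σ : A ⊗[K] B →ₗ[K] K) (C : Comat 𝒜) (E : Comat ℬ) (x : C.X) (y : E.X) (x' : C.X)
    (y' : E.X) : K :=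
  sgn K (C.p x' * E.p y) * σ (C.t x x' ⊗ₜ E.t y y')

theorem pairing_eq (σ : A ⊗[K] B →ₗ[K] K) (C : Comat 𝒜) (E : Comat ℬ) (x : C.X) (y : E.X)
    (x' : C.X) (y' : E.X) :
    σ (C.t x x' ⊗ₜ E.t y y') = sgn K (C.p x' * E.p y) * pairMat σ C E x y x' y' := by
  rw [pairMat, ← mul_assoc, sgn_mul_self, one_mul]

theorem EvenOn.pairMat_eq_zero {σ : A ⊗[K] B →ₗ[K] K} {C : Comat 𝒜} {E : Comat ℬ}
    (h : EvenOn σ C E) {x : C.X} {y : E.X} {x' : C.X} {y' : E.X}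
    (hne : C.p x + C.p x' ≠ E.p y + E.p y') : pairMat σ C E x y x' y' = 0 := by
  rw [pairMat, h _ _ _ _ hne, mul_zero]

theorem pairing₂_tmul (σ : A ⊗[K] B →ₗ[K] K) {i j : ZMod 2} (a : A) {a' : A} {b : B} (b' : B)
    (ha' : a' ∈ 𝒜 i) (hb : b ∈ ℬ j) : pairing₂ 𝒜 ℬ σ ((a ⊗ₜ a') ⊗ₜ (b ⊗ₜ b')) =
      sgn K (i * j) * (σ (a ⊗ₜ b) * σ (a' ⊗ₜ b')) := by
  simp [pairing₂, midMap, braid_tmul 𝒜 ℬ ha' hb, ← TensorProduct.smul_tmul',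
    TensorProduct.tmul_smul]

/-- The identity `(aa', b) = (a ⊗ a', Δ(b))` on comatrices. -/
def MulLeftOn (h : IsSuperbialgebra 𝒜) (σ : A ⊗[K] B →ₗ[K] K) (C C' : Comat 𝒜) (E : Comat ℬ) :
    Prop :=
  ∀ x z y x' z' y', pairMat σ (mul h C C') E (x, z) y (x', z') y' =
    ∑ b, pairMat σ C E x y x' b * pairMat σ C' E z b z' y'

/-- The identity `(a, bb') = (Δ^op(a), b ⊗ b')` on comatrices. -/
def MulRightOn (h : IsSuperbialgebra ℬ) (σ : A ⊗[K] B →ₗ[K] K) (C : Comat 𝒜) (E E' : Comat ℬ) :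
    Prop :=
  ∀ x y s x' y' s', pairMat σ C (mul h E E') x (y, s) x' (y', s') =
    ∑ a, pairMat σ C E' x s a s' * pairMat σ C E a y x' y'

/-- In `pairMat` the axiom becomes a sign-free matrix product. The signs of the two sides agree only
for summands whose parities match, which is why evenness of the pairing on C and E is assumed; the
other summands vanish. -/
theorem mulLeftOn_iff (h : IsSuperbialgebra 𝒜) {σ : A ⊗[K] B →ₗ[K] K} {C C' : Comat 𝒜}
    {E : Comat ℬ} (h1 : EvenOn σ C E) : MulLeftOn h σ C C' E ↔
      ∀ x x' z z' y y', σ ((C.t x x' * C'.t z z') ⊗ₜ E.t y y') =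
        pairing₂ 𝒜 ℬ σ ((C.t x x' ⊗ₜ C'.t z z') ⊗ₜ comul (R := K) (E.t y y')) := by
  have key (x x' z z' y y') : sgn K (C'.p z * (C.p x + C.p x') + (C.p x' + C'.p z') * E.p y) *
      pairing₂ 𝒜 ℬ σ ((C.t x x' ⊗ₜ C'.t z z') ⊗ₜ comul (R := K) (E.t y y')) =
      ∑ b, pairMat σ C E x y x' b * pairMat σ C' E z b z' y' := by
    rw [E.comul_t, TensorProduct.tmul_sum, map_sum, Finset.mul_sum]
    refine Finset.sum_congr rfl fun b _ => ?_
    rw [pairing₂_tmul σ _ _ (C'.mem _ _) (E.mem _ _), pairing_eq, pairing_eq σ C']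
    by_cases hne : C.p x + C.p x' = E.p y + E.p b
    · have e : C'.p z * (C.p x + C.p x') + (C.p x' + C'.p z') * E.p y +
          (C'.p z + C'.p z') * (E.p y + E.p b) + C.p x' * E.p y + C'.p z' * E.p b = 0 := by
        rw [hne]
        generalize C'.p z = a; generalize C.p x' = c; generalize C'.p z' = d
        generalize E.p y = e; generalize E.p b = f
        revert a c d e f; decide
      have e' := congrArg (sgn K) e
      simp only [sgn_add, sgn_zero, ← add_mul] at e' ⊢
      linear_combination (pairMat σ C E x y x' b * pairMat σ C' E z b z' y') * e'
    · rw [h1.pairMat_eq_zero hne]; ring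
  have hm (x x' z z' y y') : pairMat σ (mul h C C') E (x, z) y (x', z') y' =
      sgn K (C'.p z * (C.p x + C.p x') + (C.p x' + C'.p z') * E.p y) *
        σ ((C.t x x' * C'.t z z') ⊗ₜ E.t y y') := by
    simp only [pairMat, mul, ← TensorProduct.smul_tmul', map_smul, smul_eq_mul, sgn_add]
    ring
  constructor
  · intro H x x' z z' y y'
    have := H x z y x' z' y'
    rw [hm, ← key] at this
    exact mul_left_cancel₀ (sgn_ne_zero _) this
  · intro H x z y x' z' y'
    rw [hm, ← key, H]

theorem mulRightOn_iff (h : IsSuperbialgebra ℬ) {σ : A ⊗[K] B →ₗ[K] K} {C : Comat 𝒜}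
    {E E' : Comat ℬ} (h1 : EvenOn σ C E) : MulRightOn h σ C E E' ↔
      ∀ x x' y y' s s', σ (C.t x x' ⊗ₜ (E.t y y' * E'.t s s')) =
        pairing₂ 𝒜 ℬ σ (braid 𝒜 𝒜 (comul (R := K) (C.t x x')) ⊗ₜ (E.t y y' ⊗ₜ E'.t s s')) := by
  have key (x x' y y' s s') : sgn K (C.p x' * (E.p y + E'.p s) + E'.p s * (E.p y + E.p y')) *
      pairing₂ 𝒜 ℬ σ (braid 𝒜 𝒜 (comul (R := K) (C.t x x')) ⊗ₜ (E.t y y' ⊗ₜ E'.t s s')) =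
      ∑ a, pairMat σ C E' x s a s' * pairMat σ C E a y x' y' := by
    rw [C.comul_t, map_sum, TensorProduct.sum_tmul, map_sum, Finset.mul_sum]
    refine Finset.sum_congr rfl fun a _ => ?_
    rw [braid_tmul 𝒜 𝒜 (C.mem _ _) (C.mem _ _), ← TensorProduct.smul_tmul', map_smul,
      pairing₂_tmul σ _ _ (C.mem _ _) (E.mem _ _), pairing_eq, pairing_eq σ C E', smul_eq_mul]
    by_cases hne : C.p a + C.p x' = E.p y + E.p y'
    · have e : C.p x' * (E.p y + E'.p s) + E'.p s * (E.p y + E.p y') +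
          (C.p x + C.p a) * (C.p a + C.p x') + (C.p x + C.p a) * (E.p y + E.p y') +
          C.p x' * E.p y + C.p a * E'.p s = 0 := by
        rw [← hne]
        generalize C.p x = x₁; generalize C.p x' = x₂; generalize C.p a = x₃
        generalize E.p y = x₄; generalize E'.p s = x₅
        revert x₁ x₂ x₃ x₄ x₅; decide
      have e' := congrArg (sgn K) e
      simp only [sgn_add, sgn_zero] at e' ⊢
      linear_combination (pairMat σ C E' x s a s' * pairMat σ C E a y x' y') * e'
    · rw [h1.pairMat_eq_zero hne]; ring
  have hm (x x' y y' s s') : pairMat σ C (mul h E E') x (y, s) x' (y', s') =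
      sgn K (C.p x' * (E.p y + E'.p s) + E'.p s * (E.p y + E.p y')) *
        σ (C.t x x' ⊗ₜ (E.t y y' * E'.t s s')) := by
    simp only [pairMat, mul, TensorProduct.tmul_smul, map_smul, smul_eq_mul, sgn_add]
    ring
  constructor
  · intro H x x' y y' s s'
    have := H x y s x' y' s'
    rw [hm, ← key] at this
    exact mul_left_cancel₀ (sgn_ne_zero _) this
  · intro H x y s x' y' s'
    rw [hm, ← key, H]

theorem pairMat_one_left (h : IsSuperbialgebra 𝒜) {σ : A ⊗[K] B →ₗ[K] K}
    (hσ : ∀ b : B, σ (1 ⊗ₜ b) = counit (R := K) b) (E : Comat ℬ) (x x' y y') :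
    pairMat σ (one h) E x y x' y' = if y = y' then 1 else 0 := by
  simp only [pairMat, one, hσ, E.counit_t, zero_mul, sgn_zero, one_mul]

theorem pairMat_one_right (h : IsSuperbialgebra ℬ) {σ : A ⊗[K] B →ₗ[K] K}
    (hσ : ∀ a : A, σ (a ⊗ₜ 1) = counit (R := K) a) (C : Comat 𝒜) (x x' y y') :
    pairMat σ C (one h) x y x' y' = if x = x' then 1 else 0 := by
  simp only [pairMat, one, hσ, C.counit_t, mul_zero, sgn_zero, one_mul]

end Comat

end Comatrices

/-! ### The generating comatrix of U^±(R) and the RLL relations without signs -/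

theorem rll_subalgebra {N : ℕ} (D : OspDatum N) {A : Type*} [Ring A] [Algebra Kq A]
    (M : Subalgebra Kq A) {L : Fin N → Fin N → A} (hm : ∀ i j, L i j ∈ M)
    (h : ∀ i j k l, rllLeft D L L i j k l = rllRight D L L i j k l) (i j k l : Fin N) :
    rllLeft D (fun i j => (⟨L i j, hm i j⟩ : M)) (fun i j => ⟨L i j, hm i j⟩) i j k l =
      rllRight D (fun i j => (⟨L i j, hm i j⟩ : M)) (fun i j => ⟨L i j, hm i j⟩) i j k l := by
  let L' : Fin N → Fin N → M := fun i j => ⟨L i j, hm i j⟩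
  have e1 := map_rllLeft D M.val L' L' i j k l
  have e2 := map_rllRight D M.val L' L' i j k l
  have e : M.val (rllLeft D L' L' i j k l) = M.val (rllRight D L' L' i j k l) := by
    rw [e1, e2]; exact h i j k l
  exact Subtype.ext e

namespace UHalf

variable {N : ℕ} (D : OspDatum N) (s : Bool)

theorem isSuperbialgebra : IsSuperbialgebra (grading D s) where
  comul_one := by
    change (GradedTensorProduct.of Kq (grading D s) (grading D s)).symm (comulHom D s 1) = _
    rw [map_one]
    rfl
  counit_one := map_one (counitHom D s)
  counit_mul := map_mul (counitHom D s)
  comul_mul := map_mul (comulHom D s)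

/-- The generating matrix, with signs that make it a comatrix. -/
def genComat : Comat (grading D s) where
  X := Fin N
  p := D.par
  t i j := sgn Kq (D.par i * (D.par j + 1)) • gen D s i j
  mem i j := Submodule.smul_mem _ _ (gen_mem D s i j)
  comul_t i j := by
    rw [map_smul, comul_gen, Finset.smul_sum]
    refine Finset.sum_congr rfl fun k _ => ?_
    rw [TensorProduct.smul_tmul_smul, smul_smul, ← sgn_add, ← sgn_add]
    congr 2
    generalize D.par i = a; generalize D.par j = b; generalize D.par k = c
    revert a b c; decide
  counit_t i j := by
    rw [map_smul, counit_gen]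
    split_ifs with h
    · subst h
      rcases zmod2_cases (D.par i) with h | h <;> simp [h, sgn_zero, show (1 + 1 : ZMod 2) = 0 from rfl]
    · simp

theorem gen_eq (i j : Fin N) :
    gen D s i j = sgn Kq (D.par i * (D.par j + 1)) • (genComat D s).t i j := by
  simp [genComat, smul_smul, sgn_mul_self]

theorem subalgebra_eq_top (M : Subalgebra Kq (UHalf D s)) (hm : ∀ i j, gen D s i j ∈ M) :
    M = ⊤ := by
  -- The universal property gives a morphism into the subalgebra. Composed with the inclusion it
  -- fixes the generators, hence is the identity, so every element lies in the subalgebra.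
  let f : UHalf D s →ₐ[Kq] M := lift (fun i j => ⟨gen D s i j, hm i j⟩)
    (fun i j h => Subtype.ext (gen_eq_zero D s h)) (fun i j k l => by
      exact rll_subalgebra D M hm (gen_rel D s) i j k l)
  have hf : M.val.comp f = AlgHom.id Kq _ := hom_ext fun i j => by
    rw [AlgHom.comp_apply, lift_gen]; rfl
  rw [eq_top_iff]
  intro a _
  rw [← AlgHom.id_apply (R := Kq) a, ← hf]
  exact (f a).2

theorem generates_genComat : (genComat D s).Generates := by
  refine subalgebra_eq_top D s _ fun i j => ?_
  rw [gen_eq]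
  exact Subalgebra.smul_mem _ (Algebra.subset_adjoin (by exact ⟨i, j, rfl⟩)) _

end UHalf

namespace OspDatum

variable {N : ℕ} (D : OspDatum N) {A : Type*} [Ring A] [Algebra Kq A]

theorem weights_even {i j k l : Fin N} (h : D.weights.S i k j l ≠ 0) :
    D.par i + D.par j + D.par k + D.par l = 0 := by
  refine D.R_even fun h0 => h ?_
  have := D.sgn_mul_R i j k l
  rw [h0, mul_zero] at this
  exact (mul_eq_zero.1 this.symm).resolve_left (inv_ne_zero q_ne_zero)

theorem R_eq (i j k l : Fin N) : D.R i j k l =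
    sgn Kq (D.par i * D.par j + D.par i * D.par k + D.par j) * (q⁻¹ * D.weights.S i k j l) := by
  rw [← D.sgn_mul_R, ← mul_assoc, sgn_mul_self, one_mul]

/-- The product of entries of two matrices, with the sign of the product of two comatrices. -/
def bos (L M : Fin N → Fin N → A) (i k j l : Fin N) : A :=
  sgn Kq (D.par k * (D.par i + D.par j) + D.par i * (D.par j + 1) + D.par k * (D.par l + 1)) •
    (L i j * M k l)

/-- Each side of the super relation is the matching sign-free expression times one common sign and
q⁻¹. The factors coming from the summation indices cancel because S preserves parity. -/
theorem rll_iff (L M : Fin N → Fin N → A) (i j k l : Fin N) :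
    rllLeft D L M i j k l = rllRight D L M i j k l ↔
      ∑ a, ∑ b, D.weights.S i k a b • D.bos L M a b j l =
        ∑ a, ∑ b, D.weights.S a b j l • D.bos M L k i b a := by
  have h1 : rllLeft D L M i j k l = (sgn Kq (D.par i * D.par l + D.par i * D.par k +
      D.par k * D.par l + D.par k + D.par i * D.par j + D.par j * D.par l + D.par i) * q⁻¹) •
      ∑ a, ∑ b, D.weights.S i k a b • D.bos L M a b j l := by
    simp only [rllLeft, Finset.smul_sum, bos, smul_smul]
    refine Finset.sum_congr rfl fun a _ => Finset.sum_congr rfl fun b _ => ?_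
    rw [R_eq]
    by_cases h : D.weights.S i k a b = 0
    · simp [h]
    have h2 := D.weights_even h
    congr 1
    have e : (D.par a + D.par j) * (D.par k + D.par l) + (D.par i * D.par a + D.par i * D.par k +
        D.par a) = (D.par i * D.par l + D.par i * D.par k +
      D.par k * D.par l + D.par k + D.par i * D.par j + D.par j * D.par l + D.par i) +
      (D.par b * (D.par a + D.par j) + D.par a * (D.par j + 1) + D.par b * (D.par l + 1)) := by
      generalize D.par i = x₁ at *; generalize D.par j = x₂ at *; generalize D.par k = x₃ at *
      generalize D.par l = x₄ at *; generalize D.par a = x₅ at *; generalize D.par b = x₆ at *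
      revert h2; revert x₁ x₂ x₃ x₄ x₅ x₆; decide
    have e' := congrArg (sgn Kq) e
    rw [sgn_add, sgn_add (K := Kq) (_ + D.par i)] at e'
    linear_combination (q⁻¹ * D.weights.S i k a b) * e'
  rw [h1]
  clear h1
  have h2 : rllRight D L M i j k l = (sgn Kq (D.par i * D.par l + D.par i * D.par k +
      D.par k * D.par l + D.par k + D.par i * D.par j + D.par j * D.par l + D.par i) * q⁻¹) •
      ∑ a, ∑ b, D.weights.S a b j l • D.bos M L k i b a := by
    simp only [rllRight, Finset.smul_sum, bos, smul_smul]
    refine Finset.sum_congr rfl fun a _ => Finset.sum_congr rfl fun b _ => ?_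
    rw [R_eq]
    by_cases h : D.weights.S a b j l = 0
    · simp [h]
    have h2 := D.weights_even h
    congr 1
    have e : (D.par k + D.par b) * (D.par a + D.par j) + (D.par a * D.par j + D.par a * D.par b +
        D.par j) = (D.par i * D.par l + D.par i * D.par k +
      D.par k * D.par l + D.par k + D.par i * D.par j + D.par j * D.par l + D.par i) +
      (D.par i * (D.par k + D.par b) + D.par k * (D.par b + 1) + D.par i * (D.par a + 1)) := by
      generalize D.par i = x₁ at *; generalize D.par j = x₂ at *; generalize D.par k = x₃ at *
      generalize D.par l = x₄ at *; generalize D.par a = x₅ at *; generalize D.par b = x₆ at *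
      revert h2; revert x₁ x₂ x₃ x₄ x₅ x₆; decide
    have e' := congrArg (sgn Kq) e
    rw [sgn_add, sgn_add (K := Kq) (_ + D.par i)] at e'
    linear_combination (q⁻¹ * D.weights.S a b j l) * e'
  rw [h2]
  exact smul_right_inj (mul_ne_zero (sgn_ne_zero _) (inv_ne_zero q_ne_zero))

end OspDatum

/-! ### The action of linear forms on a superbialgebra -/

section Action

variable {K : Type*} [Field K] {B : Type*} [Ring B] [Algebra K B]
  (ℬ : ZMod 2 → Submodule K B) [GradedAlgebra ℬ] [CoalgebraStruct K B]

/-- The action `b ↦ ∑ (-1)^{|b_1||b_2|} φ(b_2) b_1` of a linear form. -/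
def formAct (φ : B →ₗ[K] K) : B →ₗ[K] B :=
  (TensorProduct.lid K B).toLinearMap ∘ₗ LinearMap.rTensor B φ ∘ₗ braid ℬ ℬ ∘ₗ comul (R := K)

variable {ℬ}

theorem formAct_comat (φ : B →ₗ[K] K) (E : Comat ℬ) (y y' : E.X) :
    formAct ℬ φ (E.t y y') =
      ∑ b, (sgn K ((E.p y + E.p b) * (E.p b + E.p y')) * φ (E.t b y')) • E.t y b := by
  simp only [formAct, LinearMap.comp_apply, E.comul_t, map_sum]
  refine Finset.sum_congr rfl fun b _ => ?_
  rw [braid_tmul ℬ ℬ (E.mem _ _) (E.mem _ _)]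
  simp [smul_smul]

theorem zmod2_add_self (x : ZMod 2) : x + x = 0 := CharTwo.add_self_eq_zero x

/-- The operators of the form `formAct φ`. -/
def formActAlg (h : IsSuperbialgebra ℬ) {E : Comat ℬ} (hE : E.Generates) :
    Subalgebra K (Module.End K B) where
  carrier := {f | f = formAct ℬ (counit (R := K) ∘ₗ f)}
  mul_mem' {f g} hf hg := by
    refine hE.linearMap_ext h fun n y y' => ?_
    generalize Comat.pow h E n = E at *
    rw [Set.mem_ofPred_eq] at hf hg
    have hc (f) (hf : f = formAct ℬ (counit (R := K) ∘ₗ f)) (y y') : f (E.t y y') =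
      ∑ b, (sgn K ((E.p y + E.p b) * (E.p b + E.p y')) * counit (R := K) (f (E.t b y'))) • E.t y b := by
      conv_lhs => rw [hf, formAct_comat]
      rfl
    have hfg (y y') : (f * g) (E.t y y') = ∑ c, ∑ b, (sgn K ((E.p y + E.p b) * (E.p b + E.p y') +
        (E.p y + E.p c) * (E.p c + E.p b)) * (counit (R := K) (f (E.t c b)) *
          counit (R := K) (g (E.t b y')))) • E.t y c := by
      rw [Module.End.mul_apply, hc g hg]
      simp only [map_sum, map_smul]
      rw [Finset.sum_comm]
      refine Finset.sum_congr rfl fun b _ => ?_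
      rw [hc f hf, Finset.smul_sum]
      refine Finset.sum_congr rfl fun c _ => ?_
      rw [smul_smul, sgn_add]
      congr 1; ring
    rw [formAct_comat, hfg]
    refine Finset.sum_congr rfl fun c _ => ?_
    rw [← Finset.sum_smul]
    congr 1
    -- The product rule of a comatrix plays the role of coassociativity: applying the counit selects
    -- one term of the outer sum, and what is left is the linear form that defines the composite
    -- operator.
    have hc' : counit (R := K) ((f * g) (E.t c y')) =
        ∑ b, sgn K ((E.p c + E.p b) * (E.p b + E.p y') + (E.p c + E.p c) * (E.p c + E.p b)) *
          (counit (R := K) (f (E.t c b)) * counit (R := K) (g (E.t b y'))) := by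
      rw [hfg, map_sum, Finset.sum_eq_single c (fun d _ hd => by simp [E.counit_t, hd.symm])
        (by simp)]
      simp [E.counit_t]
    rw [LinearMap.comp_apply, hc', Finset.mul_sum]
    simp only [← mul_assoc, ← sgn_add]
    refine Finset.sum_congr rfl fun b _ => ?_
    congr 3
    generalize E.p y = x₁; generalize E.p b = x₂; generalize E.p y' = x₃
    generalize E.p c = x₄
    revert x₁ x₂ x₃ x₄; decide
  add_mem' {f g} hf hg := by
    rw [Set.mem_ofPred_eq] at *
    conv_lhs => rw [hf, hg]
    ext b
    simp [formAct, LinearMap.comp_add, LinearMap.rTensor_add]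
  algebraMap_mem' r := by
    refine hE.linearMap_ext h fun n y y' => ?_
    rw [formAct_comat]
    simp [zmod2_add_self, sgn_zero, Module.algebraMap_end_apply, Comat.counit_t]

/-- The counit axiom: ε(b_1) φ(b_2) = φ(b), the sign being trivial where ε(b_1) is nonzero. A linear
form is thus recovered from its operator. -/
theorem counit_comp_formAct (h : IsSuperbialgebra ℬ) {E : Comat ℬ} (hE : E.Generates)
    (φ : B →ₗ[K] K) : counit (R := K) ∘ₗ formAct ℬ φ = φ := by
  refine hE.linearMap_ext h fun n y y' => ?_
  rw [LinearMap.comp_apply, formAct_comat]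
  simp [Comat.counit_t, zmod2_add_self, sgn_zero]

theorem formAct_mem (h : IsSuperbialgebra ℬ) {E : Comat ℬ} (hE : E.Generates) (φ : B →ₗ[K] K) :
    formAct ℬ φ ∈ formActAlg h hE := by
  change formAct ℬ φ = formAct ℬ (counit (R := K) ∘ₗ formAct ℬ φ)
  rw [counit_comp_formAct h hE]

end Action

theorem sum_rot {X Y Z M : Type*} [Fintype X] [Fintype Y] [Fintype Z] [AddCommMonoid M]
    (f : X → Y → Z → M) : ∑ a, ∑ b, ∑ c, f a b c = ∑ b, ∑ c, ∑ a, f a b c := by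
  rw [Finset.sum_comm]
  exact Finset.sum_congr rfl fun b _ => Finset.sum_comm

/-! ### The anti-representation of U^-(R) defined by R, and RTT relations for its matrix
coefficients -/

namespace OspDatum

variable {N : ℕ} (D : OspDatum N)

/-- S is lower triangular in the second factor, as it is upper triangular in the first. This is what
lets the matrices attached to l^-_kl vanish for k < l. -/
theorem weights_S_eq_zero {k l : Fin N} (h : k < l) (i j : Fin N) : D.weights.S i k j l = 0 := by
  have h1 : ¬(j = i ∧ l = k) := by rintro ⟨-, rfl⟩; exact lt_irrefl _ h
  have h2 : ¬(i < j ∧ k = j ∧ l = i) := by rintro ⟨h1, rfl, rfl⟩; exact lt_asymm h h1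
  have h3 : ¬(i < j ∧ k = i.rev ∧ l = j.rev) := by
    rintro ⟨h3, rfl, rfl⟩; exact lt_asymm h (Fin.rev_lt_rev.2 h3)
  simp [VertexWeights.S, h1, h2, h3]

/-- The matrix by which `l^-_kl` acts in the representation of `U^-(R)` given by `R`. -/
def minusMat (k l : Fin N) : Matrix (Fin N) (Fin N) Kq := Matrix.of fun i j =>
  sgn Kq (D.par k * (D.par l + 1 + D.par j)) * (q⁻¹ * D.weights.S i k j l)

theorem bos_minusMat_apply (k m l n i j : Fin N) :
    (D.bos (fun k l => MulOpposite.op (D.minusMat k l))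
      (fun k l => MulOpposite.op (D.minusMat k l)) k m l n).unop i j =
    sgn Kq (D.par j * (D.par k + D.par m)) *
      (q⁻¹ * q⁻¹ * ∑ c, D.weights.S i m c n * D.weights.S c k j l) := by
  rw [bos, ← MulOpposite.op_mul, ← MulOpposite.op_smul, MulOpposite.unop_op, Matrix.smul_apply,
    Matrix.mul_apply, smul_eq_mul, Finset.mul_sum, Finset.mul_sum, Finset.mul_sum]
  refine Finset.sum_congr rfl fun c _ => ?_
  simp only [minusMat, Matrix.of_apply]
  by_cases h1 : D.weights.S i m c n = 0
  · simp [h1]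
  by_cases h2 : D.weights.S c k j l = 0
  · simp [h2]
  have h1 := D.weights_even h1
  have h2 := D.weights_even h2
  have e : D.par m * (D.par k + D.par l) + D.par k * (D.par l + 1) + D.par m * (D.par n + 1) +
      D.par m * (D.par n + 1 + D.par c) + D.par k * (D.par l + 1 + D.par j) =
      D.par j * (D.par k + D.par m) := by
    generalize D.par i = x₁ at *; generalize D.par j = x₂ at *; generalize D.par k = x₃ at *
    generalize D.par l = x₄ at *; generalize D.par m = x₅ at *; generalize D.par n = x₆ at *
    generalize D.par c = x₇ at *
    revert h1 h2; revert x₁ x₂ x₃ x₄ x₅ x₆ x₇; decide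
  have e' := congrArg (sgn Kq) e
  rw [sgn_add, sgn_add] at e'
  linear_combination (q⁻¹ * q⁻¹ * D.weights.S i m c n * D.weights.S c k j l) * e'

/-- The anti-representation of `U^-(R)` given by `R`. -/
def minusHom : UHalf D false →ₐ[Kq] (Matrix (Fin N) (Fin N) Kq)ᵐᵒᵖ :=
  UHalf.lift (fun k l => MulOpposite.op (D.minusMat k l))
    (fun k l h => by
      rw [MulOpposite.op_eq_zero_iff]
      ext i j
      simp [minusMat, D.weights_S_eq_zero (not_le.1 h)])
    (fun k l m n => by
      rw [rll_iff]
      apply MulOpposite.unop_injective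
      ext i j
      simp only [Finset.unop_sum, MulOpposite.unop_smul, Matrix.sum_apply,
        Matrix.smul_apply, bos_minusMat_apply, smul_eq_mul]
      have h1 : ∑ a, ∑ b, D.weights.S k m a b * (sgn Kq (D.par j * (D.par a + D.par b)) *
          (q⁻¹ * q⁻¹ * ∑ c, D.weights.S i b c n * D.weights.S c a j l)) =
          sgn Kq (D.par j * (D.par k + D.par m)) * (q⁻¹ * q⁻¹ *
            ∑ b, ∑ c, ∑ a, D.weights.S k m b c * D.weights.S i c a n * D.weights.S a b j l) := by
        simp only [Finset.mul_sum]
        refine Finset.sum_congr rfl fun a _ => Finset.sum_congr rfl fun b _ =>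
          Finset.sum_congr rfl fun c _ => ?_
        by_cases h : D.weights.S k m a b = 0
        · simp [h]
        have h := D.weights_even h
        have e : D.par a + D.par b = D.par k + D.par m := by
          generalize D.par a = x₁ at *; generalize D.par b = x₂ at *
          generalize D.par k = x₃ at *; generalize D.par m = x₄ at *
          revert h; revert x₁ x₂ x₃ x₄; decide
        rw [e]; ring
      have h2 : ∑ a, ∑ b, D.weights.S a b l n * (sgn Kq (D.par j * (D.par m + D.par k)) *
          (q⁻¹ * q⁻¹ * ∑ c, D.weights.S i k c a * D.weights.S c m j b)) =
          sgn Kq (D.par j * (D.par k + D.par m)) * (q⁻¹ * q⁻¹ *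
            ∑ b, ∑ c, ∑ a, D.weights.S i k a b * D.weights.S a m j c * D.weights.S b c l n) := by
        simp only [Finset.mul_sum, add_comm (D.par m)]
        refine Finset.sum_congr rfl fun a _ => Finset.sum_congr rfl fun b _ =>
          Finset.sum_congr rfl fun c _ => ?_
        ring
      rw [h1, h2]
      congr 2
      -- Once the signs are pulled out, the RLL relation for the representing matrices is the
      -- Yang–Baxter equation with the summations cyclically rearranged.
      have := D.weights.yangBaxterAt i j k m l n
      exact (sum_rot _).symm.trans (this.symm.trans (sum_rot _)))

/-- The pairing with `t_ij ∈ U^+(R)` as a linear form on `U^-(R)`. -/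
def minusForm (i j : Fin N) : UHalf D false →ₗ[Kq] Kq :=
  Matrix.entryLinearMap Kq Kq i j ∘ₗ (MulOpposite.opLinearEquiv Kq).symm.toLinearMap ∘ₗ
    D.minusHom.toLinearMap

theorem minusForm_one (i j : Fin N) : D.minusForm i j 1 = if i = j then 1 else 0 := by
  simp [minusForm, Matrix.one_apply]

theorem minusForm_mul (i j : Fin N) (b b' : UHalf D false) :
    D.minusForm i j (b * b') = ∑ a, D.minusForm i a b' * D.minusForm a j b := by
  simp [minusForm, Matrix.mul_apply]

theorem minusForm_gen (i j k l : Fin N) : D.minusForm i j (UHalf.gen D false k l) =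
    sgn Kq (D.par k * (D.par l + 1 + D.par j)) * (q⁻¹ * D.weights.S i k j l) := by
  simp only [minusForm, LinearMap.comp_apply, AlgHom.toLinearMap_apply, minusHom, UHalf.lift_gen]
  rfl

theorem minusForm_genComat (i j k l : Fin N) : D.minusForm i j ((UHalf.genComat D false).t k l) =
    sgn Kq (D.par j * D.par k) * (q⁻¹ * D.weights.S i k j l) := by
  simp only [UHalf.genComat, map_smul, minusForm_gen, smul_eq_mul]
  rw [← mul_assoc, ← sgn_add]
  congr 2
  generalize D.par k = a; generalize D.par j = b; generalize D.par l = c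
  revert a b c; decide

/-- The elements represented by triangular matrices form a subalgebra, and it contains the
generators because S is triangular in the first factor. The forms attached to l^+_ij with i > j
therefore vanish, as U^+(R) requires. -/
theorem minusForm_eq_zero {i j : Fin N} (h : j < i) : D.minusForm i j = 0 := by
  let M : Subalgebra Kq (UHalf D false) :=
    { carrier := {b | ∀ i j, j < i → D.minusForm i j b = 0}
      mul_mem' := fun {b b'} hb hb' i j hij => by
        rw [minusForm_mul]
        refine Finset.sum_eq_zero fun a _ => ?_
        rcases lt_or_ge a i with ha | ha
        · rw [hb' i a ha, zero_mul]
        · rw [hb a j (hij.trans_le ha), mul_zero]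
      add_mem' := fun {b b'} hb hb' i j hij => by rw [map_add, hb i j hij, hb' i j hij, add_zero]
      algebraMap_mem' := fun r i j hij => by
        rw [Algebra.algebraMap_eq_smul_one, map_smul, minusForm_one, if_neg hij.ne', smul_zero] }
  have hM : M = ⊤ := UHalf.subalgebra_eq_top D false M fun k l i j hij => by
    rw [minusForm_gen, D.weights.S_eq_zero hij, mul_zero, mul_zero]
  ext b
  have hb : b ∈ M := by rw [hM]; trivial
  exact hb i j h

theorem minusForm_parity (i j : Fin N) (b : UHalf D false) :
    D.minusForm i j (UHalf.parity D false b) =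
      sgn Kq (D.par i + D.par j) * D.minusForm i j b := by
  let M : Subalgebra Kq (UHalf D false) :=
    { carrier := {b | ∀ i j, D.minusForm i j (UHalf.parity D false b) =
        sgn Kq (D.par i + D.par j) * D.minusForm i j b}
      mul_mem' := fun {b b'} hb hb' i j => by
        rw [map_mul, minusForm_mul, minusForm_mul, Finset.mul_sum]
        refine Finset.sum_congr rfl fun a _ => ?_
        rw [hb a j, hb' i a]
        simp only [sgn_add]
        linear_combination (sgn Kq (D.par i) * sgn Kq (D.par j) * D.minusForm i a b' *
          D.minusForm a j b) * sgn_mul_self (K := Kq) (D.par a)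
      add_mem' := fun {b b'} hb hb' i j => by simp only [map_add, hb i j, hb' i j, mul_add]
      algebraMap_mem' := fun r i j => by
        rw [AlgHom.commutes, Algebra.algebraMap_eq_smul_one, map_smul, minusForm_one]
        split_ifs with h
        · subst h; simp [zmod2_add_self, sgn_zero]
        · simp }
  have hM : M = ⊤ := UHalf.subalgebra_eq_top D false M fun k l i j => by
    rw [UHalf.parity_gen, map_smul, minusForm_gen, smul_eq_mul]
    by_cases h : D.weights.S i k j l = 0
    · simp [h]
    have h := D.weights_even h
    have e : D.par k + D.par l = D.par i + D.par j := by
      generalize D.par i = x₁ at *; generalize D.par j = x₂ at *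
      generalize D.par k = x₃ at *; generalize D.par l = x₄ at *
      revert h; revert x₁ x₂ x₃ x₄; decide
    rw [e]
  have hb : b ∈ M := by rw [hM]; trivial
  exact hb i j

theorem minusForm_even {i j : Fin N} (E : Comat (UHalf.grading D false)) {y y' : E.X}
    (h : D.par i + D.par j ≠ E.p y + E.p y') : D.minusForm i j (E.t y y') = 0 := by
  have h1 := D.minusForm_parity i j (E.t y y')
  rw [(mem_parityGrading.1 (E.mem y y') : UHalf.parity D false _ = _), map_smul, smul_eq_mul,
    ← sub_eq_zero, ← sub_mul] at h1
  refine (mul_eq_zero.1 h1).resolve_left fun h2 => h ?_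
  generalize D.par i + D.par j = a at *
  generalize E.p y + E.p y' = b at *
  have h3 : (2 : Kq) ≠ 0 := two_ne_zero
  rcases zmod2_cases a with rfl | rfl <;> rcases zmod2_cases b with rfl | rfl <;>
    simp only [sgn_zero, sgn_one] at h2 <;> first | rfl | (exfalso; apply h3; linear_combination h2) | (exfalso; apply h3; linear_combination -h2)

/-- The matrix of the pairing of the generating matrix of `U^+(R)` with a comatrix. -/
def minusPair (E : Comat (UHalf.grading D false)) (i : Fin N) (y : E.X) (j : Fin N) (y' : E.X) :
    Kq :=
  sgn Kq (D.par j * E.p y) * D.minusForm i j (E.t y y')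

/-- The anti-multiplicativity of the matrix coefficients, in sign-free form. The order of the
factors is that of Δ^op, so this is the second multiplicativity axiom for the generators of U^+(R).
-/
theorem minusPair_mul (E E' : Comat (UHalf.grading D false)) (i : Fin N) (y : E.X) (s : E'.X)
    (j : Fin N) (y' : E.X) (s' : E'.X) :
    D.minusPair (Comat.mul (UHalf.isSuperbialgebra D false) E E') i (y, s) j (y', s') =
      ∑ a, D.minusPair E' i s a s' * D.minusPair E a y j y' := by
  simp only [minusPair, Comat.mul, map_smul, minusForm_mul, Finset.smul_sum, Finset.mul_sum,
    smul_eq_mul]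
  refine Finset.sum_congr rfl fun a _ => ?_
  by_cases h : D.par a + D.par j = E.p y + E.p y'
  · rw [← h]
    simp only [← mul_assoc, ← sgn_add]
    have e : D.par j * (E.p y + E'.p s) + E'.p s * (D.par a + D.par j) =
      D.par a * E'.p s + D.par j * E.p y := by
      generalize D.par a = x₁; generalize D.par j = x₂; generalize E.p y = x₃
      generalize E'.p s = x₄
      revert x₁ x₂ x₃ x₄; decide
    rw [e, sgn_add]; ring
  · rw [D.minusForm_even E h]; ring

/-- The relation `S_12 T_13 T_23 = T_23 T_13 S_12` for a matrix `T`. -/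
def RTTOn {Y : Type*} [Fintype Y] (T : Fin N → Y → Fin N → Y → Kq) : Prop :=
  ∀ i k j l c d, ∑ a, ∑ b, D.weights.S i k a b * ∑ e, T a c j e * T b e l d =
    ∑ a, ∑ b, D.weights.S a b j l * ∑ e, T k c b e * T i e a d

/-- The train argument: S is carried first past the factors U and then past the factors T, once the
finite sums have been reordered. -/
theorem RTTOn.mul {Y Z : Type*} [Fintype Y] [Fintype Z] {T : Fin N → Y → Fin N → Y → Kq}
    {U : Fin N → Z → Fin N → Z → Kq} (hT : D.RTTOn T) (hU : D.RTTOn U) :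
    D.RTTOn (Y := Y × Z) fun i y j y' => ∑ a, U i y.2 a y'.2 * T a y.1 j y'.1 := by
  intro i k j l c d
  calc _ = ∑ p, ∑ r, ∑ e, (T p c.1 j e * T r e l d.1) *
      (∑ a, ∑ b, D.weights.S i k a b * ∑ f, U a c.2 p f * U b f r d.2) := by
        simp only [Finset.mul_sum, Finset.sum_mul, Fintype.sum_prod_type]
        simp only [← Finset.sum_product', Finset.univ_product_univ]
        exact Fintype.sum_equiv ⟨fun (a, b, e, f, r, p) => (p, r, e, a, b, f), fun (p, r, e, a, b, f) => (a, b, e, f, r, p),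
          fun _ => rfl, fun _ => rfl⟩ _ _ fun _ => by dsimp only [Equiv.coe_fn_mk]; ring
    _ = ∑ a, ∑ b, ∑ f, (U k c.2 b f * U i f a d.2) *
      (∑ p, ∑ r, D.weights.S a b p r * ∑ e, T p c.1 j e * T r e l d.1) := by
        simp only [hU i k _ _ c.2 d.2]
        simp only [Finset.mul_sum, Finset.sum_mul, Fintype.sum_prod_type]
        simp only [← Finset.sum_product', Finset.univ_product_univ]
        exact Fintype.sum_equiv ⟨fun (p, r, e, a, b, f) => (a, b, f, p, r, e), fun (a, b, f, p, r, e) => (p, r, e, a, b, f),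
          fun _ => rfl, fun _ => rfl⟩ _ _ fun _ => by dsimp only [Equiv.coe_fn_mk]; ring
    _ = _ := by
        simp only [hT _ _ j l c.1 d.1]
        simp only [Finset.mul_sum, Finset.sum_mul, Fintype.sum_prod_type]
        simp only [← Finset.sum_product', Finset.univ_product_univ]
        exact Fintype.sum_equiv ⟨fun (a, b, f, p, r, e) => (p, r, e, f, a, b), fun (p, r, e, f, a, b) => (a, b, f, p, r, e),
          fun _ => rfl, fun _ => rfl⟩ _ _ fun _ => by dsimp only [Equiv.coe_fn_mk]; ring

theorem minusPair_genComat : D.minusPair (UHalf.genComat D false) =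
    fun (i k j l : Fin N) => q⁻¹ * D.weights.S i k j l := by
  funext i k j l
  change sgn Kq (D.par j * D.par k) * D.minusForm i j _ = _
  refine (congrArg _ (D.minusForm_genComat i j k l)).trans ?_
  exact (mul_assoc _ _ _).symm.trans ((congrArg (· * _) (sgn_mul_self _)).trans (one_mul _))

/-- On the generating comatrix the pairing matrix is q⁻¹ S, so the relation is Yang–Baxter once
more. -/
theorem rttOn_minusPair_genComat : D.RTTOn (D.minusPair (UHalf.genComat D false)) := by
  rw [minusPair_genComat]
  intro i k j l (c : Fin N) (d : Fin N)
  change ∑ a, ∑ b, D.weights.S i k a b * ∑ e : Fin N, q⁻¹ * D.weights.S a c j e *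
    (q⁻¹ * D.weights.S b e l d) = ∑ a, ∑ b, D.weights.S a b j l * ∑ e : Fin N,
      q⁻¹ * D.weights.S k c b e * (q⁻¹ * D.weights.S i e a d)
  have h := congrArg (fun x => q⁻¹ * q⁻¹ * x) (D.weights.yangBaxterAt i j k c l d)
  simp only [Finset.mul_sum] at h ⊢
  refine Eq.trans ?_ (h.trans ?_)
  · refine Finset.sum_congr rfl fun a _ => Finset.sum_congr rfl fun b _ =>
      Finset.sum_congr rfl fun e _ => ?_
    ring
  · refine Finset.sum_congr rfl fun a _ => Finset.sum_congr rfl fun b _ =>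
      Finset.sum_congr rfl fun e _ => ?_
    ring

theorem rttOn_minusPair (n : ℕ) : D.RTTOn (D.minusPair (Comat.pow (UHalf.isSuperbialgebra D false)
    (UHalf.genComat D false) n)) := by
  induction n with
  | zero =>
    intro i k j l c d
    have h1 (i c j d) : D.minusPair (Comat.pow (UHalf.isSuperbialgebra D false)
        (UHalf.genComat D false) 0) i c j d = if i = j then 1 else 0 := by
      change sgn Kq (D.par j * 0) * D.minusForm i j 1 = _
      rw [minusForm_one, mul_zero, sgn_zero, one_mul]
    simp only [h1, Finset.sum_const]
    change ∑ a, ∑ b, _ * (1 • _) = ∑ a, ∑ b, _ * (1 • _)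
    simp
  | succ n ih =>
    have h1 := RTTOn.mul D (D.rttOn_minusPair_genComat) ih
    have h2 : D.minusPair (Comat.mul (UHalf.isSuperbialgebra D false) (UHalf.genComat D false)
        (Comat.pow (UHalf.isSuperbialgebra D false) (UHalf.genComat D false) n)) = _ :=
      funext fun i => funext fun y => funext fun j => funext fun y' =>
        D.minusPair_mul (UHalf.genComat D false)
          (Comat.pow (UHalf.isSuperbialgebra D false) (UHalf.genComat D false) n) i y.1 y.2 j y'.1 y'.2
    change D.RTTOn (D.minusPair (Comat.mul _ _ _))
    rw [h2]
    exact h1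

end OspDatum

/-! ### Extending the skew-pairing axioms from generators to the whole algebra -/

section Comatrices

variable {K : Type*} [Field K] {A : Type*} [Ring A] [Algebra K A]
  {𝒜 : ZMod 2 → Submodule K A} [GradedAlgebra 𝒜] [CoalgebraStruct K A]
  {B : Type*} [Ring B] [Algebra K B] {ℬ : ZMod 2 → Submodule K B} [GradedAlgebra ℬ]
  [CoalgebraStruct K B]

namespace Comat

/-- Both axioms are matrix factorisations, one in each argument. Splitting the product comatrix on
the left, then both products on the right, and reordering commuting scalars shows that the second
axiom passes to products in the first argument. -/
theorem mulRightOn_mul (h : IsSuperbialgebra 𝒜) (h' : IsSuperbialgebra ℬ)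
    {σ : A ⊗[K] B →ₗ[K] K} {C C' : Comat 𝒜} {E E' : Comat ℬ}
    (hl1 : MulLeftOn h σ C C' E) (hl2 : MulLeftOn h σ C C' E')
    (hl : MulLeftOn h σ C C' (mul h' E E'))
    (hr : MulRightOn h' σ C E E') (hr' : MulRightOn h' σ C' E E') :
    MulRightOn h' σ (mul h C C') E E' := by
  rintro ⟨x, z⟩ y s ⟨x', z'⟩ y' s'
  calc _ = ∑ b, ∑ d, (∑ a, pairMat σ C E' x s a d * pairMat σ C E a y x' b) *
        (∑ e, pairMat σ C' E' z d e s' * pairMat σ C' E e b z' y') := by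
        rw [hl x z (y, s) x' z' (y', s')]
        refine (Fintype.sum_prod_type _).trans ?_
        refine Finset.sum_congr rfl fun b _ => Finset.sum_congr rfl fun d _ => ?_
        rw [hr, hr']
    _ = ∑ a, ∑ e, (∑ d, pairMat σ C E' x s a d * pairMat σ C' E' z d e s') *
        (∑ b, pairMat σ C E a y x' b * pairMat σ C' E e b z' y') := by
        simp only [Finset.mul_sum, Finset.sum_mul]
        simp only [← Finset.sum_product', Finset.univ_product_univ]
        exact Fintype.sum_equiv ⟨fun (b, d, e, a) => (a, e, b, d), fun (a, e, b, d) => (b, d, e, a),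
          fun _ => rfl, fun _ => rfl⟩ _ _ fun _ => by dsimp only [Equiv.coe_fn_mk]; ring
    _ = _ := by
        refine Eq.trans ?_ (Fintype.sum_prod_type _).symm
        refine Finset.sum_congr rfl fun a _ => Finset.sum_congr rfl fun e _ => ?_
        rw [hl1, hl2]

theorem mulRightOn_pow (h : IsSuperbialgebra 𝒜) (h' : IsSuperbialgebra ℬ)
    {σ : A ⊗[K] B →ₗ[K] K} (C : Comat 𝒜) {E E' : Comat ℬ}
    (h1 : ∀ b : B, σ (1 ⊗ₜ b) = counit (R := K) b) (hl : ∀ n (E : Comat ℬ), MulLeftOn h σ C (pow h C n) E)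
    (hr : MulRightOn h' σ C E E') (n : ℕ) : MulRightOn h' σ (pow h C n) E E' := by
  induction n with
  | zero =>
    intro x y s x' y' s'
    have key (E : Comat ℬ) (x x' : Unit) (y y' : E.X) : pairMat σ (pow h C 0) E x y x' y' =
        if y = y' then 1 else 0 := pairMat_one_left h h1 E x x' y y'
    refine (key (mul h' E E') x x' (y, s) (y', s')).trans ?_
    refine Eq.trans ?_ (Fintype.sum_unique fun a : Unit =>
      pairMat σ (pow h C 0) E' x s a s' * pairMat σ (pow h C 0) E a y x' y').symm
    refine Eq.trans ?_ (congrArg₂ (· * ·) (key E' x () s s') (key E () x' y y')).symm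
    change (if (y, s) = ((y', s') : E.X × E'.X) then (1 : K) else 0) = _
    by_cases e1 : y = y' <;> by_cases e2 : s = s' <;> simp [e1, e2]
  | succ n ih => exact mulRightOn_mul h h' (hl n _) (hl n _) (hl n _) hr ih

theorem mul_right_of_mulRightOn (h : IsSuperbialgebra 𝒜) (h' : IsSuperbialgebra ℬ)
    {σ : A ⊗[K] B →ₗ[K] K} (he : IsEvenPairing 𝒜 ℬ σ) {C : Comat 𝒜} (hC : C.Generates)
    {E : Comat ℬ} (hE : E.Generates)
    (hr : ∀ n m m', MulRightOn h' σ (pow h C n) (pow h' E m) (pow h' E m')) (a : A) (b b' : B) :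
    σ (a ⊗ₜ (b * b')) = pairing₂ 𝒜 ℬ σ (braid 𝒜 𝒜 (comul (R := K) a) ⊗ₜ (b ⊗ₜ b')) := by
  let f : A ⊗[K] (B ⊗[K] B) →ₗ[K] K := σ ∘ₗ LinearMap.lTensor A (LinearMap.mul' K B)
  let g : A ⊗[K] (B ⊗[K] B) →ₗ[K] K := pairing₂ 𝒜 ℬ σ ∘ₗ
    LinearMap.rTensor (B ⊗[K] B) (braid 𝒜 𝒜 ∘ₗ comul (R := K))
  have hfg : f = g := by
    refine TensorProduct.ext (hC.linearMap_ext h fun n x x' => ?_)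
    refine hE.tensor_ext h' hE h' fun m m' y y' s s' => ?_
    exact (mulRightOn_iff h' (evenOn_of_isEvenPairing he _ _)).1 (hr n m m') x x' y y' s s'
  exact LinearMap.congr_fun hfg (a ⊗ₜ (b ⊗ₜ b'))

/-- Both sides are linear in the second factor a' and in b, so comatrix entries suffice there; a may
stay arbitrary. -/
theorem mul_left_of_comat (h : IsSuperbialgebra 𝒜) (h' : IsSuperbialgebra ℬ)
    {σ : A ⊗[K] B →ₗ[K] K} {C : Comat 𝒜} (hC : C.Generates)
    {E : Comat ℬ} (hE : E.Generates)
    (hl : ∀ a n m x x' y y', σ ((a * (pow h C n).t x x') ⊗ₜ (pow h' E m).t y y') =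
      pairing₂ 𝒜 ℬ σ ((a ⊗ₜ (pow h C n).t x x') ⊗ₜ comul (R := K) ((pow h' E m).t y y')))
    (a a' : A) (b : B) :
    σ ((a * a') ⊗ₜ b) = pairing₂ 𝒜 ℬ σ ((a ⊗ₜ a') ⊗ₜ comul (R := K) b) := by
  let f : A ⊗[K] B →ₗ[K] K := σ ∘ₗ LinearMap.rTensor B (LinearMap.mulLeft K a)
  let g : A ⊗[K] B →ₗ[K] K := pairing₂ 𝒜 ℬ σ ∘ₗ
    TensorProduct.map (TensorProduct.mk K A A a) (comul (R := K))
  have hfg : f = g := hC.tensor_ext h hE h' fun n m x x' y y' => hl a n m x x' y y'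
  exact LinearMap.congr_fun hfg (a' ⊗ₜ b)

end Comat

end Comatrices

/-! ### The action of U^+(R) on U^-(R) and the skew-pairing -/

namespace OspDatum

variable {N : ℕ} (D : OspDatum N)

/-- The operator on `U^-(R)` by which `l^+_ij` acts. -/
def plusOp (i j : Fin N) : Module.End Kq (UHalf D false) :=
  sgn Kq (D.par i * (D.par j + 1)) • formAct (UHalf.grading D false) (D.minusForm i j)

/-- On a comatrix the composite of two of these operators is given by the product of the
corresponding pairing matrices, up to a sign depending on j and l only through |j| + |l|. That makes
the RLL relation of the operators comparable with `RTTOn`. -/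
theorem bos_plusOp_apply (E : Comat (UHalf.grading D false)) (i k j l : Fin N) (y y' : E.X) :
    D.bos D.plusOp D.plusOp i k j l (E.t y y') = ∑ c, (sgn Kq ((E.p y + E.p c) *
      (E.p c + E.p y') + E.p c * (D.par j + D.par l)) *
        ∑ b, D.minusPair E i c j b * D.minusPair E k b l y') • E.t y c := by
  have h1 : D.bos D.plusOp D.plusOp i k j l = sgn Kq (D.par k * (D.par i + D.par j)) •
      (formAct (UHalf.grading D false) (D.minusForm i j) *
        formAct (UHalf.grading D false) (D.minusForm k l)) := by
    rw [bos, plusOp, plusOp, smul_mul_smul_comm, smul_smul]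
    congr 1
    rw [sgn_add, sgn_add]
    linear_combination (sgn Kq (D.par k * (D.par i + D.par j)) *
      sgn Kq (D.par k * (D.par l + 1)) * sgn Kq (D.par k * (D.par l + 1))) *
      sgn_mul_self (K := Kq) (D.par i * (D.par j + 1)) +
      sgn Kq (D.par k * (D.par i + D.par j)) * sgn_mul_self (K := Kq) (D.par k * (D.par l + 1))
  rw [h1, LinearMap.smul_apply, Module.End.mul_apply, formAct_comat]
  simp only [map_sum, map_smul, formAct_comat, Finset.smul_sum, smul_smul, Finset.mul_sum,
    Finset.sum_smul]
  rw [Finset.sum_comm]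
  refine Finset.sum_congr rfl fun c _ => Finset.sum_congr rfl fun b _ => ?_
  congr 1
  simp only [minusPair]
  by_cases e1 : D.par i + D.par j = E.p c + E.p b
  · by_cases e2 : D.par k + D.par l = E.p b + E.p y'
    · have e : D.par k * (D.par i + D.par j) + (E.p y + E.p b) * (E.p b + E.p y') +
          (E.p y + E.p c) * (E.p c + E.p b) = (E.p y + E.p c) *
          (E.p c + E.p y') + E.p c * (D.par j + D.par l) + D.par j * E.p c + D.par l * E.p b := by
        generalize D.par i = x₁ at *; generalize D.par j = x₂ at *; generalize D.par k = x₃ at *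
        generalize D.par l = x₄ at *; generalize E.p y = x₅ at *; generalize E.p c = x₆ at *
        generalize E.p b = x₇ at *; generalize E.p y' = x₈ at *
        clear h1
        revert e1 e2; revert x₁ x₂ x₃ x₄ x₅ x₆ x₇ x₈; decide
      have e' := congrArg (sgn Kq) e
      rw [sgn_add, sgn_add, sgn_add _ (D.par l * E.p b), sgn_add _ (D.par j * E.p c)] at e'
      linear_combination (D.minusForm i j (E.t c b) * D.minusForm k l (E.t b y')) * e'
    · rw [D.minusForm_even E e2]; ring
  · rw [D.minusForm_even E e1]; ring

/-- On entries of each power of the generating comatrix this is the RTT relation for the pairing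
matrices. The remaining sign is common to both sides because S preserves the total parity of its
indices. -/
theorem rll_plusOp (i j k l : Fin N) :
    rllLeft D D.plusOp D.plusOp i j k l = rllRight D D.plusOp D.plusOp i j k l := by
  rw [rll_iff]
  refine (UHalf.generates_genComat D false).linearMap_ext (UHalf.isSuperbialgebra D false)
    fun n y y' => ?_
  have hT := D.rttOn_minusPair n
  generalize Comat.pow (UHalf.isSuperbialgebra D false) (UHalf.genComat D false) n = E at *
  simp only [LinearMap.sum_apply, LinearMap.smul_apply, bos_plusOp_apply, Finset.smul_sum,
    smul_smul]
  have e1 : ∑ a, ∑ b, ∑ c, (D.weights.S i k a b * (sgn Kq ((E.p y + E.p c) *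
      (E.p c + E.p y') + E.p c * (D.par j + D.par l)) *
        ∑ e, D.minusPair E a c j e * D.minusPair E b e l y')) • E.t y c =
      ∑ c, (sgn Kq ((E.p y + E.p c) * (E.p c + E.p y') + E.p c * (D.par j + D.par l)) *
        ∑ a, ∑ b, D.weights.S i k a b * ∑ e, D.minusPair E a c j e * D.minusPair E b e l y') •
          E.t y c := by
    rw [← sum_rot]
    refine Finset.sum_congr rfl fun c _ => ?_
    rw [Finset.mul_sum, Finset.sum_smul]
    refine Finset.sum_congr rfl fun a _ => ?_
    rw [Finset.mul_sum, Finset.sum_smul]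
    refine Finset.sum_congr rfl fun b _ => ?_
    congr 1; ring
  have e2 : ∑ a, ∑ b, ∑ c, (D.weights.S a b j l * (sgn Kq ((E.p y + E.p c) *
      (E.p c + E.p y') + E.p c * (D.par b + D.par a)) *
        ∑ e, D.minusPair E k c b e * D.minusPair E i e a y')) • E.t y c =
      ∑ c, (sgn Kq ((E.p y + E.p c) * (E.p c + E.p y') + E.p c * (D.par j + D.par l)) *
        ∑ a, ∑ b, D.weights.S a b j l * ∑ e, D.minusPair E k c b e * D.minusPair E i e a y') •
          E.t y c := by
    rw [← sum_rot]
    refine Finset.sum_congr rfl fun c _ => ?_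
    rw [Finset.mul_sum, Finset.sum_smul]
    refine Finset.sum_congr rfl fun a _ => ?_
    rw [Finset.mul_sum, Finset.sum_smul]
    refine Finset.sum_congr rfl fun b _ => ?_
    by_cases h : D.weights.S a b j l = 0
    · simp [h]
    have h := D.weights_even h
    have e : D.par b + D.par a = D.par j + D.par l := by
      generalize D.par a = x₁ at *; generalize D.par b = x₂ at *
      generalize D.par j = x₃ at *; generalize D.par l = x₄ at *
      clear e1 hT
      revert h; revert x₁ x₂ x₃ x₄; decide
    rw [e]
    congr 1; ring
  rw [e1, e2]
  refine Finset.sum_congr rfl fun c _ => ?_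
  rw [hT i k j l c y']

/-- The action of `U^+(R)` on `U^-(R)`. -/
def plusHom : UHalf D true →ₐ[Kq] Module.End Kq (UHalf D false) :=
  UHalf.lift D.plusOp (fun i j h => by
    rw [plusOp, D.minusForm_eq_zero (not_le.1 h)]
    simp [formAct]) D.rll_plusOp

theorem plusHom_genComat (i j : Fin N) : D.plusHom ((UHalf.genComat D true).t i j) =
    formAct (UHalf.grading D false) (D.minusForm i j) := by
  simp only [UHalf.genComat, map_smul, plusHom, UHalf.lift_gen, plusOp, smul_smul, sgn_mul_self,
    one_smul]

/-- The skew-pairing of `U^+(R)` and `U^-(R)` given by `R`. -/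
def rPairing : UHalf D true ⊗[Kq] UHalf D false →ₗ[Kq] Kq :=
  TensorProduct.lift (D.plusHom.toLinearMap.compr₂ (counit (R := Kq)))

theorem rPairing_tmul (a : UHalf D true) (b : UHalf D false) :
    D.rPairing (a ⊗ₜ b) = counit (R := Kq) (D.plusHom a b) := rfl

theorem rPairing_genComat (i j : Fin N) (b : UHalf D false) :
    D.rPairing ((UHalf.genComat D true).t i j ⊗ₜ b) = D.minusForm i j b := by
  rw [rPairing_tmul, plusHom_genComat]
  exact LinearMap.congr_fun (counit_comp_formAct (UHalf.isSuperbialgebra D false)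
    (UHalf.generates_genComat D false) _) b

/-- Operators given by linear forms constitute a subalgebra that contains the images of the
generators. Hence the whole action of a is recovered from the form b ↦ (a, b). -/
theorem plusHom_eq_formAct (a : UHalf D true) : D.plusHom a =
    formAct (UHalf.grading D false) (counit (R := Kq) ∘ₗ D.plusHom a) := by
  let M := (formActAlg (UHalf.isSuperbialgebra D false)
    (UHalf.generates_genComat D false)).comap D.plusHom
  have hM : M = ⊤ := UHalf.subalgebra_eq_top D true M fun i j => by
    rw [UHalf.gen_eq]
    refine Subalgebra.smul_mem _ ?_ _
    rw [Subalgebra.mem_comap, plusHom_genComat]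
    exact formAct_mem _ _ _
  have ha : a ∈ M := by rw [hM]; trivial
  exact ha

theorem plusHom_comat (a : UHalf D true) (E : Comat (UHalf.grading D false)) (y y' : E.X) :
    D.plusHom a (E.t y y') = ∑ b, (sgn Kq ((E.p y + E.p b) * (E.p b + E.p y')) *
      D.rPairing (a ⊗ₜ E.t b y')) • E.t y b := by
  rw [plusHom_eq_formAct, formAct_comat]
  rfl

end OspDatum

/-- On homogeneous elements of different parity the compatibility forces a value to equal its own
negative; this uses 2 ≠ 0. -/
theorem isEvenPairing_of_parity {K : Type*} [Field K] [CharZero K] {A B : Type*} [Ring A]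
    [Algebra K A] [Ring B] [Algebra K B] {θ : A →ₐ[K] A} {η : B →ₐ[K] B} {σ : A ⊗[K] B →ₗ[K] K}
    (h : ∀ a b, σ (θ a ⊗ₜ b) = σ (a ⊗ₜ η b)) :
    IsEvenPairing (parityGrading θ) (parityGrading η) σ := by
  intro i j hij a ha b hb
  have h1 := h a b
  rw [mem_parityGrading.1 ha, mem_parityGrading.1 hb, ← TensorProduct.smul_tmul', map_smul,
    TensorProduct.tmul_smul, map_smul, ← sub_eq_zero, ← sub_smul] at h1
  refine (smul_eq_zero.1 h1).resolve_left fun h2 => hij ?_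
  have h3 : (2 : K) ≠ 0 := two_ne_zero
  rcases zmod2_cases i with rfl | rfl <;> rcases zmod2_cases j with rfl | rfl <;>
    simp only [sgn_zero, sgn_one] at h2
  · rfl
  · exact absurd (by linear_combination h2) h3
  · exact absurd (by linear_combination -h2) h3
  · rfl

namespace OspDatum

variable {N : ℕ} (D : OspDatum N)

/-- The action is a morphism of superspaces: twisting a by the parity is conjugating its operator by
the parity. It suffices to know this for generators, where it follows from evenness of the matrix
coefficients. -/
theorem plusHom_parity (a : UHalf D true) (b : UHalf D false) :
    D.plusHom (UHalf.parity D true a) b =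
      UHalf.parity D false (D.plusHom a (UHalf.parity D false b)) := by
  let M : Subalgebra Kq (UHalf D true) :=
    { carrier := {a | ∀ b, D.plusHom (UHalf.parity D true a) b =
        UHalf.parity D false (D.plusHom a (UHalf.parity D false b))}
      mul_mem' := fun {a a'} ha ha' b => by
        rw [map_mul, map_mul, map_mul, Module.End.mul_apply, ha', ha, UHalf.parity_parity]
        rfl
      add_mem' := fun {a a'} ha ha' b => by
        simp only [map_add, LinearMap.add_apply, ha b, ha' b]
      algebraMap_mem' := fun r b => by
        simp only [AlgHom.commutes, Module.algebraMap_end_apply, map_smul, UHalf.parity_parity] }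
  have hM : M = ⊤ := UHalf.subalgebra_eq_top D true M fun i j => by
    rw [UHalf.gen_eq]
    refine Subalgebra.smul_mem _ (fun b => ?_) _
    have e : UHalf.parity D true ((UHalf.genComat D true).t i j) =
      sgn Kq (D.par i + D.par j) • (UHalf.genComat D true).t i j :=
        mem_parityGrading.1 ((UHalf.genComat D true).mem i j)
    rw [e, map_smul, plusHom_genComat]
    have key : sgn Kq (D.par i + D.par j) •
        formAct (UHalf.grading D false) (D.minusForm i j) =
        (UHalf.parity D false).toLinearMap ∘ₗ formAct (UHalf.grading D false) (D.minusForm i j) ∘ₗ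
          (UHalf.parity D false).toLinearMap := by
      refine (UHalf.generates_genComat D false).linearMap_ext (UHalf.isSuperbialgebra D false)
        fun n y y' => ?_
      generalize Comat.pow (UHalf.isSuperbialgebra D false) (UHalf.genComat D false) n = E at *
      have hp (y y') : UHalf.parity D false (E.t y y') = sgn Kq (E.p y + E.p y') • E.t y y' :=
        mem_parityGrading.1 (E.mem y y')
      simp only [LinearMap.smul_apply, LinearMap.comp_apply, AlgHom.toLinearMap_apply, hp, map_smul,
        formAct_comat, map_sum, Finset.smul_sum, smul_smul]
      refine Finset.sum_congr rfl fun c _ => ?_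
      congr 1
      by_cases h : D.par i + D.par j = E.p c + E.p y'
      · rw [h]
        simp only [sgn_add]
        linear_combination (-sgn Kq (E.p c) * sgn Kq (E.p y') * sgn Kq ((E.p y + E.p c) * (E.p c + E.p y')) * D.minusForm i j (E.t c y')) * sgn_mul_self (K := Kq) (E.p y)
      · rw [D.minusForm_even E h]; ring
    exact LinearMap.congr_fun key b
  have ha : a ∈ M := by rw [hM]; trivial
  exact ha b

theorem counit_parity (s : Bool) (b : UHalf D s) :
    counit (R := Kq) (UHalf.parity D s b) = counit (R := Kq) b := by
  have h : (UHalf.counitHom D s).comp (UHalf.parity D s) = UHalf.counitHom D s :=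
    UHalf.hom_ext fun i j => by
      rw [AlgHom.comp_apply, UHalf.parity_gen, map_smul]
      change _ • counit (R := Kq) (UHalf.gen D s i j) = counit (R := Kq) (UHalf.gen D s i j)
      rw [UHalf.counit_gen]
      split_ifs with h
      · subst h; simp [zmod2_add_self, sgn_zero]
      · simp
  exact DFunLike.congr_fun h b

theorem rPairing_even :
    IsEvenPairing (UHalf.grading D true) (UHalf.grading D false) D.rPairing :=
  isEvenPairing_of_parity fun a b => by
    rw [rPairing_tmul, plusHom_parity, counit_parity, rPairing_tmul]

theorem rPairing_one_left (b : UHalf D false) : D.rPairing (1 ⊗ₜ b) = counit (R := Kq) b := by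
  rw [rPairing_tmul, map_one]; rfl

theorem rPairing_one_right (a : UHalf D true) : D.rPairing (a ⊗ₜ 1) = counit (R := Kq) a := by
  -- The unit spans the trivial representation: this is multiplicative in a, and for the generators
  -- it says that the anti-representation sends 1 to the identity matrix.
  have key : ∀ a, D.plusHom a 1 = counit (R := Kq) a • 1 := by
    let M : Subalgebra Kq (UHalf D true) :=
      { carrier := {a | D.plusHom a 1 = counit (R := Kq) a • 1}
        mul_mem' := fun {a a'} (ha : _ = _) (ha' : _ = _) => by
          change D.plusHom (a * a') 1 = counit (R := Kq) (a * a') • 1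
          rw [map_mul, Module.End.mul_apply, ha', map_smul, ha,
            (UHalf.isSuperbialgebra D true).counit_mul, smul_smul, mul_comm]
        add_mem' := fun {a a'} (ha : _ = _) (ha' : _ = _) => by
          change D.plusHom (a + a') 1 = counit (R := Kq) (a + a') • 1
          rw [map_add, LinearMap.add_apply, ha, ha', map_add, add_smul]
        algebraMap_mem' := fun r => by
          change D.plusHom (algebraMap _ _ r) 1 = counit (R := Kq) (algebraMap _ _ r) • 1
          rw [AlgHom.commutes, Algebra.algebraMap_eq_smul_one (A := UHalf D true), map_smul,
            (UHalf.isSuperbialgebra D true).counit_one, Module.algebraMap_end_apply, smul_eq_mul,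
            mul_one] }
    have hM : M = ⊤ := UHalf.subalgebra_eq_top D true M fun i j => by
      rw [UHalf.gen_eq]
      refine Subalgebra.smul_mem _ ?_ _
      change D.plusHom ((UHalf.genComat D true).t i j) 1 =
        counit (R := Kq) ((UHalf.genComat D true).t i j) • 1
      have hc : counit (R := Kq) ((UHalf.genComat D true).t i j) = if i = j then 1 else 0 :=
        (UHalf.genComat D true).counit_t i j
      rw [plusHom_genComat, hc]
      have := formAct_comat (D.minusForm i j) (Comat.one (UHalf.isSuperbialgebra D false)) () ()
      refine this.trans ?_
      change ∑ c : Unit, (sgn Kq ((0 + 0) * (0 + 0)) * D.minusForm i j 1) • 1 = _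
      simp [minusForm_one, sgn_zero]
    intro a
    have ha : a ∈ M := by rw [hM]; trivial
    exact ha
  rw [rPairing_tmul, key, map_smul, (UHalf.isSuperbialgebra D false).counit_one, smul_eq_mul,
    mul_one]

/-- This is the action property (a a') · u = a · (a' · u) for a comatrix entry u: expanding a' · u
by `plusHom_comat` and pairing with a produces the two factors of Δ(u). -/
theorem rPairing_mul_left (a a' : UHalf D true) (b : UHalf D false) :
    D.rPairing ((a * a') ⊗ₜ b) = pairing₂ (UHalf.grading D true) (UHalf.grading D false) D.rPairing
      ((a ⊗ₜ a') ⊗ₜ comul (R := Kq) b) := by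
  refine Comat.mul_left_of_comat (UHalf.isSuperbialgebra D true) (UHalf.isSuperbialgebra D false)
    (UHalf.generates_genComat D true) (UHalf.generates_genComat D false)
    (fun a n m x x' y y' => ?_) a a' b
  generalize Comat.pow (UHalf.isSuperbialgebra D false) (UHalf.genComat D false) m = E at *
  generalize Comat.pow (UHalf.isSuperbialgebra D true) (UHalf.genComat D true) n = C at *
  rw [rPairing_tmul, map_mul, Module.End.mul_apply, plusHom_comat, E.comul_t,
    TensorProduct.tmul_sum]
  simp only [map_sum]
  refine Finset.sum_congr rfl fun b _ => ?_
  rw [Comat.pairing₂_tmul _ _ _ (C.mem x x') (E.mem y b), map_smul, map_smul,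
    ← rPairing_tmul, smul_eq_mul]
  by_cases h : C.p x + C.p x' = E.p b + E.p y'
  · rw [h, mul_comm (E.p b + E.p y')]; ring
  · rw [D.rPairing_even h _ (C.mem x x') _ (E.mem b y')]; ring

theorem pairMat_rPairing (E : Comat (UHalf.grading D false)) :
    Comat.pairMat D.rPairing (UHalf.genComat D true) E = D.minusPair E := by
  funext i y j y'
  exact congrArg (sgn Kq (D.par j * E.p y) * ·) (D.rPairing_genComat i j (E.t y y'))

/-- For generators of U^+(R) this is the anti-multiplicativity of the matrix coefficients; the first
axiom, already proved, propagates it to all powers of the generating comatrix. -/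
theorem rPairing_mul_right (a : UHalf D true) (b b' : UHalf D false) :
    D.rPairing (a ⊗ₜ (b * b')) = pairing₂ (UHalf.grading D true) (UHalf.grading D false) D.rPairing
      (braid (UHalf.grading D true) (UHalf.grading D true) (comul (R := Kq) a) ⊗ₜ (b ⊗ₜ b')) := by
  refine Comat.mul_right_of_mulRightOn (UHalf.isSuperbialgebra D true)
    (UHalf.isSuperbialgebra D false) D.rPairing_even (UHalf.generates_genComat D true)
    (UHalf.generates_genComat D false) (fun n m m' => ?_) a b b'
  refine Comat.mulRightOn_pow _ _ _ D.rPairing_one_left (fun n E => ?_) ?_ n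
  · rw [Comat.mulLeftOn_iff _ (Comat.evenOn_of_isEvenPairing D.rPairing_even _ _)]
    exact fun x x' z z' y y' => D.rPairing_mul_left _ _ _
  · intro x y s x' y' s'
    simp only [pairMat_rPairing]
    exact D.minusPair_mul _ _ _ _ _ _ _ _

theorem isRPairing_rPairing : IsRPairing D D.rPairing := by
  refine ⟨⟨D.rPairing_even, D.rPairing_one_left, D.rPairing_one_right, D.rPairing_mul_left,
    D.rPairing_mul_right⟩, fun i j k l => ?_⟩
  rw [UHalf.gen_eq, ← TensorProduct.smul_tmul', map_smul, rPairing_genComat, minusForm_gen, R_eq,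
    smul_eq_mul, ← mul_assoc, ← mul_assoc, ← sgn_add, ← sgn_add]
  by_cases h : D.weights.S i k j l = 0
  · simp [h]
  have h := D.weights_even h
  congr 2
  generalize D.par i = x₁ at *; generalize D.par j = x₂ at *
  generalize D.par k = x₃ at *; generalize D.par l = x₄ at *
  revert h; revert x₁ x₂ x₃ x₄; decide

end OspDatum

/-! ### Inverses of matrices indexed by pairs -/

section Inverse

variable {K : Type*} [Field K] {X Y Z : Type*} [Fintype X] [Fintype Y] [Fintype Z] [DecidableEq X]
  [DecidableEq Y] [DecidableEq Z]

/-- `Q` is the inverse of the matrix `P`, with rows and columns indexed by pairs. -/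
def IsInv (P Q : X → Y → X → Y → K) : Prop :=
  ∀ x y x' y', ∑ a, ∑ b, P x y a b * Q a b x' y' = if x = x' ∧ y = y' then 1 else 0

/-- The product of P and P' along the common Y-factor has as inverse the product of the inverses in
the opposite order. `IsInv.mulRight` is the same along the X-factor. -/
theorem IsInv.mulLeft {P Q : X → Y → X → Y → K} {P' Q' : Z → Y → Z → Y → K} (h : IsInv P Q)
    (h' : IsInv P' Q') : IsInv (X := X × Z)
      (fun x y x' y' => ∑ b, P x.1 y x'.1 b * P' x.2 b x'.2 y')
      (fun x y x' y' => ∑ b, Q' x.2 y x'.2 b * Q x.1 b x'.1 y') := by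
  rintro ⟨x, z⟩ y ⟨x', z'⟩ y'
  calc _ = ∑ d, ∑ a, ∑ e, P x y a d * Q a e x' y' * (∑ c, ∑ b, P' z d c b * Q' c b z' e) := by
        simp only [Finset.mul_sum, Finset.sum_mul, Fintype.sum_prod_type]
        simp only [← Finset.sum_product', Finset.univ_product_univ]
        exact Fintype.sum_equiv ⟨fun (a, c, b, e, d) => (d, a, e, c, b), fun (d, a, e, c, b) => (a, c, b, e, d),
          fun _ => rfl, fun _ => rfl⟩ _ _ fun _ => by dsimp only [Equiv.coe_fn_mk]; ring
    _ = if z = z' then ∑ d, ∑ a, P x y a d * Q a d x' y' else 0 := by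
        simp only [h' _ _ _ _]
        split_ifs with hz
        · simp [hz]
        · simp [hz]
    _ = _ := by
        rw [Finset.sum_comm, h]
        by_cases h1 : x = x' <;> by_cases h2 : y = y' <;> by_cases h3 : z = z' <;> simp [h1, h2, h3]

theorem IsInv.mulRight {P Q : X → Y → X → Y → K} {P' Q' : X → Z → X → Z → K} (h : IsInv P Q)
    (h' : IsInv P' Q') : IsInv (Y := Y × Z)
      (fun x y x' y' => ∑ a, P' x y.2 a y'.2 * P a y.1 x' y'.1)
      (fun x y x' y' => ∑ a, Q x y.1 a y'.1 * Q' a y.2 x' y'.2) := by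
  rintro x ⟨y, z⟩ x' ⟨y', z'⟩
  calc _ = ∑ d, ∑ a, ∑ e, P' x z a d * Q' e d x' z' * (∑ c, ∑ b, P a y c b * Q c b e y') := by
        simp only [Finset.mul_sum, Finset.sum_mul, Fintype.sum_prod_type]
        simp only [← Finset.sum_product', Finset.univ_product_univ]
        exact Fintype.sum_equiv ⟨fun (c, b, d, e, a) => (d, a, e, c, b), fun (d, a, e, c, b) => (c, b, d, e, a),
          fun _ => rfl, fun _ => rfl⟩ _ _ fun _ => by dsimp only [Equiv.coe_fn_mk]; ring
    _ = if y = y' then ∑ d, ∑ a, P' x z a d * Q' a d x' z' else 0 := by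
        simp only [h _ _ _ _]
        split_ifs with hz
        · simp [hz]
        · simp [hz]
    _ = _ := by
        rw [Finset.sum_comm, h']
        by_cases h1 : x = x' <;> by_cases h2 : y = y' <;> by_cases h3 : z = z' <;> simp [h1, h2, h3]

theorem isInv_iff {P Q : X → Y → X → Y → K} : IsInv P Q ↔
    Matrix.of (fun x y : X × Y => P x.1 x.2 y.1 y.2) *
      Matrix.of (fun x y : X × Y => Q x.1 x.2 y.1 y.2) = 1 := by
  constructor
  · intro h
    ext x y
    rw [Matrix.mul_apply, Fintype.sum_prod_type, Matrix.one_apply]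
    simp only [Matrix.of_apply, h x.1 x.2 y.1 y.2, Prod.ext_iff]
  · intro h x y x' y'
    have := congrFun (congrFun h (x, y)) (x', y')
    rw [Matrix.mul_apply, Fintype.sum_prod_type, Matrix.one_apply] at this
    simpa [Prod.ext_iff] using this

theorem IsInv.symm {P Q : X → Y → X → Y → K} (h : IsInv P Q) : IsInv Q P := by
  rw [isInv_iff] at *
  exact mul_eq_one_comm.1 h

theorem IsInv.unique {P Q Q' : X → Y → X → Y → K} (h : IsInv P Q) (h' : IsInv P Q') : Q = Q' := by
  have := IsInv.symm h
  rw [isInv_iff] at *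
  have e := left_inv_eq_right_inv this h'
  funext x y x' y'
  exact congrFun (congrFun e (x, y)) (x', y')

theorem isInv_unit_right {P : X → Unit → X → Unit → K}
    (h : ∀ x x' y y', P x y x' y' = if x = x' then 1 else 0) : IsInv P P := by
  intro x y x' y'
  simp [h]

theorem isInv_unit_left {P : Unit → Y → Unit → Y → K}
    (h : ∀ x x' y y', P x y x' y' = if y = y' then 1 else 0) : IsInv P P := by
  intro x y x' y'
  simp [h]

end Inverse

/-! ### Uniqueness of skew-pairings, and the convolution inverse on comatrices -/

section Pairing

variable {K : Type*} [Field K] {A : Type*} [Ring A] [Algebra K A]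
  {𝒜 : ZMod 2 → Submodule K A} [GradedAlgebra 𝒜] [CoalgebraStruct K A]
  {B : Type*} [Ring B] [Algebra K B] {ℬ : ZMod 2 → Submodule K B} [GradedAlgebra ℬ]
  [CoalgebraStruct K B] {σ σ' : A ⊗[K] B →ₗ[K] K}

namespace IsSkewPairing

theorem mulLeftOn (hσ : IsSkewPairing 𝒜 ℬ σ) (h : IsSuperbialgebra 𝒜) (C C' : Comat 𝒜)
    (E : Comat ℬ) : Comat.MulLeftOn h σ C C' E :=
  (Comat.mulLeftOn_iff h (Comat.evenOn_of_isEvenPairing hσ.even _ _)).2 fun _ _ _ _ _ _ =>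
    hσ.mul_left _ _ _

theorem mulRightOn (hσ : IsSkewPairing 𝒜 ℬ σ) (h : IsSuperbialgebra ℬ) (C : Comat 𝒜)
    (E E' : Comat ℬ) : Comat.MulRightOn h σ C E E' :=
  (Comat.mulRightOn_iff h (Comat.evenOn_of_isEvenPairing hσ.even _ _)).2 fun _ _ _ _ _ _ =>
    hσ.mul_right _ _ _

/-- Two skew-pairings that agree on generating comatrices are equal. -/
theorem ext {τ : A ⊗[K] B →ₗ[K] K} (hσ : IsSkewPairing 𝒜 ℬ σ) (hτ : IsSkewPairing 𝒜 ℬ τ)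
    (h : IsSuperbialgebra 𝒜) (h' : IsSuperbialgebra ℬ) {C : Comat 𝒜} (hC : C.Generates)
    {E : Comat ℬ} (hE : E.Generates)
    (hστ : ∀ x x' y y', σ (C.t x x' ⊗ₜ E.t y y') = τ (C.t x x' ⊗ₜ E.t y y')) : σ = τ := by
  have h1 (m : ℕ) : Comat.pairMat σ C (Comat.pow h' E m) = Comat.pairMat τ C (Comat.pow h' E m) := by
    induction m with
    | zero =>
      funext x y x' y'
      exact (Comat.pairMat_one_right h' hσ.one_right C x x' y y').trans
        (Comat.pairMat_one_right h' hτ.one_right C x x' y y').symm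
    | succ m ih =>
      funext x y x' y'
      refine (hσ.mulRightOn h' C E (Comat.pow h' E m) x y.1 y.2 x' y'.1 y'.2).trans
        (Eq.trans ?_ (hτ.mulRightOn h' C E (Comat.pow h' E m) x y.1 y.2 x' y'.1 y'.2).symm)
      simp only [ih]
      simp only [Comat.pairMat, hστ]
  have h2 (n m : ℕ) : Comat.pairMat σ (Comat.pow h C n) (Comat.pow h' E m) =
      Comat.pairMat τ (Comat.pow h C n) (Comat.pow h' E m) := by
    induction n with
    | zero =>
      funext x y x' y'
      exact (Comat.pairMat_one_left h hσ.one_left _ x x' y y').trans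
        (Comat.pairMat_one_left h hτ.one_left _ x x' y y').symm
    | succ n ih =>
      funext x y x' y'
      refine (hσ.mulLeftOn h C (Comat.pow h C n) _ x.1 x.2 y x'.1 x'.2 y').trans
        (Eq.trans ?_ (hτ.mulLeftOn h C (Comat.pow h C n) _ x.1 x.2 y x'.1 x'.2 y').symm)
      simp only [ih, h1]
  refine hC.tensor_ext h hE h' fun n m x x' y y' => ?_
  rw [Comat.pairing_eq, Comat.pairing_eq, h2]

/-- The matrices of a skew-pairing are invertible, if it is so for generating comatrices. -/
theorem exists_isInv (hσ : IsSkewPairing 𝒜 ℬ σ)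
    (h : IsSuperbialgebra 𝒜) (h' : IsSuperbialgebra ℬ) {C : Comat 𝒜} {E : Comat ℬ}
    (hQ : ∃ Q, IsInv (Comat.pairMat σ C E) Q) (n m : ℕ) :
    ∃ Q, IsInv (Comat.pairMat σ (Comat.pow h C n) (Comat.pow h' E m)) Q := by
  have h1 (m : ℕ) : ∃ Q, IsInv (Comat.pairMat σ C (Comat.pow h' E m)) Q := by
    induction m with
    | zero =>
      exact ⟨_, isInv_unit_right (P := Comat.pairMat σ C (Comat.one h'))
        (Comat.pairMat_one_right h' hσ.one_right C)⟩
    | succ m ih =>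
      obtain ⟨Q, hQ⟩ := hQ
      obtain ⟨Q', hQ'⟩ := ih
      have e1 : Comat.pairMat σ C (Comat.pow h' E (m + 1)) = _ :=
        funext fun x => funext fun y => funext fun x' => funext fun y' =>
          hσ.mulRightOn h' C E (Comat.pow h' E m) x y.1 y.2 x' y'.1 y'.2
      rw [e1]
      exact ⟨_, IsInv.mulRight hQ hQ'⟩
  induction n with
  | zero =>
    exact ⟨_, isInv_unit_left (P := Comat.pairMat σ (Comat.one h) (Comat.pow h' E m))
      (Comat.pairMat_one_left h hσ.one_left _)⟩
  | succ n ih =>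
    obtain ⟨Q, hQ⟩ := h1 m
    obtain ⟨Q', hQ'⟩ := ih
    have e1 : Comat.pairMat σ (Comat.pow h C (n + 1)) (Comat.pow h' E m) = _ :=
      funext fun x => funext fun y => funext fun x' => funext fun y' =>
        hσ.mulLeftOn h C (Comat.pow h C n) (Comat.pow h' E m) x.1 x.2 y x'.1 x'.2 y'
    rw [e1]
    exact ⟨_, IsInv.mulLeft hQ hQ'⟩

end IsSkewPairing

namespace Comat

/-- The matrix `(-1)^{(|x|+|x'|)|y|} t_xx' ⊗ u_yy'`, a comatrix of the tensor product. -/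
def tens (C : Comat 𝒜) (E : Comat ℬ) (x : C.X) (y : E.X) (x' : C.X) (y' : E.X) : A ⊗[K] B :=
  sgn K ((C.p x + C.p x') * E.p y) • (C.t x x' ⊗ₜ E.t y y')

theorem tmul_eq (C : Comat 𝒜) (E : Comat ℬ) (x : C.X) (y : E.X) (x' : C.X) (y' : E.X) :
    C.t x x' ⊗ₜ E.t y y' = sgn K ((C.p x + C.p x') * E.p y) • tens C E x y x' y' := by
  rw [tens, smul_smul, sgn_mul_self, one_smul]

theorem midMap_tmul {X Y P Q P' Q' : Type*} [AddCommGroup X] [Module K X] [AddCommGroup Y]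
    [Module K Y] [AddCommGroup P] [Module K P] [AddCommGroup Q] [Module K Q]
    [AddCommGroup P'] [Module K P'] [AddCommGroup Q'] [Module K Q']
    (f : P ⊗[K] Q →ₗ[K] P' ⊗[K] Q') (r : K) (x : X) (p : P) (z : Q) (y : Y) {p' : P'} {z' : Q'}
    (h : f (p ⊗ₜ z) = r • (p' ⊗ₜ z')) :
    midMap f ((x ⊗ₜ p) ⊗ₜ (z ⊗ₜ y)) = r • ((x ⊗ₜ p') ⊗ₜ (z' ⊗ₜ y)) := by
  simp [midMap, h, ← TensorProduct.smul_tmul', TensorProduct.tmul_smul]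

theorem comulTensor_tens (C : Comat 𝒜) (E : Comat ℬ) (x : C.X) (y : E.X) (x' : C.X) (y' : E.X) :
    comulTensor 𝒜 ℬ (tens C E x y x' y') =
      ∑ a, ∑ b, tens C E x y a b ⊗ₜ tens C E a b x' y' := by
  rw [tens, map_smul, comulTensor, LinearMap.comp_apply, TensorProduct.map_tmul, C.comul_t,
    E.comul_t, TensorProduct.sum_tmul, map_sum, Finset.smul_sum]
  refine Finset.sum_congr rfl fun a _ => ?_
  rw [TensorProduct.tmul_sum, map_sum, Finset.smul_sum]
  refine Finset.sum_congr rfl fun b _ => ?_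
  rw [midMap_tmul _ _ _ _ _ _ (braid_tmul 𝒜 ℬ (C.mem a x') (E.mem y b)), tens, tens,
    TensorProduct.smul_tmul_smul, smul_smul, ← sgn_add, ← sgn_add]
  congr 2
  generalize C.p x = x₁; generalize C.p x' = x₂; generalize C.p a = x₃
  generalize E.p y = x₄; generalize E.p b = x₅
  revert x₁ x₂ x₃ x₄ x₅; decide

theorem counitTensor_tens (C : Comat 𝒜) (E : Comat ℬ) (x : C.X) (y : E.X) (x' : C.X) (y' : E.X) :
    counitTensor K A B (tens C E x y x' y') = if x = x' ∧ y = y' then 1 else 0 := by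
  rw [tens, map_smul, counitTensor, LinearMap.comp_apply, TensorProduct.map_tmul, C.counit_t,
    E.counit_t, LinearMap.mul'_apply]
  by_cases h1 : x = x' <;> by_cases h2 : y = y' <;> simp [h1, h2, zmod2_add_self, sgn_zero]

theorem pairing_tens (σ : A ⊗[K] B →ₗ[K] K) (C : Comat 𝒜) (E : Comat ℬ) (x : C.X) (y : E.X)
    (x' : C.X) (y' : E.X) :
    σ (tens C E x y x' y') = sgn K (C.p x * E.p y) * pairMat σ C E x y x' y' := by
  rw [tens, map_smul, pairing_eq, smul_eq_mul, ← mul_assoc, ← sgn_add]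
  congr 2
  generalize C.p x = x₁; generalize C.p x' = x₂; generalize E.p y = x₃
  revert x₁ x₂ x₃; decide

/-- The matrix `(-1)^{|x'||y'|} σ'(w_xy,x'y')`, for the tensor comatrix `w`. -/
def copairMat (σ' : A ⊗[K] B →ₗ[K] K) (C : Comat 𝒜) (E : Comat ℬ) (x : C.X) (y : E.X)
    (x' : C.X) (y' : E.X) : K :=
  sgn K (C.p x' * E.p y') * σ' (tens C E x y x' y')

theorem copairing_tens (σ' : A ⊗[K] B →ₗ[K] K) (C : Comat 𝒜) (E : Comat ℬ) (x : C.X) (y : E.X)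
    (x' : C.X) (y' : E.X) :
    σ' (tens C E x y x' y') = sgn K (C.p x' * E.p y') * copairMat σ' C E x y x' y' := by
  rw [copairMat, ← mul_assoc, sgn_mul_self, one_mul]

theorem conv_tens (φ ψ : A ⊗[K] B →ₗ[K] K) (C : Comat 𝒜) (E : Comat ℬ) (x : C.X) (y : E.X)
    (x' : C.X) (y' : E.X) : conv 𝒜 ℬ φ ψ (tens C E x y x' y') =
      ∑ a, ∑ b, φ (tens C E x y a b) * ψ (tens C E a b x' y') := by
  simp only [conv, LinearMap.comp_apply, comulTensor_tens, map_sum, TensorProduct.map_tmul,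
    LinearMap.mul'_apply]

theorem Generates.tens_ext {C : Comat 𝒜} (hC : C.Generates) (h : IsSuperbialgebra 𝒜)
    {E : Comat ℬ} (hE : E.Generates) (h' : IsSuperbialgebra ℬ)
    {M : Type*} [AddCommMonoid M] [Module K M] {f g : A ⊗[K] B →ₗ[K] M}
    (hfg : ∀ n m x y x' y', f (tens (pow h C n) (pow h' E m) x y x' y') =
      g (tens (pow h C n) (pow h' E m) x y x' y')) : f = g := by
  refine hC.tensor_ext h hE h' fun n m x x' y y' => ?_
  rw [tmul_eq, map_smul, map_smul, hfg]

/-- Convolution on the tensor comatrix is matrix multiplication, so a right convolution inverse is a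
right inverse matrix. The sign conventions of `pairMat` and `copairMat` cancel at the summation
indices. -/
theorem isInv_of_conv {C : Comat 𝒜} {E : Comat ℬ}
    (hc : conv 𝒜 ℬ σ σ' = counitTensor K A B) : IsInv (pairMat σ C E) (copairMat σ' C E) := by
  intro x y x' y'
  have := LinearMap.congr_fun hc (tens C E x y x' y')
  rw [conv_tens, counitTensor_tens] at this
  simp only [pairing_tens σ, copairing_tens σ'] at this
  have e : ∑ a, ∑ b, pairMat σ C E x y a b * copairMat σ' C E a b x' y' =
      sgn K (C.p x * E.p y) * (sgn K (C.p x' * E.p y') * if x = x' ∧ y = y' then 1 else 0) := by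
    rw [← this]
    simp only [Finset.mul_sum]
    refine Finset.sum_congr rfl fun a _ => Finset.sum_congr rfl fun b _ => ?_
    linear_combination (-pairMat σ C E x y a b * copairMat σ' C E a b x' y') *
      (sgn_mul_self (K := K) (C.p x * E.p y) + sgn K (C.p x * E.p y) * sgn K (C.p x * E.p y) * sgn_mul_self (K := K) (C.p x' * E.p y'))
  rw [e]
  split_ifs with hh
  · rw [hh.1, hh.2, mul_one, sgn_mul_self]
  · simp

/-- For finite square matrices a right inverse is also a left inverse, and the entries of the tensor
comatrices span. -/
theorem conv_left_of_conv_right {C : Comat 𝒜} (hC : C.Generates) (h : IsSuperbialgebra 𝒜)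
    {E : Comat ℬ} (hE : E.Generates) (h' : IsSuperbialgebra ℬ)
    (hc : conv 𝒜 ℬ σ σ' = counitTensor K A B) : conv 𝒜 ℬ σ' σ = counitTensor K A B := by
  refine hC.tens_ext h hE h' fun n m x y x' y' => ?_
  rw [conv_tens, counitTensor_tens, ← (isInv_of_conv hc).symm]
  refine Finset.sum_congr rfl fun a _ => Finset.sum_congr rfl fun b _ => ?_
  rw [pairing_tens σ, copairing_tens σ']
  linear_combination (copairMat σ' _ _ x y a b * pairMat σ _ _ a b x' y') *
    sgn_mul_self (K := K) ((pow h C n).p a * (pow h' E m).p b)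

theorem even_of_conv_right {C : Comat 𝒜} (hC : C.Generates) (h : IsSuperbialgebra 𝒜)
    {E : Comat ℬ} (hE : E.Generates) (h' : IsSuperbialgebra ℬ) (he : IsEvenPairing 𝒜 ℬ σ)
    (hc : conv 𝒜 ℬ σ σ' = counitTensor K A B) (h2 : (2 : K) ≠ 0) : IsEvenPairing 𝒜 ℬ σ' := by
  refine hC.isEvenPairing h hE h' fun n m => ?_
  generalize pow h C n = C at *
  generalize pow h' E m = E at *
  have h1 : IsInv (pairMat σ C E) (copairMat σ' C E) := isInv_of_conv hc
  -- Multiplying the inverse by total parity signs gives another inverse, since the matrix of σ is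
  -- even. By uniqueness the two agree, so the odd entries equal their own negatives.
  have h3 : IsInv (pairMat σ C E) fun x y x' y' =>
      sgn K (C.p x + E.p y + C.p x' + E.p y') * copairMat σ' C E x y x' y' := by
    intro x y x' y'
    have e : ∑ a, ∑ b, pairMat σ C E x y a b * (sgn K (C.p a + E.p b + C.p x' + E.p y') *
        copairMat σ' C E a b x' y') = sgn K (C.p x + E.p y + C.p x' + E.p y') *
          ∑ a, ∑ b, pairMat σ C E x y a b * copairMat σ' C E a b x' y' := by
      simp only [Finset.mul_sum]
      refine Finset.sum_congr rfl fun a _ => Finset.sum_congr rfl fun b _ => ?_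
      by_cases e : C.p x + C.p a = E.p y + E.p b
      · have e : C.p a + E.p b + C.p x' + E.p y' = C.p x + E.p y + C.p x' + E.p y' := by
          generalize C.p x = x₁ at *; generalize C.p x' = x₂ at *; generalize C.p a = x₃ at *
          generalize E.p y = x₄ at *; generalize E.p b = x₅ at *; generalize E.p y' = x₆ at *
          revert e; clear * -; revert x₁ x₂ x₃ x₄ x₅ x₆; decide
        rw [e]; ring
      · rw [(evenOn_of_isEvenPairing he C E).pairMat_eq_zero e]; ring
    rw [e, h1]
    split_ifs with hh
    · rw [hh.1, hh.2, add_assoc (_ + _), zmod2_add_self, sgn_zero, one_mul]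
    · simp
  have h4 := h1.unique h3
  intro x x' y y' hne
  rw [tmul_eq, map_smul, copairing_tens]
  have h5 := congrFun (congrFun (congrFun (congrFun h4 x) y) x') y'
  have h6 : C.p x + E.p y + C.p x' + E.p y' = 1 := by
    generalize C.p x = x₁ at *; generalize C.p x' = x₂ at *
    generalize E.p y = x₄ at *; generalize E.p y' = x₆ at *
    revert hne; clear * -; revert x₁ x₂ x₄ x₆; decide
  rw [h6, sgn_one] at h5
  have h7 : copairMat σ' C E x y x' y' = 0 := by
    have : (2 : K) * copairMat σ' C E x y x' y' = 0 := by linear_combination h5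
    exact (mul_eq_zero.1 this).resolve_left h2
  rw [h7, mul_zero, smul_zero]

end Comat

end Pairing

/-! ### Construction of the convolution inverse -/

section Convolution

variable {K : Type*} [Field K] {A : Type*} [Ring A] [Algebra K A]
  {𝒜 : ZMod 2 → Submodule K A} [GradedAlgebra 𝒜] [CoalgebraStruct K A]
  {B : Type*} [Ring B] [Algebra K B] {ℬ : ZMod 2 → Submodule K B} [GradedAlgebra ℬ]
  [CoalgebraStruct K B] {σ σ' : A ⊗[K] B →ₗ[K] K}

variable (𝒜 ℬ) in
/-- The operator `c ↦ φ(c_1) c_2` on `A ⊗ B`. -/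
def convOp (φ : A ⊗[K] B →ₗ[K] K) : A ⊗[K] B →ₗ[K] A ⊗[K] B :=
  (TensorProduct.lid K (A ⊗[K] B)).toLinearMap ∘ₗ LinearMap.rTensor (A ⊗[K] B) φ ∘ₗ
    comulTensor 𝒜 ℬ

namespace Comat

theorem convOp_tens (φ : A ⊗[K] B →ₗ[K] K) (C : Comat 𝒜) (E : Comat ℬ) (x : C.X) (y : E.X)
    (x' : C.X) (y' : E.X) : convOp 𝒜 ℬ φ (tens C E x y x' y') =
      ∑ a, ∑ b, φ (tens C E x y a b) • tens C E a b x' y' := by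
  simp only [convOp, LinearMap.comp_apply, comulTensor_tens, map_sum, LinearMap.rTensor_tmul,
    LinearEquiv.coe_coe, TensorProduct.lid_tmul]

/-- On a fixed tensor comatrix the operator is multiplication by the pairing matrix, up to signs, so
the inverse matrix supplies preimages. -/
theorem tens_eq_convOp {C : Comat 𝒜} {E : Comat ℬ} {Q} (hQ : IsInv (pairMat σ C E) Q) (x : C.X)
    (y : E.X) (x' : C.X) (y' : E.X) : tens C E x y x' y' =
      convOp 𝒜 ℬ σ (∑ a, ∑ b, (Q x y a b * sgn K (C.p a * E.p b)) • tens C E a b x' y') := by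
  simp only [map_sum, map_smul, convOp_tens, Finset.smul_sum, smul_smul, pairing_tens]
  have e : ∑ c, ∑ d, (∑ a, ∑ b, Q x y a b * pairMat σ C E a b c d) • tens C E c d x' y' =
      tens C E x y x' y' := by
    simp only [hQ.symm x y]
    rw [Finset.sum_eq_single x, Finset.sum_eq_single y]
    · simp
    · intro b _ hb; simp [hb.symm]
    · simp
    · intro b _ hb; simp [hb.symm]
    · simp
  rw [← e]
  simp only [Finset.sum_smul]
  simp only [← Finset.sum_product', Finset.univ_product_univ]
  refine Fintype.sum_equiv ⟨fun (c, d, a, b) => (a, b, c, d), fun (a, b, c, d) => (c, d, a, b),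
    fun _ => rfl, fun _ => rfl⟩ _ _ fun ⟨c, d, a, b⟩ => ?_
  dsimp only [Equiv.coe_fn_mk]
  congr 1
  linear_combination (-Q x y a b * pairMat σ C E a b c d) * sgn_mul_self (K := K) (C.p a * E.p b)

/-- The span of the entries of the first tensor comatrices. -/
def tensSpan (h : IsSuperbialgebra 𝒜) (h' : IsSuperbialgebra ℬ) (C : Comat 𝒜) (E : Comat ℬ)
    (M : ℕ) : Submodule K (A ⊗[K] B) :=
  Submodule.span K (Set.range fun z : Σ nm : Fin M × Fin M,
    ((pow h C nm.1).X × (pow h' E nm.2).X) × ((pow h C nm.1).X × (pow h' E nm.2).X) =>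
      tens (pow h C z.1.1) (pow h' E z.1.2) z.2.1.1 z.2.1.2 z.2.2.1 z.2.2.2)

theorem tens_mem_tensSpan (h : IsSuperbialgebra 𝒜) (h' : IsSuperbialgebra ℬ) (C : Comat 𝒜)
    (E : Comat ℬ) {M n m : ℕ} (hn : n < M) (hm : m < M) (x y x' y') :
    tens (pow h C n) (pow h' E m) x y x' y' ∈ tensSpan h h' C E M :=
  Submodule.subset_span ⟨⟨(⟨n, hn⟩, ⟨m, hm⟩), (x, y), (x', y')⟩, rfl⟩

theorem tensSpan_mono (h : IsSuperbialgebra 𝒜) (h' : IsSuperbialgebra ℬ) (C : Comat 𝒜)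
    (E : Comat ℬ) {M M' : ℕ} (hM : M ≤ M') : tensSpan h h' C E M ≤ tensSpan h h' C E M' := by
  refine Submodule.span_le.2 ?_
  rintro _ ⟨⟨⟨n, m⟩, ⟨x, y⟩, ⟨x', y'⟩⟩, rfl⟩
  exact tens_mem_tensSpan h h' C E (n.2.trans_le hM) (m.2.trans_le hM) _ _ _ _

theorem exists_mem_tensSpan (h : IsSuperbialgebra 𝒜) (h' : IsSuperbialgebra ℬ) {C : Comat 𝒜}
    (hC : C.Generates) {E : Comat ℬ} (hE : E.Generates) (c : A ⊗[K] B) :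
    ∃ M, c ∈ tensSpan h h' C E M := by
  let T : Submodule K (A ⊗[K] B) :=
    { carrier := {c | ∃ M, c ∈ tensSpan h h' C E M}
      zero_mem' := ⟨0, Submodule.zero_mem _⟩
      add_mem' := fun {a b} ⟨M, hM⟩ ⟨M', hM'⟩ => ⟨max M M', Submodule.add_mem _
        (tensSpan_mono h h' C E (le_max_left _ _) hM)
        (tensSpan_mono h h' C E (le_max_right _ _) hM')⟩
      smul_mem' := fun r a ⟨M, hM⟩ => ⟨M, Submodule.smul_mem _ _ hM⟩ }
  have hT : T.mkQ = 0 := hC.tens_ext h hE h' fun n m x y x' y' => by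
    rw [Submodule.mkQ_apply, LinearMap.zero_apply, Submodule.Quotient.mk_eq_zero]
    exact ⟨max n m + 1, tens_mem_tensSpan h h' C E (by omega) (by omega) _ _ _ _⟩
  have := LinearMap.congr_fun hT c
  rwa [Submodule.mkQ_apply, LinearMap.zero_apply, Submodule.Quotient.mk_eq_zero] at this

/-- The entries of comatrices may be linearly dependent, so the inverse matrices alone do not define
an inverse operator. Instead, each vector lies in a finite-dimensional stable subspace on which the
operator is surjective, hence injective. -/
theorem convOp_injective (h : IsSuperbialgebra 𝒜) (h' : IsSuperbialgebra ℬ) {C : Comat 𝒜}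
    (hC : C.Generates) {E : Comat ℬ} (hE : E.Generates)
    (hQ : ∀ n m, ∃ Q, IsInv (pairMat σ (pow h C n) (pow h' E m)) Q) :
    Function.Injective (convOp 𝒜 ℬ σ) := by
  rw [injective_iff_map_eq_zero]
  intro c hc
  obtain ⟨M, hM⟩ := exists_mem_tensSpan h h' hC hE c
  set W := tensSpan h h' C E M with hW
  have : FiniteDimensional K W := FiniteDimensional.span_of_finite K (Set.finite_range _)
  have hmaps : ∀ w ∈ W, convOp 𝒜 ℬ σ w ∈ W := by
    intro w hw
    have : W ≤ W.comap (convOp 𝒜 ℬ σ) := by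
      conv_lhs => rw [hW, tensSpan]
      refine Submodule.span_le.2 ?_
      rintro _ ⟨⟨⟨n, m⟩, ⟨x, y⟩, ⟨x', y'⟩⟩, rfl⟩
      change convOp 𝒜 ℬ σ (tens _ _ _ _ _ _) ∈ W
      rw [convOp_tens]
      exact Submodule.sum_mem _ fun a _ => Submodule.sum_mem _ fun b _ => Submodule.smul_mem _ _
        (tens_mem_tensSpan h h' C E n.2 m.2 _ _ _ _)
    exact this hw
  have hsurj : Function.Surjective ((convOp 𝒜 ℬ σ).restrict hmaps) := by
    rintro ⟨w, hw⟩
    have : W ≤ W.map (convOp 𝒜 ℬ σ) := by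
      conv_lhs => rw [hW, tensSpan]
      refine Submodule.span_le.2 ?_
      rintro _ ⟨⟨⟨n, m⟩, ⟨x, y⟩, ⟨x', y'⟩⟩, rfl⟩
      obtain ⟨Q, hQ⟩ := hQ n m
      refine ⟨_, ?_, (tens_eq_convOp hQ x y x' y').symm⟩
      exact Submodule.sum_mem _ fun a _ => Submodule.sum_mem _ fun b _ => Submodule.smul_mem _ _
        (tens_mem_tensSpan h h' C E n.2 m.2 _ _ _ _)
    obtain ⟨v, hv, e⟩ := this hw
    exact ⟨⟨v, hv⟩, Subtype.ext e⟩
  have hinj := LinearMap.injective_iff_surjective.2 hsurj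
  have := hinj (a₁ := ⟨c, hM⟩) (a₂ := 0) (Subtype.ext (by simpa using hc))
  exact congrArg Subtype.val this

theorem exists_conv_right (h : IsSuperbialgebra 𝒜) (h' : IsSuperbialgebra ℬ) {C : Comat 𝒜}
    (hC : C.Generates) {E : Comat ℬ} (hE : E.Generates)
    (hQ : ∀ n m, ∃ Q, IsInv (pairMat σ (pow h C n) (pow h' E m)) Q) :
    ∃ σ', conv 𝒜 ℬ σ σ' = counitTensor K A B := by
  -- For any left inverse g, the form ε ∘ g satisfies σ(c_1) ε(g(c_2)) = ε(g(σ(c_1) c_2)) = ε(c).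
  obtain ⟨g, hg⟩ := (convOp 𝒜 ℬ σ).exists_leftInverse_of_injective
    (LinearMap.ker_eq_bot.2 (convOp_injective h h' hC hE hQ))
  refine ⟨counitTensor K A B ∘ₗ g, hC.tens_ext h hE h' fun n m x y x' y' => ?_⟩
  have e := congrArg (counitTensor K A B) (LinearMap.congr_fun hg
    (tens (pow h C n) (pow h' E m) x y x' y'))
  rw [LinearMap.comp_apply, convOp_tens, LinearMap.id_apply] at e
  simp only [map_sum, map_smul] at e
  rw [← e, conv_tens]
  rfl

/-- A skew-pairing is convolution invertible if its matrix on generating comatrices is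
invertible. -/
theorem exists_isConvInverse (h : IsSuperbialgebra 𝒜) (h' : IsSuperbialgebra ℬ) {C : Comat 𝒜}
    (hC : C.Generates) {E : Comat ℬ} (hE : E.Generates) (hσ : IsSkewPairing 𝒜 ℬ σ)
    (hQ : ∃ Q, IsInv (pairMat σ C E) Q) (h2 : (2 : K) ≠ 0) :
    ∃ σ', IsConvInverse 𝒜 ℬ σ σ' := by
  obtain ⟨σ', hc⟩ := exists_conv_right h h' hC hE (hσ.exists_isInv h h' hQ)
  exact ⟨σ', even_of_conv_right hC h hE h' hσ.even hc h2, hc,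
    conv_left_of_conv_right hC h hE h' hc⟩

end Comat

end Convolution

namespace OspDatum

variable {N : ℕ} (D : OspDatum N)

theorem IsRPairing.apply_genComat {D : OspDatum N}
    {σ : UHalf D true ⊗[Kq] UHalf D false →ₗ[Kq] Kq}
    (h : IsRPairing D σ) (i j k l : Fin N) :
    σ ((UHalf.genComat D true).t i j ⊗ₜ (UHalf.genComat D false).t k l) =
      sgn Kq (D.par i * (D.par j + 1) + D.par k * (D.par l + 1) +
        (D.par i + D.par j) * (D.par k + D.par l)) * D.R i j k l := by
  have h1 := h.2 i j k l
  simp only [UHalf.genComat, TensorProduct.smul_tmul_smul, map_smul, smul_eq_mul]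
  rw [← h1, sgn_add, sgn_add]
  linear_combination (-sgn Kq (D.par i * (D.par j + 1)) * sgn Kq (D.par k * (D.par l + 1)) *
    σ (UHalf.gen D true i j ⊗ₜ UHalf.gen D false k l)) *
    sgn_mul_self (K := Kq) ((D.par i + D.par j) * (D.par k + D.par l))

theorem IsRPairing.eq_rPairing {D : OspDatum N}
    {σ : UHalf D true ⊗[Kq] UHalf D false →ₗ[Kq] Kq} (h : IsRPairing D σ) : σ = D.rPairing :=
  h.1.ext D.isRPairing_rPairing.1 (UHalf.isSuperbialgebra D true) (UHalf.isSuperbialgebra D false)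
    (UHalf.generates_genComat D true) (UHalf.generates_genComat D false) fun i j k l =>
      (IsRPairing.apply_genComat h i j k l).trans
        (IsRPairing.apply_genComat D.isRPairing_rPairing i j k l).symm

theorem pairMat_rPairing_genComat :
    Comat.pairMat D.rPairing (UHalf.genComat D true) (UHalf.genComat D false) =
      fun (i k j l : Fin N) => q⁻¹ * D.weights.S i k j l :=
  (D.pairMat_rPairing _).trans D.minusPair_genComat

theorem exists_isInv_genComat : ∃ Q, IsInv
    (Comat.pairMat D.rPairing (UHalf.genComat D true) (UHalf.genComat D false)) Q := by
  rw [pairMat_rPairing_genComat]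
  obtain ⟨M, hM⟩ := D.weights.isUnit_mat.exists_right_inv
  -- The pairing matrix is q⁻¹ S, so its inverse is q S⁻¹.
  refine ⟨fun (i k j l : Fin N) => q * M (i, k) (j, l), ?_⟩
  intro (i : Fin N) (k : Fin N) (j : Fin N) (l : Fin N)
  have e := congrFun (congrFun hM (i, k)) (j, l)
  rw [Matrix.mul_apply, Fintype.sum_prod_type, Matrix.one_apply] at e
  simp only [Prod.mk.injEq] at e
  refine Eq.trans ?_ e
  refine Finset.sum_congr rfl fun a _ => Finset.sum_congr rfl fun b _ => ?_
  change q⁻¹ * D.weights.S i k a b * (q * M (a, b) (j, l)) = D.weights.S i k a b * M (a, b) (j, l)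
  linear_combination (D.weights.S i k a b * M (a, b) (j, l)) * inv_mul_cancel₀ q_ne_zero

theorem exists_isConvInverse : ∃ σ',
    IsConvInverse (UHalf.grading D true) (UHalf.grading D false) D.rPairing σ' :=
  Comat.exists_isConvInverse (UHalf.isSuperbialgebra D true) (UHalf.isSuperbialgebra D false)
    (UHalf.generates_genComat D true) (UHalf.generates_genComat D false) D.isRPairing_rPairing.1
    D.exists_isInv_genComat two_ne_zero

end OspDatum

/-! ### The cross-multiplication and associativity of the double -/

section Cross

variable {K : Type*} [Field K] {A : Type*} [Ring A] [Algebra K A]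
  {𝒜 : ZMod 2 → Submodule K A} [GradedAlgebra 𝒜] [CoalgebraStruct K A]
  {B : Type*} [Ring B] [Algebra K B] {ℬ : ZMod 2 → Submodule K B} [GradedAlgebra ℬ]
  [CoalgebraStruct K B] {σ σ' : A ⊗[K] B →ₗ[K] K}

/-- The operator `x ⊗ y ↦ a x ⊗ y b`. -/
def sandwich (a : A) (b : B) : A ⊗[K] B →ₗ[K] A ⊗[K] B :=
  TensorProduct.map (LinearMap.mulLeft K a) (LinearMap.mulRight K b)

theorem sandwich_tmul (a x : A) (b y : B) :
    sandwich (K := K) a b (x ⊗ₜ y) = (a * x) ⊗ₜ (y * b) := rfl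

theorem sandwich_sandwich (a a' : A) (b b' : B) (T : A ⊗[K] B) :
    sandwich a b (sandwich a' b' T) = sandwich (a * a') (b' * b) T := by
  induction T with
  | zero => simp
  | tmul x y => simp only [sandwich_tmul, mul_assoc]
  | add x y hx hy => simp only [map_add, hx, hy]

theorem sandwich_one (T : A ⊗[K] B) : sandwich 1 1 T = T := by
  induction T with
  | zero => simp
  | tmul x y => simp only [sandwich_tmul, one_mul, mul_one]
  | add x y hx hy => simp only [map_add, hx, hy]

theorem doubleMul_tmul (a a' : A) (b b' : B) : doubleMul 𝒜 ℬ σ σ' ((a ⊗ₜ b) ⊗ₜ (a' ⊗ₜ b')) =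
    sandwich a b' (cross 𝒜 ℬ σ σ' (b ⊗ₜ a')) := by
  simp only [doubleMul, midMap, LinearMap.comp_apply, LinearEquiv.coe_coe,
    TensorProduct.assoc_tmul, LinearMap.lTensor_tmul, TensorProduct.assoc_symm_tmul,
    LinearMap.rTensor_tmul]
  generalize cross 𝒜 ℬ σ σ' (b ⊗ₜ a') = T
  induction T with
  | zero => simp
  | tmul x y => simp [sandwich_tmul]
  | add x y hx hy => simp only [map_add, TensorProduct.add_tmul, TensorProduct.tmul_add, hx, hy]

namespace Comat

/-- Iterating the coproduct of the tensor comatrix puts the pairing matrix on the left and the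
inverse one on the right: up to a sign, the result is P W Q with W the tensor comatrix. -/
theorem cross_comat (σ σ' : A ⊗[K] B →ₗ[K] K) (C : Comat 𝒜) (E : Comat ℬ) (x : C.X) (y : E.X)
    (x' : C.X) (y' : E.X) : cross 𝒜 ℬ σ σ' (E.t y y' ⊗ₜ C.t x x') =
      ∑ c, ∑ d, ∑ a, ∑ b, (sgn K (C.p x * (E.p y + E.p y')) * (pairMat σ C E x y a b *
        copairMat σ' C E c d x' y')) • tens C E a b c d := by
  rw [cross]
  simp only [LinearMap.comp_apply]
  rw [braid_tmul ℬ 𝒜 (E.mem _ _) (C.mem _ _), tmul_eq, smul_smul, map_smul, comulTensor_tens]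
  simp only [map_smul, map_sum, LinearMap.rTensor_tmul, comulTensor_tens, TensorProduct.sum_tmul,
    TensorProduct.map_tmul, LinearMap.comp_apply, LinearEquiv.coe_coe, TensorProduct.lid_tmul,
    TensorProduct.rid_tmul, Finset.smul_sum, smul_smul, pairing_tens σ, copairing_tens σ']
  refine Finset.sum_congr rfl fun c _ => Finset.sum_congr rfl fun d _ =>
    Finset.sum_congr rfl fun a _ => Finset.sum_congr rfl fun b _ => ?_
  congr 1
  have e : (E.p y + E.p y') * (C.p x + C.p x') + (C.p x + C.p x') * E.p y + C.p x' * E.p y' +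
      C.p x * E.p y = C.p x * (E.p y + E.p y') := by
    generalize C.p x = x₁; generalize C.p x' = x₂; generalize E.p y = x₃
    generalize E.p y' = x₄
    revert x₁ x₂ x₃ x₄; decide
  have e' := congrArg (sgn K) e
  rw [sgn_add, sgn_add, sgn_add] at e'
  linear_combination (pairMat σ C E x y a b * copairMat σ' C E c d x' y') * e'

/-- The convolution inverse has no multiplicativity axiom of its own. The factorisation, in reversed
order, comes from uniqueness of the inverse of the factorised pairing matrix. -/
theorem copairMat_mulRight (hσ : IsSkewPairing 𝒜 ℬ σ) (hσ' : IsConvInverse 𝒜 ℬ σ σ')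
    (h : IsSuperbialgebra ℬ) (C : Comat 𝒜) (E E' : Comat ℬ) (x : C.X)
    (y : E.X) (s : E'.X) (x' : C.X) (y' : E.X) (s' : E'.X) :
    copairMat σ' C (mul h E E') x (y, s) x' (y', s') =
      ∑ a, copairMat σ' C E x y a y' * copairMat σ' C E' a s x' s' := by
  have e1 : pairMat σ C (mul h E E') = _ :=
    funext fun x => funext fun y => funext fun x' => funext fun y' =>
      hσ.mulRightOn h C E E' x y.1 y.2 x' y'.1 y'.2
  have h1 : IsInv (pairMat σ C (mul h E E')) (copairMat σ' C (mul h E E')) :=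
    isInv_of_conv hσ'.conv_right
  rw [e1] at h1
  have h2 := IsInv.mulRight (isInv_of_conv (C := C) (E := E) hσ'.conv_right)
    (isInv_of_conv (C := C) (E := E') hσ'.conv_right)
  exact congrFun (congrFun (congrFun (congrFun (IsInv.unique h1 h2) x) (y, s)) x') (y', s')

theorem copairMat_mulLeft (hσ : IsSkewPairing 𝒜 ℬ σ) (hσ' : IsConvInverse 𝒜 ℬ σ σ')
    (h : IsSuperbialgebra 𝒜) (C C' : Comat 𝒜) (E : Comat ℬ) (x : C.X)
    (z : C'.X) (y : E.X) (x' : C.X) (z' : C'.X) (y' : E.X) :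
    copairMat σ' (mul h C C') E (x, z) y (x', z') y' =
      ∑ b, copairMat σ' C' E z y z' b * copairMat σ' C E x b x' y' := by
  have e1 : pairMat σ (mul h C C') E = _ :=
    funext fun x => funext fun y => funext fun x' => funext fun y' =>
      hσ.mulLeftOn h C C' E x.1 x.2 y x'.1 x'.2 y'
  have h1 : IsInv (pairMat σ (mul h C C') E) (copairMat σ' (mul h C C') E) :=
    isInv_of_conv hσ'.conv_right
  rw [e1] at h1
  have h2 := IsInv.mulLeft (isInv_of_conv (C := C) (E := E) hσ'.conv_right)
    (isInv_of_conv (C := C') (E := E) hσ'.conv_right)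
  exact congrFun (congrFun (congrFun (congrFun (IsInv.unique h1 h2) (x, z)) y) (x', z')) y'

theorem copairMat_eq_zero (hσ' : IsConvInverse 𝒜 ℬ σ σ') {C : Comat 𝒜} {E : Comat ℬ} {x : C.X} {y : E.X} {x' : C.X} {y' : E.X}
    (hne : C.p x + C.p x' ≠ E.p y + E.p y') : copairMat σ' C E x y x' y' = 0 := by
  rw [copairMat, tens, map_smul, hσ'.even hne _ (C.mem x x') _ (E.mem y y'), smul_zero, mul_zero]

theorem sandwich_right_tens (h : IsSuperbialgebra ℬ) (C : Comat 𝒜) (E E' : Comat ℬ)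
    (x₃ x₄ : C.X) (y₃ y₄ : E.X) (s₁ s₂ : E'.X) :
    sandwich 1 (E'.t s₁ s₂) (tens C E x₃ y₃ x₄ y₄) =
      sgn K (E'.p s₁ * (E.p y₃ + E.p y₄) + (C.p x₃ + C.p x₄) * E'.p s₁) •
        tens C (mul h E E') x₃ (y₃, s₁) x₄ (y₄, s₂) := by
  have e : (C.p x₃ + C.p x₄) * E.p y₃ + E'.p s₁ * (E.p y₃ + E.p y₄) =
      E'.p s₁ * (E.p y₃ + E.p y₄) + (C.p x₃ + C.p x₄) * E'.p s₁ +
        (C.p x₃ + C.p x₄) * (E.p y₃ + E'.p s₁) := by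
    generalize C.p x₃ = x₁; generalize C.p x₄ = x₂; generalize E.p y₃ = x₃
    generalize E.p y₄ = x₄; generalize E'.p s₁ = x₅
    revert x₁ x₂ x₃ x₄ x₅; decide
  rw [tens, map_smul, sandwich_tmul, one_mul, mul_eq_smul h, TensorProduct.tmul_smul,
    smul_smul, ← sgn_add, e, sgn_add, ← smul_smul]
  rfl

theorem sandwich_left_tens (h : IsSuperbialgebra 𝒜) (C C' : Comat 𝒜) (E : Comat ℬ)
    (x₁ x₂ : C.X) (z₁ z₂ : C'.X) (y₃ y₄ : E.X) :
    sandwich (C.t x₁ x₂) 1 (tens C' E z₁ y₃ z₂ y₄) =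
      sgn K (C'.p z₁ * (C.p x₁ + C.p x₂) + (C.p x₁ + C.p x₂) * E.p y₃) •
        tens (mul h C C') E (x₁, z₁) y₃ (x₂, z₂) y₄ := by
  have e : (C'.p z₁ + C'.p z₂) * E.p y₃ + C'.p z₁ * (C.p x₁ + C.p x₂) =
      C'.p z₁ * (C.p x₁ + C.p x₂) + (C.p x₁ + C.p x₂) * E.p y₃ +
        ((C.p x₁ + C'.p z₁) + (C.p x₂ + C'.p z₂)) * E.p y₃ := by
    generalize C.p x₁ = x₁; generalize C.p x₂ = x₂; generalize C'.p z₁ = x₃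
    generalize C'.p z₂ = x₄; generalize E.p y₃ = x₅
    revert x₁ x₂ x₃ x₄ x₅; decide
  rw [tens, map_smul, sandwich_tmul, mul_one, mul_eq_smul h, ← TensorProduct.smul_tmul',
    smul_smul, ← sgn_add, e, sgn_add, ← smul_smul]
  rfl

/-- Both sides are conjugations of the same threefold tensor comatrix: P and Q for the product
comatrix factor into those for E and E', so moving u u' past t can be done one factor at a time. -/
theorem cross_mul_comat (hσ : IsSkewPairing 𝒜 ℬ σ) (hσ' : IsConvInverse 𝒜 ℬ σ σ')
    (h : IsSuperbialgebra ℬ) (C : Comat 𝒜) (E E' : Comat ℬ) (x x' : C.X)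
    (y y' : E.X) (s s' : E'.X) : cross 𝒜 ℬ σ σ' ((E.t y y' * E'.t s s') ⊗ₜ C.t x x') =
      doubleMul 𝒜 ℬ σ σ' ((1 ⊗ₜ E.t y y') ⊗ₜ cross 𝒜 ℬ σ σ' (E'.t s s' ⊗ₜ C.t x x')) := by
  have hL : cross 𝒜 ℬ σ σ' ((E.t y y' * E'.t s s') ⊗ₜ C.t x x') =
      ∑ x₄, ∑ y₄, ∑ s₂, ∑ x₃, ∑ y₃, ∑ s₁, ∑ x₂, ∑ x₁,
        (sgn K (E'.p s * (E.p y + E.p y')) *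
          (sgn K (C.p x * ((E.p y + E'.p s) + (E.p y' + E'.p s'))) *
          ((pairMat σ C E' x s x₁ s₁ * pairMat σ C E x₁ y x₃ y₃) *
          (copairMat σ' C E x₄ y₄ x₂ y' * copairMat σ' C E' x₂ s₂ x' s')))) •
          tens C (mul h E E') x₃ (y₃, s₁) x₄ (y₄, s₂) := by
    rw [mul_eq_smul h, ← TensorProduct.smul_tmul', map_smul]
    refine (congrArg _ (cross_comat σ σ' C (mul h E E') x (y, s) x' (y', s'))).trans ?_
    rw [Finset.smul_sum]
    refine Finset.sum_congr rfl fun x₄ _ => ?_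
    rw [Finset.smul_sum]
    refine (Fintype.sum_prod_type _).trans ?_
    refine Finset.sum_congr rfl fun y₄ _ => Finset.sum_congr rfl fun s₂ _ => ?_
    rw [Finset.smul_sum]
    refine Finset.sum_congr rfl fun x₃ _ => ?_
    rw [Finset.smul_sum]
    refine (Fintype.sum_prod_type _).trans ?_
    refine Finset.sum_congr rfl fun y₃ _ => Finset.sum_congr rfl fun s₁ _ => ?_
    rw [hσ.mulRightOn h, copairMat_mulRight hσ hσ', smul_smul, Finset.sum_mul_sum, Finset.mul_sum,
      Finset.mul_sum, Finset.sum_smul, Finset.sum_comm]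
    refine Finset.sum_congr rfl fun x₂ _ => ?_
    simp only [Finset.mul_sum, Finset.sum_smul]
    rfl
  have hR : doubleMul 𝒜 ℬ σ σ' ((1 ⊗ₜ E.t y y') ⊗ₜ cross 𝒜 ℬ σ σ' (E'.t s s' ⊗ₜ C.t x x')) =
      ∑ x₂, ∑ s₂, ∑ x₁, ∑ s₁, ∑ x₄, ∑ y₄, ∑ x₃, ∑ y₃,
        (sgn K (C.p x * (E'.p s + E'.p s')) *
          (pairMat σ C E' x s x₁ s₁ * copairMat σ' C E' x₂ s₂ x' s') *
          (sgn K ((C.p x₁ + C.p x₂) * E'.p s₁) * (sgn K (C.p x₁ * (E.p y + E.p y')) *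
          (pairMat σ C E x₁ y x₃ y₃ * copairMat σ' C E x₄ y₄ x₂ y') *
          sgn K (E'.p s₁ * (E.p y₃ + E.p y₄) + (C.p x₃ + C.p x₄) * E'.p s₁)))) •
          tens C (mul h E E') x₃ (y₃, s₁) x₄ (y₄, s₂) := by
    rw [cross_comat]
    simp only [map_sum, TensorProduct.tmul_sum, TensorProduct.tmul_smul, map_smul]
    refine Finset.sum_congr rfl fun x₂ _ => Finset.sum_congr rfl fun s₂ _ =>
      Finset.sum_congr rfl fun x₁ _ => Finset.sum_congr rfl fun s₁ _ => ?_
    rw [tens, TensorProduct.tmul_smul, map_smul, doubleMul_tmul, cross_comat]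
    simp only [map_sum, map_smul, sandwich_right_tens h, Finset.smul_sum, smul_smul, mul_assoc]
  rw [hL, hR]
  simp only [← Finset.sum_product', Finset.univ_product_univ]
  refine Fintype.sum_equiv ⟨fun (x₄, y₄, s₂, x₃, y₃, s₁, x₂, x₁) =>
    (x₂, s₂, x₁, s₁, x₄, y₄, x₃, y₃), fun (x₂, s₂, x₁, s₁, x₄, y₄, x₃, y₃) =>
    (x₄, y₄, s₂, x₃, y₃, s₁, x₂, x₁), fun _ => rfl, fun _ => rfl⟩ _ _
    fun ⟨x₄, y₄, s₂, x₃, y₃, s₁, x₂, x₁⟩ => ?_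
  dsimp only [Equiv.coe_fn_mk]
  congr 1
  -- Summands violating evenness vanish on both sides. For the others the parity equations eliminate
  -- three of the summation parities, and the signs then agree.
  by_cases e1 : C.p x₁ + C.p x₃ = E.p y + E.p y₃
  swap
  · rw [(evenOn_of_isEvenPairing hσ.even C E).pairMat_eq_zero e1]; ring
  by_cases e2 : C.p x₄ + C.p x₂ = E.p y₄ + E.p y'
  swap
  · rw [copairMat_eq_zero hσ' e2]; ring
  by_cases e3 : C.p x + C.p x₁ = E'.p s + E'.p s₁
  swap
  · rw [(evenOn_of_isEvenPairing hσ.even C E').pairMat_eq_zero e3]; ring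
  have e : E'.p s * (E.p y + E.p y') + C.p x * ((E.p y + E'.p s) + (E.p y' + E'.p s')) =
      C.p x * (E'.p s + E'.p s') + (C.p x₁ + C.p x₂) * E'.p s₁ + C.p x₁ * (E.p y + E.p y') +
        (E'.p s₁ * (E.p y₃ + E.p y₄) + (C.p x₃ + C.p x₄) * E'.p s₁) := by
    have f1 : C.p x₃ = C.p x₁ + E.p y + E.p y₃ := by
      rw [add_assoc, ← e1, ← add_assoc, zmod2_add_self, zero_add]
    have f2 : C.p x₄ = C.p x₂ + E.p y₄ + E.p y' := by
      rw [add_assoc, ← e2, add_comm, add_assoc, zmod2_add_self, add_zero]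
    have f3 : E'.p s₁ = C.p x + C.p x₁ + E'.p s := by
      rw [e3, add_right_comm, zmod2_add_self, zero_add]
    rw [f1, f2, f3]
    generalize C.p x = g₁; generalize C.p x₁ = g₂; generalize C.p x₂ = g₃
    generalize E.p y = g₄; generalize E.p y' = g₅; generalize E.p y₃ = g₆
    generalize E.p y₄ = g₇; generalize E'.p s = g₈; generalize E'.p s' = g₉
    clear * -
    revert g₁ g₂ g₃ g₄ g₅ g₆ g₇ g₈ g₉; decide
  have e' := congrArg (sgn K) e
  rw [sgn_add, sgn_add _ (E'.p s₁ * (E.p y₃ + E.p y₄) + _), sgn_add _ (C.p x₁ * _),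
    sgn_add _ (_ * E'.p s₁)] at e'
  linear_combination (pairMat σ C E' x s x₁ s₁ * pairMat σ C E x₁ y x₃ y₃ *
    (copairMat σ' C E x₄ y₄ x₂ y' * copairMat σ' C E' x₂ s₂ x' s')) * e'

theorem cross_comat_mul (hσ : IsSkewPairing 𝒜 ℬ σ) (hσ' : IsConvInverse 𝒜 ℬ σ σ')
    (h : IsSuperbialgebra 𝒜) (C C' : Comat 𝒜) (E : Comat ℬ) (x x' : C.X)
    (z z' : C'.X) (y y' : E.X) : cross 𝒜 ℬ σ σ' (E.t y y' ⊗ₜ (C.t x x' * C'.t z z')) =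
      doubleMul 𝒜 ℬ σ σ' (cross 𝒜 ℬ σ σ' (E.t y y' ⊗ₜ C.t x x') ⊗ₜ (C'.t z z' ⊗ₜ 1)) := by
  have hL : cross 𝒜 ℬ σ σ' (E.t y y' ⊗ₜ (C.t x x' * C'.t z z')) =
      ∑ x₂, ∑ z₂, ∑ y₄, ∑ x₁, ∑ z₁, ∑ y₃, ∑ y₁, ∑ y₂,
        (sgn K (C'.p z * (C.p x + C.p x')) *
          (sgn K ((C.p x + C'.p z) * (E.p y + E.p y')) *
          ((pairMat σ C E x y x₁ y₁ * pairMat σ C' E z y₁ z₁ y₃) *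
          (copairMat σ' C' E z₂ y₄ z' y₂ * copairMat σ' C E x₂ y₂ x' y')))) •
          tens (mul h C C') E (x₁, z₁) y₃ (x₂, z₂) y₄ := by
    rw [mul_eq_smul h, TensorProduct.tmul_smul, map_smul]
    refine (congrArg _ (cross_comat σ σ' (mul h C C') E (x, z) y (x', z') y')).trans ?_
    rw [Finset.smul_sum]
    refine (Fintype.sum_prod_type _).trans ?_
    refine Finset.sum_congr rfl fun x₂ _ => Finset.sum_congr rfl fun z₂ _ => ?_
    rw [Finset.smul_sum]
    refine Finset.sum_congr rfl fun y₄ _ => ?_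
    rw [Finset.smul_sum]
    refine (Fintype.sum_prod_type _).trans ?_
    refine Finset.sum_congr rfl fun x₁ _ => Finset.sum_congr rfl fun z₁ _ => ?_
    rw [Finset.smul_sum]
    refine Finset.sum_congr rfl fun y₃ _ => ?_
    rw [hσ.mulLeftOn h, copairMat_mulLeft hσ hσ', smul_smul, Finset.sum_mul_sum, Finset.mul_sum,
      Finset.mul_sum, Finset.sum_smul]
    refine Finset.sum_congr rfl fun y₁ _ => ?_
    simp only [Finset.mul_sum, Finset.sum_smul]
    rfl
  have hR : doubleMul 𝒜 ℬ σ σ' (cross 𝒜 ℬ σ σ' (E.t y y' ⊗ₜ C.t x x') ⊗ₜ (C'.t z z' ⊗ₜ 1)) =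
      ∑ x₂, ∑ y₂, ∑ x₁, ∑ y₁, ∑ z₂, ∑ y₄, ∑ z₁, ∑ y₃,
        (sgn K (C.p x * (E.p y + E.p y')) *
          (pairMat σ C E x y x₁ y₁ * copairMat σ' C E x₂ y₂ x' y') *
          (sgn K ((C.p x₁ + C.p x₂) * E.p y₁) * (sgn K (C'.p z * (E.p y₁ + E.p y₂)) *
          (pairMat σ C' E z y₁ z₁ y₃ * copairMat σ' C' E z₂ y₄ z' y₂) *
          sgn K (C'.p z₁ * (C.p x₁ + C.p x₂) + (C.p x₁ + C.p x₂) * E.p y₃)))) •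
          tens (mul h C C') E (x₁, z₁) y₃ (x₂, z₂) y₄ := by
    rw [cross_comat]
    simp only [map_sum, TensorProduct.sum_tmul, ← TensorProduct.smul_tmul', map_smul]
    refine Finset.sum_congr rfl fun x₂ _ => Finset.sum_congr rfl fun y₂ _ =>
      Finset.sum_congr rfl fun x₁ _ => Finset.sum_congr rfl fun y₁ _ => ?_
    rw [tens, ← TensorProduct.smul_tmul', map_smul, doubleMul_tmul, cross_comat]
    simp only [map_sum, map_smul, sandwich_left_tens h, Finset.smul_sum, smul_smul, mul_assoc]
  rw [hL, hR]
  simp only [← Finset.sum_product', Finset.univ_product_univ]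
  refine Fintype.sum_equiv ⟨fun (x₂, z₂, y₄, x₁, z₁, y₃, y₁, y₂) =>
    (x₂, y₂, x₁, y₁, z₂, y₄, z₁, y₃), fun (x₂, y₂, x₁, y₁, z₂, y₄, z₁, y₃) =>
    (x₂, z₂, y₄, x₁, z₁, y₃, y₁, y₂), fun _ => rfl, fun _ => rfl⟩ _ _
    fun ⟨x₂, z₂, y₄, x₁, z₁, y₃, y₁, y₂⟩ => ?_
  dsimp only [Equiv.coe_fn_mk]
  congr 1
  by_cases e1 : C.p x + C.p x₁ = E.p y + E.p y₁
  swap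
  · rw [(evenOn_of_isEvenPairing hσ.even C E).pairMat_eq_zero e1]; ring
  by_cases e2 : C.p x₂ + C.p x' = E.p y₂ + E.p y'
  swap
  · rw [copairMat_eq_zero hσ' e2]; ring
  by_cases e3 : C'.p z + C'.p z₁ = E.p y₁ + E.p y₃
  swap
  · rw [(evenOn_of_isEvenPairing hσ.even C' E).pairMat_eq_zero e3]; ring
  have e : C'.p z * (C.p x + C.p x') + (C.p x + C'.p z) * (E.p y + E.p y') =
      C.p x * (E.p y + E.p y') + (C.p x₁ + C.p x₂) * E.p y₁ + C'.p z * (E.p y₁ + E.p y₂) +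
        (C'.p z₁ * (C.p x₁ + C.p x₂) + (C.p x₁ + C.p x₂) * E.p y₃) := by
    have f1 : C.p x₁ = C.p x + E.p y + E.p y₁ := by
      rw [add_assoc, ← e1, ← add_assoc, zmod2_add_self, zero_add]
    have f2 : C.p x₂ = C.p x' + E.p y₂ + E.p y' := by
      rw [add_assoc, ← e2, add_comm, add_assoc, zmod2_add_self, add_zero]
    have f3 : C'.p z₁ = C'.p z + E.p y₁ + E.p y₃ := by
      rw [add_assoc, ← e3, ← add_assoc, zmod2_add_self, zero_add]
    rw [f1, f2, f3]
    generalize C.p x = g₁; generalize C.p x' = g₂; generalize C'.p z = g₃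
    generalize E.p y = g₄; generalize E.p y' = g₅; generalize E.p y₃ = g₆
    generalize E.p y₁ = g₇; generalize E.p y₂ = g₈
    clear * -
    revert g₁ g₂ g₃ g₄ g₅ g₆ g₇ g₈; decide
  have e' := congrArg (sgn K) e
  rw [sgn_add, sgn_add _ (C'.p z₁ * (C.p x₁ + C.p x₂) + _), sgn_add _ (C'.p z * (E.p y₁ + _)),
    sgn_add _ (_ * E.p y₁)] at e'
  linear_combination (pairMat σ C E x y x₁ y₁ * pairMat σ C' E z y₁ z₁ y₃ *
    (copairMat σ' C' E z₂ y₄ z' y₂ * copairMat σ' C E x₂ y₂ x' y')) * e'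

instance (h : IsSuperbialgebra 𝒜) : Unique (one h).X := inferInstanceAs (Unique Unit)

theorem cross_comat_one (hσ : IsSkewPairing 𝒜 ℬ σ) (hσ' : IsConvInverse 𝒜 ℬ σ σ')
    (h : IsSuperbialgebra ℬ) (C : Comat 𝒜) (x x' : C.X) :
    cross 𝒜 ℬ σ σ' (1 ⊗ₜ C.t x x') = C.t x x' ⊗ₜ 1 := by
  have h1 := pairMat_one_right h hσ.one_right C
  have h2 := IsInv.unique (isInv_of_conv (C := C) (E := one h) hσ'.conv_right)
    (isInv_unit_right (P := pairMat σ C (one h)) h1)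
  have h3 (d d' : (one h).X) : tens C (one h) x d x' d' = C.t x x' ⊗ₜ 1 := by
    change sgn K (_ * 0) • (C.t x x' ⊗ₜ 1) = _
    rw [mul_zero, sgn_zero, one_smul]
  have h4 (d d' : (one h).X) : sgn K (C.p x * ((one h).p d + (one h).p d')) = 1 := by
    change sgn K (_ * (0 + 0)) = 1
    rw [add_zero, mul_zero, sgn_zero]
  refine (cross_comat σ σ' C (one h) x default x' default).trans ?_
  rw [h2]
  simp only [h1, h4, one_mul, Fintype.sum_unique]
  rw [Finset.sum_eq_single x', Finset.sum_eq_single x]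
  · simp [h3]
  · intro a _ ha; simp [ha.symm]
  · simp
  · intro a _ ha; simp [ha]
  · simp

theorem cross_one_comat (hσ : IsSkewPairing 𝒜 ℬ σ) (hσ' : IsConvInverse 𝒜 ℬ σ σ')
    (h : IsSuperbialgebra 𝒜) (E : Comat ℬ) (y y' : E.X) :
    cross 𝒜 ℬ σ σ' (E.t y y' ⊗ₜ 1) = 1 ⊗ₜ E.t y y' := by
  have h1 := pairMat_one_left h hσ.one_left E
  have h2 := IsInv.unique (isInv_of_conv (C := one h) (E := E) hσ'.conv_right)
    (isInv_unit_left (P := pairMat σ (one h) E) h1)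
  have h3 (d d' : (one h).X) : tens (one h) E d y d' y' = 1 ⊗ₜ E.t y y' := by
    change sgn K ((0 + 0) * _) • (1 ⊗ₜ E.t y y') = _
    rw [add_zero, zero_mul, sgn_zero, one_smul]
  have h4 (d : (one h).X) : sgn K ((one h).p d * (E.p y + E.p y')) = 1 := by
    change sgn K (0 * _) = 1
    rw [zero_mul, sgn_zero]
  refine (cross_comat σ σ' (one h) E default y default y').trans ?_
  rw [h2]
  simp only [h1, h4, one_mul, Fintype.sum_unique]
  rw [Finset.sum_eq_single y', Finset.sum_eq_single y]
  · simp [h3]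
  · intro a _ ha; simp [ha.symm]
  · simp
  · intro a _ ha; simp [ha]
  · simp

end Comat

section IsDouble

variable {C : Comat 𝒜} {E : Comat ℬ}

/-- First hexagon identity; with its counterpart for products in A it carries associativity.
Linearity in each argument extends it from comatrix entries to all elements. -/
theorem cross_mul (hC : C.Generates) (hE : E.Generates) (h : IsSuperbialgebra 𝒜)
    (h' : IsSuperbialgebra ℬ) (hσ : IsSkewPairing 𝒜 ℬ σ) (hσ' : IsConvInverse 𝒜 ℬ σ σ')
    (b b' : B) (a : A) : cross 𝒜 ℬ σ σ' ((b * b') ⊗ₜ a) =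
      doubleMul 𝒜 ℬ σ σ' ((1 ⊗ₜ b) ⊗ₜ cross 𝒜 ℬ σ σ' (b' ⊗ₜ a)) := by
  let f : (B ⊗[K] B) ⊗[K] A →ₗ[K] A ⊗[K] B :=
    cross 𝒜 ℬ σ σ' ∘ₗ LinearMap.rTensor A (LinearMap.mul' K B)
  let g : (B ⊗[K] B) ⊗[K] A →ₗ[K] A ⊗[K] B := doubleMul 𝒜 ℬ σ σ' ∘ₗ
    TensorProduct.map (TensorProduct.mk K A B 1) (cross 𝒜 ℬ σ σ') ∘ₗ
      (TensorProduct.assoc K B B A).toLinearMap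
  have hfg : f = g := by
    refine TensorProduct.ext (hE.tensor_ext h' hE h' fun n m y y' s s' => ?_)
    refine hC.linearMap_ext h fun l x x' => ?_
    exact Comat.cross_mul_comat hσ hσ' h' _ _ _ _ _ _ _ _ _
  exact LinearMap.congr_fun hfg ((b ⊗ₜ b') ⊗ₜ a)

theorem cross_tmul_mul (hC : C.Generates) (hE : E.Generates) (h : IsSuperbialgebra 𝒜)
    (h' : IsSuperbialgebra ℬ) (hσ : IsSkewPairing 𝒜 ℬ σ) (hσ' : IsConvInverse 𝒜 ℬ σ σ')
    (b : B) (a a' : A) : cross 𝒜 ℬ σ σ' (b ⊗ₜ (a * a')) =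
      doubleMul 𝒜 ℬ σ σ' (cross 𝒜 ℬ σ σ' (b ⊗ₜ a) ⊗ₜ (a' ⊗ₜ 1)) := by
  let f : B ⊗[K] (A ⊗[K] A) →ₗ[K] A ⊗[K] B :=
    cross 𝒜 ℬ σ σ' ∘ₗ LinearMap.lTensor B (LinearMap.mul' K A)
  let g : B ⊗[K] (A ⊗[K] A) →ₗ[K] A ⊗[K] B := doubleMul 𝒜 ℬ σ σ' ∘ₗ
    TensorProduct.map (cross 𝒜 ℬ σ σ') ((TensorProduct.mk K A B).flip 1) ∘ₗ
      (TensorProduct.assoc K B A A).symm.toLinearMap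
  have hfg : f = g := by
    refine TensorProduct.ext (hE.linearMap_ext h' fun n y y' => ?_)
    refine hC.tensor_ext h hC h fun m l x x' z z' => ?_
    exact Comat.cross_comat_mul hσ hσ' h _ _ _ _ _ _ _ _ _
  exact LinearMap.congr_fun hfg (b ⊗ₜ (a ⊗ₜ a'))

theorem cross_one_tmul (hC : C.Generates) (h : IsSuperbialgebra 𝒜)
    (h' : IsSuperbialgebra ℬ) (hσ : IsSkewPairing 𝒜 ℬ σ) (hσ' : IsConvInverse 𝒜 ℬ σ σ')
    (a : A) : cross 𝒜 ℬ σ σ' (1 ⊗ₜ a) = a ⊗ₜ 1 := by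
  have hfg : cross 𝒜 ℬ σ σ' ∘ₗ TensorProduct.mk K B A 1 = (TensorProduct.mk K A B).flip 1 :=
    hC.linearMap_ext h fun n x x' => Comat.cross_comat_one hσ hσ' h' _ x x'
  exact LinearMap.congr_fun hfg a

theorem cross_tmul_one (hE : E.Generates) (h : IsSuperbialgebra 𝒜)
    (h' : IsSuperbialgebra ℬ) (hσ : IsSkewPairing 𝒜 ℬ σ) (hσ' : IsConvInverse 𝒜 ℬ σ σ')
    (b : B) : cross 𝒜 ℬ σ σ' (b ⊗ₜ 1) = 1 ⊗ₜ b := by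
  have hfg : cross 𝒜 ℬ σ σ' ∘ₗ (TensorProduct.mk K B A).flip 1 = TensorProduct.mk K A B 1 :=
    hE.linearMap_ext h' fun n y y' => Comat.cross_one_comat hσ hσ' h _ y y'
  exact LinearMap.congr_fun hfg b

/-- The outer factors of a product in the double factor out, the inner b' being absorbed into the
cross-multiplication by the hexagon identity. -/
theorem doubleMul_sandwich_left (hm : ∀ (b b' : B) (a : A), cross 𝒜 ℬ σ σ' ((b * b') ⊗ₜ a) =
      doubleMul 𝒜 ℬ σ σ' ((1 ⊗ₜ b) ⊗ₜ cross 𝒜 ℬ σ σ' (b' ⊗ₜ a))) (a a'' : A) (b' b'' : B)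
    (T : A ⊗[K] B) : doubleMul 𝒜 ℬ σ σ' (sandwich a b' T ⊗ₜ (a'' ⊗ₜ b'')) =
      sandwich a b'' (doubleMul 𝒜 ℬ σ σ' (T ⊗ₜ cross 𝒜 ℬ σ σ' (b' ⊗ₜ a''))) := by
  have key (x : A) (y : B) (U : A ⊗[K] B) : doubleMul 𝒜 ℬ σ σ' ((x ⊗ₜ y) ⊗ₜ U) =
      sandwich x 1 (doubleMul 𝒜 ℬ σ σ' ((1 ⊗ₜ y) ⊗ₜ U)) := by
    induction U with
    | zero => simp
    | tmul p r => rw [doubleMul_tmul, doubleMul_tmul, sandwich_sandwich, mul_one, mul_one]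
    | add U V hU hV => simp only [TensorProduct.tmul_add, map_add, hU, hV]
  induction T with
  | zero => simp
  | tmul x y =>
    rw [sandwich_tmul, doubleMul_tmul, hm, key x y, sandwich_sandwich, one_mul]
  | add U V hU hV => simp only [TensorProduct.add_tmul, map_add, hU, hV]

theorem doubleMul_sandwich_right (hm : ∀ (b : B) (a a' : A), cross 𝒜 ℬ σ σ' (b ⊗ₜ (a * a')) =
      doubleMul 𝒜 ℬ σ σ' (cross 𝒜 ℬ σ σ' (b ⊗ₜ a) ⊗ₜ (a' ⊗ₜ 1))) (a a' : A) (b b'' : B)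
    (T : A ⊗[K] B) : doubleMul 𝒜 ℬ σ σ' ((a ⊗ₜ b) ⊗ₜ sandwich a' b'' T) =
      sandwich a b'' (doubleMul 𝒜 ℬ σ σ' (cross 𝒜 ℬ σ σ' (b ⊗ₜ a') ⊗ₜ T)) := by
  have key (p : A) (r : B) (U : A ⊗[K] B) : doubleMul 𝒜 ℬ σ σ' (U ⊗ₜ (p ⊗ₜ r)) =
      sandwich 1 r (doubleMul 𝒜 ℬ σ σ' (U ⊗ₜ (p ⊗ₜ 1))) := by
    induction U with
    | zero => simp
    | tmul x y => rw [doubleMul_tmul, doubleMul_tmul, sandwich_sandwich, one_mul, one_mul]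
    | add U V hU hV => simp only [TensorProduct.add_tmul, map_add, hU, hV]
  induction T with
  | zero => simp
  | tmul x y =>
    rw [sandwich_tmul, doubleMul_tmul, hm, key x y, sandwich_sandwich, mul_one]
  | add U V hU hV => simp only [TensorProduct.tmul_add, map_add, hU, hV]

/-- The multiplication of the generalized double of a convolution invertible skew-pairing is
associative and unital. -/
theorem isDouble (hC : C.Generates) (hE : E.Generates) (h : IsSuperbialgebra 𝒜)
    (h' : IsSuperbialgebra ℬ) (hσ : IsSkewPairing 𝒜 ℬ σ) (hσ' : IsConvInverse 𝒜 ℬ σ σ') :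
    IsDouble 𝒜 ℬ σ σ' where
  one_mul x := by
    induction x with
    | zero => simp
    | tmul a b =>
      rw [doubleMul_tmul, cross_one_tmul hC h h' hσ hσ', sandwich_tmul, one_mul, one_mul]
    | add x y hx hy => simp only [TensorProduct.tmul_add, map_add, hx, hy]
  mul_one x := by
    induction x with
    | zero => simp
    | tmul a b =>
      rw [doubleMul_tmul, cross_tmul_one hE h h' hσ hσ', sandwich_tmul, mul_one, mul_one]
    | add x y hx hy => simp only [TensorProduct.add_tmul, map_add, hx, hy]
  mul_assoc x y z := by
    induction x with
    | zero => simp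
    | add x₁ x₂ h₁ h₂ => simp only [TensorProduct.add_tmul, map_add, h₁, h₂]
    | tmul a b =>
    induction y with
    | zero => simp
    | add x₁ x₂ h₁ h₂ => simp only [TensorProduct.add_tmul, TensorProduct.tmul_add, map_add, h₁, h₂]
    | tmul a' b' =>
    induction z with
    | zero => simp
    | add x₁ x₂ h₁ h₂ => simp only [TensorProduct.tmul_add, map_add, h₁, h₂]
    | tmul a'' b'' =>
    -- On pure tensors both bracketings equal a · [cross(b ⊗ a') cross(b' ⊗ a'')] · b''.
    rw [doubleMul_tmul, doubleMul_tmul,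
      doubleMul_sandwich_left (cross_mul hC hE h h' hσ hσ'),
      doubleMul_sandwich_right (cross_tmul_mul hC hE h h' hσ hσ')]

end IsDouble

end Cross

/-! ### Cross relations in exchange form, and morphisms out of the double -/

section Exchange

variable {K : Type*} [Field K] {X Y : Type*} [Fintype X] [Fintype Y] [DecidableEq X]
  [DecidableEq Y] {M : Type*} [AddCommGroup M] [Module K M]

/-- The relation `P W = V P` amounts to `V = P W P⁻¹`. -/
theorem IsInv.exchange_iff {P Q : X → Y → X → Y → K} (h : IsInv P Q) (W V : X → Y → X → Y → M) :
    (∀ x y x' y', ∑ a, ∑ b, P x y a b • W a b x' y' = ∑ a, ∑ b, P a b x' y' • V x y a b) ↔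
      ∀ x y x' y', V x y x' y' =
        ∑ c, ∑ d, ∑ a, ∑ b, (P x y a b * Q c d x' y') • W a b c d := by
  have single (f : X → Y → M) (x' : X) (y' : Y) :
      ∑ a, ∑ b, (if a = x' ∧ b = y' then (1 : K) else 0) • f a b = f x' y' := by
    rw [Finset.sum_eq_single x', Finset.sum_eq_single y']
    · simp
    · intro b _ hb; simp [hb]
    · simp
    · intro a _ ha; simp [ha]
    · simp
  constructor
  · intro H x y x' y'
    have e : ∑ c, ∑ d, ∑ a, ∑ b, (P x y a b * Q c d x' y') • W a b c d =
        ∑ c, ∑ d, Q c d x' y' • ∑ a, ∑ b, P a b c d • V x y a b := by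
      refine Finset.sum_congr rfl fun c _ => Finset.sum_congr rfl fun d _ => ?_
      rw [← H]
      simp only [Finset.smul_sum, smul_smul, mul_comm]
    rw [e, ← single (fun a b => V x y a b) x' y']
    simp only [show ∀ a b, (if a = x' ∧ b = y' then (1 : K) else 0) =
      ∑ c, ∑ d, P a b c d * Q c d x' y' from fun a b => (h a b x' y').symm, Finset.sum_smul,
      Finset.smul_sum]
    simp only [← Finset.sum_product', Finset.univ_product_univ]
    refine Fintype.sum_equiv ⟨fun (c, d, a, b) => (a, b, c, d), fun (a, b, c, d) => (c, d, a, b),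
      fun _ => rfl, fun _ => rfl⟩ _ _ fun ⟨c, d, a, b⟩ => ?_
    dsimp only [Equiv.coe_fn_mk]
    rw [smul_smul, mul_comm]
  · intro H x y x' y'
    have e : ∑ a, ∑ b, P a b x' y' • V x y a b = ∑ c, ∑ d, (∑ a, ∑ b, Q c d a b * P a b x' y') •
        ∑ e, ∑ f, P x y e f • W e f c d := by
      simp only [H, Finset.sum_smul, Finset.smul_sum]
      simp only [← Finset.sum_product', Finset.univ_product_univ]
      refine Fintype.sum_equiv ⟨fun (a, b, c, d, e, f) => (c, d, e, f, a, b),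
        fun (c, d, e, f, a, b) => (a, b, c, d, e, f),
        fun _ => rfl, fun _ => rfl⟩ _ _ fun ⟨a, b, c, d, e, f⟩ => ?_
      dsimp only [Equiv.coe_fn_mk]
      rw [smul_smul, smul_smul]
      congr 1; ring
    rw [e]
    simp only [h.symm _ _ _ _]
    rw [single (fun c d => ∑ e, ∑ f, P x y e f • W e f c d)]

end Exchange

namespace GenDouble

variable {K : Type*} [Field K] {A : Type*} [Ring A] [Algebra K A]
  {𝒜 : ZMod 2 → Submodule K A} [GradedAlgebra 𝒜] [CoalgebraStruct K A]
  {B : Type*} [Ring B] [Algebra K B] {ℬ : ZMod 2 → Submodule K B} [GradedAlgebra ℬ]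
  [CoalgebraStruct K B] {σ σ' : A ⊗[K] B →ₗ[K] K} (h : IsDouble 𝒜 ℬ σ σ')

/-- Read off from the unit axiom: the product (1 ⊗ 1)(a ⊗ 1) is this cross term between two units.
-/
theorem cross_one_tmul (h : IsDouble 𝒜 ℬ σ σ') (a : A) : cross 𝒜 ℬ σ σ' (1 ⊗ₜ a) = a ⊗ₜ 1 := by
  rw [← sandwich_one (cross 𝒜 ℬ σ σ' (1 ⊗ₜ a)), ← doubleMul_tmul, h.one_mul]

theorem cross_tmul_one (h : IsDouble 𝒜 ℬ σ σ') (b : B) : cross 𝒜 ℬ σ σ' (b ⊗ₜ 1) = 1 ⊗ₜ b := by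
  rw [← sandwich_one (cross 𝒜 ℬ σ σ' (b ⊗ₜ 1)), ← doubleMul_tmul, h.mul_one]

theorem of_mul_of (a a' : A) (b b' : B) : of h (a ⊗ₜ b) * of h (a' ⊗ₜ b') =
    of h (sandwich a b' (cross 𝒜 ℬ σ σ' (b ⊗ₜ a'))) := by
  rw [← doubleMul_tmul]; rfl

/-- The embedding `a ↦ a ⊗ 1`. -/
def inl : A →ₐ[K] GenDouble h := AlgHom.ofLinearMap
  ((of h).toLinearMap ∘ₗ (TensorProduct.mk K A B).flip 1) rfl fun a a' => by
    change of h ((a * a') ⊗ₜ 1) = of h (a ⊗ₜ 1) * of h (a' ⊗ₜ 1)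
    rw [of_mul_of, cross_one_tmul h, sandwich_tmul, one_mul]

/-- The embedding `b ↦ 1 ⊗ b`. -/
def inr : B →ₐ[K] GenDouble h := AlgHom.ofLinearMap
  ((of h).toLinearMap ∘ₗ TensorProduct.mk K A B 1) rfl fun b b' => by
    change of h (1 ⊗ₜ (b * b')) = of h (1 ⊗ₜ b) * of h (1 ⊗ₜ b')
    rw [of_mul_of, cross_tmul_one h, sandwich_tmul, one_mul]

theorem inl_apply (a : A) : inl h a = of h (a ⊗ₜ 1) := rfl

theorem inr_apply (b : B) : inr h b = of h (1 ⊗ₜ b) := rfl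

theorem inl_mul_inr (a : A) (b : B) : inl h a * inr h b = of h (a ⊗ₜ b) := by
  rw [inl_apply, inr_apply, of_mul_of, cross_one_tmul h, sandwich_tmul, mul_one, one_mul]

theorem inr_mul_inl (a : A) (b : B) : inr h b * inl h a = of h (cross 𝒜 ℬ σ σ' (b ⊗ₜ a)) := by
  rw [inl_apply, inr_apply, of_mul_of, sandwich_one]

theorem algHom_ext {T : Type*} [Ring T] [Algebra K T] {f g : GenDouble h →ₐ[K] T}
    (h1 : f.comp (inl h) = g.comp (inl h)) (h2 : f.comp (inr h) = g.comp (inr h)) : f = g := by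
  have key : f.toLinearMap ∘ₗ (of h).toLinearMap = g.toLinearMap ∘ₗ (of h).toLinearMap := by
    ext a b
    change f (of h (a ⊗ₜ b)) = g (of h (a ⊗ₜ b))
    rw [← inl_mul_inr, map_mul, map_mul]
    exact congrArg₂ (· * ·) (DFunLike.congr_fun h1 a) (DFunLike.congr_fun h2 b)
  exact AlgHom.ext fun x => LinearMap.congr_fun key ((of h).symm x)

variable {T : Type*} [Ring T] [Algebra K T] (α : A →ₐ[K] T) (β : B →ₐ[K] T)

/-- The map `a ⊗ b ↦ α(a) β(b)`. -/
def mulMap : A ⊗[K] B →ₗ[K] T :=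
  LinearMap.mul' K T ∘ₗ TensorProduct.map α.toLinearMap β.toLinearMap

theorem mulMap_tmul (a : A) (b : B) : mulMap α β (a ⊗ₜ b) = α a * β b := rfl

theorem mulMap_sandwich (a : A) (b : B) (U : A ⊗[K] B) :
    mulMap α β (sandwich a b U) = α a * mulMap α β U * β b := by
  induction U with
  | zero => simp
  | tmul x y => simp only [sandwich_tmul, mulMap_tmul, map_mul, mul_assoc]
  | add x y hx hy => simp only [map_add, hx, hy, mul_add, add_mul]

/-- A morphism from the double from morphisms on its halves that satisfy the cross relations. -/
def lift (H : ∀ a b, β b * α a = mulMap α β (cross 𝒜 ℬ σ σ' (b ⊗ₜ a))) : GenDouble h →ₐ[K] T :=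
  AlgHom.ofLinearMap (mulMap α β ∘ₗ (of h).symm.toLinearMap)
    (by change mulMap α β (1 ⊗ₜ 1) = 1; rw [mulMap_tmul, map_one, map_one, mul_one])
    (by
      have key (x y : A ⊗[K] B) : mulMap α β (doubleMul 𝒜 ℬ σ σ' (x ⊗ₜ y)) =
          mulMap α β x * mulMap α β y := by
        induction x with
        | zero => simp
        | add x₁ x₂ h₁ h₂ => simp only [TensorProduct.add_tmul, map_add, h₁, h₂, add_mul]
        | tmul a b =>
        induction y with
        | zero => simp
        | add x₁ x₂ h₁ h₂ => simp only [TensorProduct.tmul_add, map_add, h₁, h₂, mul_add]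
        | tmul a' b' =>
        rw [doubleMul_tmul, mulMap_sandwich, ← H, mulMap_tmul, mulMap_tmul]
        simp only [mul_assoc]
      exact fun x y => key _ _)

/-- The cross relations hold if they hold for generating comatrices. -/
theorem mul_eq_mulMap_cross (hA : IsSuperbialgebra 𝒜) (hB : IsSuperbialgebra ℬ) {C : Comat 𝒜}
    (hC : C.Generates) {E : Comat ℬ} (hE : E.Generates) (hσ : IsSkewPairing 𝒜 ℬ σ)
    (hσ' : IsConvInverse 𝒜 ℬ σ σ')
    (H : ∀ x x' y y', β (E.t y y') * α (C.t x x') =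
      mulMap α β (cross 𝒜 ℬ σ σ' (E.t y y' ⊗ₜ C.t x x'))) (a : A) (b : B) :
    β b * α a = mulMap α β (cross 𝒜 ℬ σ σ' (b ⊗ₜ a)) := by
  have h := isDouble hC hE hA hB hσ hσ'
  -- The first hexagon argument extends the relation along powers of C for a fixed generator of B; a
  -- second induction along powers of E then treats all of B with a fixed.
  have step1 (y y' : E.X) (a : A) : β (E.t y y') * α a =
      mulMap α β (cross 𝒜 ℬ σ σ' (E.t y y' ⊗ₜ a)) := by
    have hn : ∀ n x x' y y', β (E.t y y') * α ((Comat.pow hA C n).t x x') =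
        mulMap α β (cross 𝒜 ℬ σ σ' (E.t y y' ⊗ₜ (Comat.pow hA C n).t x x')) := by
      intro n
      induction n with
      | zero =>
        intro x x' y y'
        change β (E.t y y') * α 1 = mulMap α β (cross 𝒜 ℬ σ σ' (E.t y y' ⊗ₜ 1))
        rw [cross_tmul_one h, mulMap_tmul, map_one, one_mul, mul_one]
      | succ n ih =>
        rintro ⟨x, z⟩ ⟨x', z'⟩ y y'
        change β (E.t y y') * α (sgn K _ • (C.t x x' * (Comat.pow hA C n).t z z')) = mulMap α β
          (cross 𝒜 ℬ σ σ' (E.t y y' ⊗ₜ (sgn K _ • (C.t x x' * (Comat.pow hA C n).t z z'))))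
        rw [TensorProduct.tmul_smul, map_smul, map_smul, map_smul, mul_smul_comm,
          cross_tmul_mul hC hE hA hB hσ hσ', map_mul, ← mul_assoc, H, Comat.cross_comat]
        congr 1
        simp only [map_sum, TensorProduct.sum_tmul, ← TensorProduct.smul_tmul', map_smul,
          Finset.sum_mul, smul_mul_assoc]
        refine Finset.sum_congr rfl fun c _ => Finset.sum_congr rfl fun d _ =>
          Finset.sum_congr rfl fun a _ => Finset.sum_congr rfl fun b _ => ?_
        rw [Comat.tens, ← TensorProduct.smul_tmul', map_smul, map_smul, map_smul, doubleMul_tmul,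
          mulMap_sandwich, ← ih, mulMap_tmul, map_one, mul_one, smul_mul_assoc, mul_assoc]
    have e : LinearMap.mulLeft K (β (E.t y y')) ∘ₗ α.toLinearMap =
        mulMap α β ∘ₗ cross 𝒜 ℬ σ σ' ∘ₗ TensorProduct.mk K B A (E.t y y') :=
      hC.linearMap_ext hA fun n x x' => hn n x x' y y'
    exact LinearMap.congr_fun e a
  have hm : ∀ m y y', β ((Comat.pow hB E m).t y y') * α a =
      mulMap α β (cross 𝒜 ℬ σ σ' ((Comat.pow hB E m).t y y' ⊗ₜ a)) := by
    intro m
    induction m with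
    | zero =>
      intro y y'
      change β 1 * α a = mulMap α β (cross 𝒜 ℬ σ σ' (1 ⊗ₜ a))
      rw [cross_one_tmul h, mulMap_tmul, map_one, one_mul, mul_one]
    | succ m ih =>
      rintro ⟨y, s⟩ ⟨y', s'⟩
      change β (sgn K _ • (E.t y y' * (Comat.pow hB E m).t s s')) * α a = mulMap α β
        (cross 𝒜 ℬ σ σ' ((sgn K _ • (E.t y y' * (Comat.pow hB E m).t s s')) ⊗ₜ a))
      have key (U : A ⊗[K] B) : mulMap α β (doubleMul 𝒜 ℬ σ σ' ((1 ⊗ₜ E.t y y') ⊗ₜ U)) =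
          β (E.t y y') * mulMap α β U := by
        induction U with
        | zero => simp
        | add x₁ x₂ h₁ h₂ => simp only [TensorProduct.tmul_add, map_add, h₁, h₂, mul_add]
        | tmul p r =>
          rw [doubleMul_tmul, mulMap_sandwich, ← step1, mulMap_tmul, map_one, one_mul, mul_assoc]
      rw [← TensorProduct.smul_tmul', map_smul, map_smul, map_smul, smul_mul_assoc,
        cross_mul hC hE hA hB hσ hσ', key, ← ih, map_mul, mul_assoc]
  have e : LinearMap.mulRight K (α a) ∘ₗ β.toLinearMap =
      mulMap α β ∘ₗ cross 𝒜 ℬ σ σ' ∘ₗ (TensorProduct.mk K B A).flip a :=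
    hE.linearMap_ext hB fun m y y' => hm m y y'
  exact LinearMap.congr_fun e b

end GenDouble

theorem GenDouble.mulMap_cross_comat {K : Type*} [Field K] {A : Type*} [Ring A] [Algebra K A]
    {𝒜 : ZMod 2 → Submodule K A} [GradedAlgebra 𝒜] [CoalgebraStruct K A]
    {B : Type*} [Ring B] [Algebra K B] {ℬ : ZMod 2 → Submodule K B} [GradedAlgebra ℬ]
    [CoalgebraStruct K B] {σ σ' : A ⊗[K] B →ₗ[K] K} {T : Type*} [Ring T] [Algebra K T]
    (α : A →ₐ[K] T) (β : B →ₐ[K] T) (C : Comat 𝒜) (E : Comat ℬ) (x x' : C.X) (y y' : E.X) :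
    mulMap α β (cross 𝒜 ℬ σ σ' (E.t y y' ⊗ₜ C.t x x')) =
      sgn K (C.p x * (E.p y + E.p y')) • ∑ c, ∑ d, ∑ a, ∑ b,
        (Comat.pairMat σ C E x y a b * Comat.copairMat σ' C E c d x' y') •
          mulMap α β (Comat.tens C E a b c d) := by
  rw [Comat.cross_comat]
  simp only [map_sum, map_smul, Finset.smul_sum, mul_smul]

/-- The cross relations between two comatrices in the form `P W = V P`. -/
theorem GenDouble.cross_relations_iff {K : Type*} [Field K] {A : Type*} [Ring A] [Algebra K A]
    {𝒜 : ZMod 2 → Submodule K A} [GradedAlgebra 𝒜] [CoalgebraStruct K A]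
    {B : Type*} [Ring B] [Algebra K B] {ℬ : ZMod 2 → Submodule K B} [GradedAlgebra ℬ]
    [CoalgebraStruct K B] {σ σ' : A ⊗[K] B →ₗ[K] K} {T : Type*} [Ring T] [Algebra K T]
    (α : A →ₐ[K] T) (β : B →ₐ[K] T) (C : Comat 𝒜) (E : Comat ℬ)
    (hQ : IsInv (Comat.pairMat σ C E) (Comat.copairMat σ' C E)) :
    (∀ x y x' y', ∑ a, ∑ b, Comat.pairMat σ C E x y a b • mulMap α β (Comat.tens C E a b x' y') =
      ∑ a, ∑ b, Comat.pairMat σ C E a b x' y' •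
        (sgn K (C.p x * (E.p y + E.p b)) • (β (E.t y b) * α (C.t x a)))) ↔
    ∀ x x' y y', β (E.t y y') * α (C.t x x') =
      mulMap α β (cross 𝒜 ℬ σ σ' (E.t y y' ⊗ₜ C.t x x')) := by
  refine (IsInv.exchange_iff hQ (fun x y x' y' => mulMap α β (Comat.tens C E x y x' y'))
    fun x y x' y' => sgn K (C.p x * (E.p y + E.p y')) • (β (E.t y y') * α (C.t x x'))).trans ?_
  simp only [mulMap_cross_comat]
  constructor
  · intro h x x' y y'
    rw [← h, smul_smul, sgn_mul_self, one_smul]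
  · intro h x y x' y'
    rw [h, smul_smul, sgn_mul_self, one_smul]

/-! ### The universal property of U(R), and its cross relation inside the double -/

namespace UR

variable {N : ℕ} (D : OspDatum N)

theorem gen_eq_zero {s : Bool} {i j : Fin N} (h : ¬Tri s i j) : gen D s i j = 0 := by
  rw [gen, freeMat, triMat, dif_neg h, map_zero]

theorem gen_mul_gen (s : Bool) (i : Fin N) : gen D s i i * gen D (!s) i i = 1 := by
  rw [gen, gen, ← map_mul, RingQuot.mkAlgHom_rel Kq (Rel.diag s i), map_one]

theorem gen_rll (s : Bool) (i j k l : Fin N) :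
    rllLeft D (gen D s) (gen D s) i j k l = rllRight D (gen D s) (gen D s) i j k l := by
  have h := RingQuot.mkAlgHom_rel Kq (Rel.rll (D := D) s i j k l)
  rwa [map_rllLeft, map_rllRight] at h

theorem gen_cross (i j k l : Fin N) : rllLeft D (gen D true) (gen D false) i j k l =
    rllRight D (gen D true) (gen D false) i j k l := by
  have h := RingQuot.mkAlgHom_rel Kq (Rel.cross (D := D) i j k l)
  rwa [map_rllLeft, map_rllRight] at h

variable {D}

/-- The universal property of `U(R)`. -/
def lift {A : Type*} [Ring A] [Algebra Kq A] (L : Bool → Fin N → Fin N → A)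
    (h0 : ∀ s i j, ¬Tri s i j → L s i j = 0) (hd : ∀ s i, L s i i * L (!s) i i = 1)
    (hr : ∀ s i j k l, rllLeft D (L s) (L s) i j k l = rllRight D (L s) (L s) i j k l)
    (hc : ∀ i j k l, rllLeft D (L true) (L false) i j k l =
      rllRight D (L true) (L false) i j k l) : UR D →ₐ[Kq] A :=
  RingQuot.liftAlgHom Kq ⟨FreeAlgebra.lift Kq fun x : GenAll N => L x.1 x.2.1.1 x.2.1.2, by
    have h1 : ∀ s i j, FreeAlgebra.lift Kq (fun x : GenAll N => L x.1 x.2.1.1 x.2.1.2)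
        (freeMat N s i j) = L s i j := by
      intro s i j
      unfold freeMat triMat
      split_ifs with h
      · simp
      · rw [map_zero, h0 s i j h]
    rintro _ _ (⟨s, i⟩ | ⟨s, i, j, k, l⟩ | ⟨i, j, k, l⟩)
    · rw [map_mul, h1, h1, hd, map_one]
    · rw [map_rllLeft, map_rllRight]
      simp only [h1]
      exact hr s i j k l
    · rw [map_rllLeft, map_rllRight]
      simp only [h1]
      exact hc i j k l⟩

theorem lift_gen {A : Type*} [Ring A] [Algebra Kq A] (L : Bool → Fin N → Fin N → A)
    (h0 : ∀ s i j, ¬Tri s i j → L s i j = 0) (hd : ∀ s i, L s i i * L (!s) i i = 1)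
    (hr : ∀ s i j k l, rllLeft D (L s) (L s) i j k l = rllRight D (L s) (L s) i j k l)
    (hc : ∀ i j k l, rllLeft D (L true) (L false) i j k l =
      rllRight D (L true) (L false) i j k l) (s : Bool) (i j : Fin N) :
    lift L h0 hd hr hc (gen D s i j) = L s i j := by
  rw [gen, lift, RingQuot.liftAlgHom_mkAlgHom_apply, freeMat, triMat]
  split_ifs with h
  · simp
  · rw [map_zero, h0 s i j h]

theorem hom_ext {A : Type*} [Ring A] [Algebra Kq A] {f g : UR D →ₐ[Kq] A}
    (h : ∀ s i j, f (gen D s i j) = g (gen D s i j)) : f = g := by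
  refine RingQuot.ringQuot_ext' Kq f g (FreeAlgebra.hom_ext (funext fun x => ?_))
  have := h x.1 x.2.1.1 x.2.1.2
  rw [gen, freeMat, triMat, dif_pos x.2.2] at this
  exact this

variable (D)

/-- The morphisms `U^±(R) → U(R)`. -/
def ofHalf (s : Bool) : UHalf D s →ₐ[Kq] UR D :=
  UHalf.lift (gen D s) (fun _ _ => gen_eq_zero D) (gen_rll D s)

theorem ofHalf_gen (s : Bool) (i j : Fin N) : ofHalf D s (UHalf.gen D s i j) = gen D s i j :=
  UHalf.lift_gen _ _ _ _ _

theorem ofHalf_mem (s : Bool) {i : ZMod 2} {a : UHalf D s} (ha : a ∈ UHalf.grading D s i) :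
    ofHalf D s a ∈ grading D i := by
  have h : (parity D).comp (ofHalf D s) = (ofHalf D s).comp (UHalf.parity D s) :=
    UHalf.hom_ext fun i j => by
      simp only [AlgHom.comp_apply, ofHalf_gen, parity_gen, UHalf.parity_gen, map_smul]
  refine mem_parityGrading.2 ?_
  have h1 := DFunLike.congr_fun h a
  rw [AlgHom.comp_apply, AlgHom.comp_apply,
    (mem_parityGrading.1 ha : UHalf.parity D s a = _), map_smul] at h1
  exact h1

end UR

namespace OspDatum

variable {N : ℕ} (D : OspDatum N) {σ' : UHalf D true ⊗[Kq] UHalf D false →ₗ[Kq] Kq}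

theorem isDouble_rPairing
    (hσ' : IsConvInverse (UHalf.grading D true) (UHalf.grading D false) D.rPairing σ') :
    IsDouble (UHalf.grading D true) (UHalf.grading D false) D.rPairing σ' :=
  isDouble (UHalf.generates_genComat D true) (UHalf.generates_genComat D false)
    (UHalf.isSuperbialgebra D true) (UHalf.isSuperbialgebra D false) D.isRPairing_rPairing.1 hσ'

/-- The relation `R_12 L^+_1 L^-_2 = L^-_2 L^+_1 R_12` is the cross relation of the double. -/
theorem rll_cross_iff
    (hσ' : IsConvInverse (UHalf.grading D true) (UHalf.grading D false) D.rPairing σ')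
    {T : Type*} [Ring T] [Algebra Kq T] (α : UHalf D true →ₐ[Kq] T) (β : UHalf D false →ₐ[Kq] T) :
    (∀ i j k l, rllLeft D (fun i j => α (UHalf.gen D true i j))
      (fun i j => β (UHalf.gen D false i j)) i j k l =
      rllRight D (fun i j => α (UHalf.gen D true i j))
      (fun i j => β (UHalf.gen D false i j)) i j k l) ↔
    ∀ i j k l : Fin N, β ((UHalf.genComat D false).t k l) * α ((UHalf.genComat D true).t i j) =
      GenDouble.mulMap α β (cross (UHalf.grading D true) (UHalf.grading D false) D.rPairing σ'
        ((UHalf.genComat D false).t k l ⊗ₜ (UHalf.genComat D true).t i j)) := by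
  have hQ : IsInv (Comat.pairMat D.rPairing (UHalf.genComat D true) (UHalf.genComat D false))
    (Comat.copairMat σ' (UHalf.genComat D true) (UHalf.genComat D false)) :=
      Comat.isInv_of_conv hσ'.conv_right
  refine Iff.trans ?_ (GenDouble.cross_relations_iff α β _ _ hQ)
  have hW (i k j l : Fin N) : D.bos (fun i j => α (UHalf.gen D true i j))
      (fun i j => β (UHalf.gen D false i j)) i k j l = GenDouble.mulMap α β
        (Comat.tens (UHalf.genComat D true) (UHalf.genComat D false) i k j l) := by
    change _ = GenDouble.mulMap α β (sgn Kq ((D.par i + D.par j) * D.par k) •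
      ((UHalf.genComat D true).t i j ⊗ₜ (UHalf.genComat D false).t k l))
    rw [bos, UHalf.gen_eq, UHalf.gen_eq, map_smul, map_smul, map_smul, GenDouble.mulMap_tmul,
      smul_mul_smul_comm, smul_smul, ← sgn_add, ← sgn_add]
    congr 2
    generalize D.par i = a; generalize D.par j = b; generalize D.par k = c
    generalize D.par l = d
    revert a b c d; decide
  have hV (i k j l : Fin N) : D.bos (fun i j => β (UHalf.gen D false i j))
      (fun i j => α (UHalf.gen D true i j)) k i l j = sgn Kq (D.par i * (D.par k + D.par l)) •
        (β ((UHalf.genComat D false).t k l) * α ((UHalf.genComat D true).t i j)) := by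
    rw [bos, UHalf.gen_eq, UHalf.gen_eq, map_smul, map_smul,
      smul_mul_smul_comm, smul_smul, ← sgn_add, ← sgn_add]
    congr 2
    generalize D.par i = a; generalize D.par j = b; generalize D.par k = c
    generalize D.par l = d
    revert a b c d; decide
  have hP (i k j l : Fin N) : D.weights.S i k j l = q * Comat.pairMat D.rPairing
      (UHalf.genComat D true) (UHalf.genComat D false) i k j l := by
    rw [congr_fun (congr_fun (congr_fun (congr_fun D.pairMat_rPairing_genComat i) k) j) l,
      mul_inv_cancel_left₀ q_ne_zero]
  -- S is q times the pairing matrix. The common scalar q cancels from both sides, and the RLL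
  -- relation is literally P W = V P.
  simp only [rll_iff, hW, hV, hP, mul_smul, ← Finset.smul_sum,
    (smul_right_injective T q_ne_zero).eq_iff]
  exact ⟨fun h i k j l => h i j k l, fun h i j k l => h i k j l⟩

end OspDatum

/-! ### The quotient of the double and its isomorphism with U(R) -/

section

variable {N : ℕ} {D : OspDatum N} {σ σ' : UHalf D true ⊗[Kq] UHalf D false →ₗ[Kq] Kq}
  (h : IsDouble (UHalf.grading D true) (UHalf.grading D false) σ σ')

namespace DoubleQuot

/-- The quotient map from the double. -/
def mkHom : GenDouble h →ₐ[Kq] DoubleQuot h := RingQuot.mkAlgHom Kq (DiagRel h)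

set_option maxRecDepth 10000 in
theorem mkHom_of (u : UHalf D true ⊗[Kq] UHalf D false) : mkHom h (GenDouble.of h u) = mk h u := (rfl)

set_option maxRecDepth 10000 in
theorem mkHom_rel {x y : GenDouble h} (hr : DiagRel h x y) : mkHom h x = mkHom h y :=
  RingQuot.mkAlgHom_rel Kq hr

/-- The morphisms from `U^±(R)` to the quotient of the double. -/
def ofHalf : (s : Bool) → UHalf D s →ₐ[Kq] DoubleQuot h
  | true => (mkHom h).comp (GenDouble.inl h)
  | false => (mkHom h).comp (GenDouble.inr h)

set_option maxRecDepth 10000 in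
theorem ofHalf_true (a : UHalf D true) : ofHalf h true a = mk h (a ⊗ₜ 1) := (rfl)

set_option maxRecDepth 10000 in
theorem ofHalf_false (b : UHalf D false) : ofHalf h false b = mk h (1 ⊗ₜ b) := (rfl)

theorem mulMap_ofHalf (u : UHalf D true ⊗[Kq] UHalf D false) :
    GenDouble.mulMap (ofHalf h true) (ofHalf h false) u = mk h u := by
  induction u with
  | zero => rw [map_zero, map_zero]
  | add x y hx hy => rw [map_add, map_add, hx, hy]
  | tmul a b =>
    change mkHom h (GenDouble.inl h a) * mkHom h (GenDouble.inr h b) = _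
    rw [← map_mul, GenDouble.inl_mul_inr, mkHom_of]

theorem ofHalf_mul_ofHalf (a : UHalf D true) (b : UHalf D false) :
    ofHalf h false b * ofHalf h true a = GenDouble.mulMap (ofHalf h true) (ofHalf h false)
      (cross (UHalf.grading D true) (UHalf.grading D false) σ σ' (b ⊗ₜ a)) := by
  rw [mulMap_ofHalf]
  change mkHom h (GenDouble.inr h b) * mkHom h (GenDouble.inl h a) = _
  rw [← map_mul, GenDouble.inr_mul_inl, mkHom_of]

theorem ofHalf_diag (s : Bool) (i : Fin N) :
    ofHalf h s (UHalf.gen D s i i) * ofHalf h (!s) (UHalf.gen D (!s) i i) = 1 := by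
  cases s with
  | true =>
    change mkHom h (doublePlus h i i) * mkHom h (doubleMinus h i i) = 1
    rw [← map_mul, ← map_one (mkHom h)]
    exact mkHom_rel h (DiagRel.plus i)
  | false =>
    change mkHom h (doubleMinus h i i) * mkHom h (doublePlus h i i) = 1
    rw [← map_mul, ← map_one (mkHom h)]
    exact mkHom_rel h (DiagRel.minus i)

theorem algHom_ext {T : Type*} [Ring T] [Algebra Kq T] {f g : DoubleQuot h →ₐ[Kq] T}
    (H : ∀ s, f.comp (ofHalf h s) = g.comp (ofHalf h s)) : f = g :=
  RingQuot.ringQuot_ext' Kq f g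
    (GenDouble.algHom_ext h (f := f.comp (mkHom h)) (g := g.comp (mkHom h)) (H true) (H false))

end DoubleQuot

end

namespace OspDatum

variable {N : ℕ} (D : OspDatum N) {σ' : UHalf D true ⊗[Kq] UHalf D false →ₗ[Kq] Kq}

theorem rll_map {s : Bool} {A : Type*} [Ring A] [Algebra Kq A] (f : UHalf D s →ₐ[Kq] A)
    (i j k l : Fin N) : rllLeft D (fun i j => f (UHalf.gen D s i j))
      (fun i j => f (UHalf.gen D s i j)) i j k l =
    rllRight D (fun i j => f (UHalf.gen D s i j)) (fun i j => f (UHalf.gen D s i j)) i j k l := by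
  rw [← map_rllLeft, ← map_rllRight, UHalf.gen_rel]

variable (hσ' : IsConvInverse (UHalf.grading D true) (UHalf.grading D false) D.rPairing σ')

/-- The morphism `D_R → U(R)`. -/
def doubleHom : GenDouble (D.isDouble_rPairing hσ') →ₐ[Kq] UR D :=
  GenDouble.lift _ (UR.ofHalf D true) (UR.ofHalf D false)
    (GenDouble.mul_eq_mulMap_cross _ _
      (UHalf.isSuperbialgebra D true) (UHalf.isSuperbialgebra D false)
      (UHalf.generates_genComat D true) (UHalf.generates_genComat D false)
      D.isRPairing_rPairing.1 hσ' fun i j k l =>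
        (D.rll_cross_iff hσ' _ _).1 (by
          simp only [UR.ofHalf_gen]
          exact UR.gen_cross D) i j k l)

theorem doubleHom_of (a : UHalf D true) (b : UHalf D false) :
    D.doubleHom hσ' (GenDouble.of _ (a ⊗ₜ b)) = UR.ofHalf D true a * UR.ofHalf D false b := rfl

theorem doubleHom_plus (i j : Fin N) :
    D.doubleHom hσ' (doublePlus _ i j) = UR.gen D true i j := by
  refine (D.doubleHom_of hσ' _ _).trans ?_
  rw [map_one, mul_one, UR.ofHalf_gen]

theorem doubleHom_minus (i j : Fin N) :
    D.doubleHom hσ' (doubleMinus _ i j) = UR.gen D false i j := by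
  refine (D.doubleHom_of hσ' _ _).trans ?_
  rw [map_one, one_mul, UR.ofHalf_gen]

theorem doubleHom_eq_of_diagRel {x y} (h : DiagRel (D.isDouble_rPairing hσ') x y) :
    D.doubleHom hσ' x = D.doubleHom hσ' y := by
  cases h with
  | plus i =>
    have h1 : D.doubleHom hσ' 1 = 1 := map_one _
    rw [h1]
    refine (map_mul (D.doubleHom hσ') _ _).trans ?_
    rw [doubleHom_plus, doubleHom_minus]
    exact UR.gen_mul_gen D true i
  | minus i =>
    have h1 : D.doubleHom hσ' 1 = 1 := map_one _
    rw [h1]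
    refine (map_mul (D.doubleHom hσ') _ _).trans ?_
    rw [doubleHom_plus, doubleHom_minus]
    exact UR.gen_mul_gen D false i

/-- The morphism from the quotient of the double to `U(R)`. -/
def quotHom : DoubleQuot (D.isDouble_rPairing hσ') →ₐ[Kq] UR D :=
  RingQuot.liftAlgHom Kq ⟨D.doubleHom hσ', fun _ _ => D.doubleHom_eq_of_diagRel hσ'⟩

theorem quotHom_mk (a : UHalf D true) (b : UHalf D false) :
    D.quotHom hσ' (DoubleQuot.mk _ (a ⊗ₜ b)) = UR.ofHalf D true a * UR.ofHalf D false b := by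
  refine Eq.trans ?_ (D.doubleHom_of hσ' a b)
  exact RingQuot.liftAlgHom_mkAlgHom_apply Kq _ _ _
/-- The morphism from `U(R)` to the quotient of the double. -/
def toQuot : UR D →ₐ[Kq] DoubleQuot (D.isDouble_rPairing hσ') :=
  UR.lift (fun s i j => DoubleQuot.ofHalf (D.isDouble_rPairing hσ') s (UHalf.gen D s i j))
    (fun s i j h => by rw [UHalf.gen_eq_zero D s h, map_zero])
    (DoubleQuot.ofHalf_diag _)
    (fun s => D.rll_map (DoubleQuot.ofHalf (D.isDouble_rPairing hσ') s))
    -- The same equivalence as for `doubleHom`, read backwards: in the double the cross relations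
    -- hold by construction, so the mixed RLL relation holds there.
    ((D.rll_cross_iff hσ' _ _).2 fun _ _ _ _ => DoubleQuot.ofHalf_mul_ofHalf _ _ _)

theorem toQuot_gen (s : Bool) (i j : Fin N) : D.toQuot hσ' (UR.gen D s i j) =
    DoubleQuot.ofHalf (D.isDouble_rPairing hσ') s (UHalf.gen D s i j) :=
  UR.lift_gen _ _ _ _ _ s i j

theorem quotHom_ofHalf (s : Bool) (a : UHalf D s) :
    D.quotHom hσ' (DoubleQuot.ofHalf (D.isDouble_rPairing hσ') s a) = UR.ofHalf D s a := by
  cases s with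
  | true => rw [DoubleQuot.ofHalf_true, quotHom_mk, map_one, mul_one]
  | false => rw [DoubleQuot.ofHalf_false, quotHom_mk, map_one, one_mul]

/-- The quotient of the double is isomorphic to `U(R)`. -/
def quotEquiv : DoubleQuot (D.isDouble_rPairing hσ') ≃ₐ[Kq] UR D :=
  AlgEquiv.ofAlgHom (D.quotHom hσ') (D.toQuot hσ')
    (UR.hom_ext fun s i j => by
      rw [AlgHom.comp_apply, toQuot_gen, quotHom_ofHalf, UR.ofHalf_gen]; rfl)
    (DoubleQuot.algHom_ext _ fun s => UHalf.hom_ext fun i j => by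
      change D.toQuot hσ' (D.quotHom hσ' (DoubleQuot.ofHalf _ s _)) = _
      rw [quotHom_ofHalf, UR.ofHalf_gen, toQuot_gen]
      rfl)

end OspDatum

end
end OspRTT

theorem mainTheorem5 {N : ℕ} (D : OspRTT.OspDatum N) :
    (∃! σ : TensorProduct OspRTT.Kq (OspRTT.UHalf D true) (OspRTT.UHalf D false) →ₗ[OspRTT.Kq]
        OspRTT.Kq, OspRTT.IsRPairing D σ) ∧
    ∀ σ : TensorProduct OspRTT.Kq (OspRTT.UHalf D true) (OspRTT.UHalf D false) →ₗ[OspRTT.Kq]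
        OspRTT.Kq, OspRTT.IsRPairing D σ →
      ∃ σ' : TensorProduct OspRTT.Kq (OspRTT.UHalf D true) (OspRTT.UHalf D false) →ₗ[OspRTT.Kq]
        OspRTT.Kq,
        OspRTT.IsConvInverse (OspRTT.UHalf.grading D true) (OspRTT.UHalf.grading D false) σ σ' ∧
        ∃ h : OspRTT.IsDouble (OspRTT.UHalf.grading D true) (OspRTT.UHalf.grading D false) σ σ',
          ∃ e : OspRTT.DoubleQuot h ≃ₐ[OspRTT.Kq] OspRTT.UR D,
            (∀ i j : Fin N,
              e (OspRTT.DoubleQuot.mk h (OspRTT.UHalf.gen D true i j ⊗ₜ 1)) =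
                OspRTT.UR.gen D true i j) ∧
            (∀ i j : Fin N,
              e (OspRTT.DoubleQuot.mk h (1 ⊗ₜ OspRTT.UHalf.gen D false i j)) =
                OspRTT.UR.gen D false i j) ∧
            ∀ (i j : ZMod 2), ∀ a ∈ OspRTT.UHalf.grading D true i,
              ∀ b ∈ OspRTT.UHalf.grading D false j,
                e (OspRTT.DoubleQuot.mk h (a ⊗ₜ b)) ∈ OspRTT.UR.grading D (i + j) := by
  refine ⟨⟨D.rPairing, D.isRPairing_rPairing, fun σ h => OspRTT.OspDatum.IsRPairing.eq_rPairing h⟩, fun σ h => ?_⟩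
  -- By uniqueness the given pairing is the constructed one, for which the inverse and the
  -- isomorphism are available.
  obtain rfl := OspRTT.OspDatum.IsRPairing.eq_rPairing h
  obtain ⟨σ', hσ'⟩ := D.exists_isConvInverse
  refine ⟨σ', hσ', D.isDouble_rPairing hσ', D.quotEquiv hσ', fun i j => ?_, fun i j => ?_,
    fun i j a ha b hb => ?_⟩
  · refine (D.quotHom_mk hσ' _ _).trans ?_
    rw [map_one, mul_one, OspRTT.UR.ofHalf_gen]
  · refine (D.quotHom_mk hσ' _ _).trans ?_
    rw [map_one, one_mul, OspRTT.UR.ofHalf_gen]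
  · have e : D.quotEquiv hσ' (OspRTT.DoubleQuot.mk _ (a ⊗ₜ b)) = _ := D.quotHom_mk hσ' a b
    rw [e]
    -- The isomorphism is even because a ⊗ b goes to the product of the images of a and b under the
    -- even morphisms U^±(R) → U(R).
    exact SetLike.mul_mem_graded (OspRTT.UR.ofHalf_mem D true ha) (OspRTT.UR.ofHalf_mem D false hb)
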